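/- Let $d\ge 2$ and $m\ge 2$ be integers, and let $1<p_1<p_2<\dots<p_m$ be pairwise coprime integers. Put $$\mathcal S=\{p_1^{\alpha_1}p_2^{\alpha_2}\cdots p_m^{\alpha_m}:\alpha_1,\dots,\alpha_m\in\mathbb Z_{\ge 0}\},\qquad \kappa=\frac{\log d}{m!}\prod_{j=1}^m\frac1{\log p_j}.$$ A multi-base representation of a positive integer $n$ is a finitely supported family of digits $(a_h)_{h\in\mathcal S}$ with $a_h\in\{0,1,\dots,d-1\}$ and $n=\sum_{h\in\mathcal S}a_h h$; its Hamming weight is the number of $h\in\mathcal S$ with $a_h\ne 0$. Every positive integer has only finitely many such representations, and every sufficiently large one has at least one. For such $n$ let $X_n$ be the Hamming weight of a multi-base representation of $n$ chosen uniformly at random, and let $\mu_n$ and $\sigma_n^2$ be the mean and the variance of $X_n$. Then $X_n$ is asymptotically Gaussian, that is, for every real $x$, $$\lim_{n\to\infty}\mathbb P\left(\frac{X_n-\mu_n}{\sigma_n}\le x\right)=\frac1{\sqrt{2\pi}}\int_{-\infty}^x e^{-t^2/2}\,dt,$$ and, as $n\to\infty$, $$\mu_n=\frac{\kappa(d-1)}{d\log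 d}(\log n)^m+O\big((\log n)^{m-1}\log\log n\big),$$ $$\sigma_n^2=\frac{\kappa(d-1)}{d^2\log d}(\log n)^m+O\big((\log n)^{m-1}\log\log n\big),$$ where the implied constants may depend on $d$, $m$ and $p_1,\dots,p_m$. -/

import Mathlib

open Filter Asymptotics MeasureTheory ProbabilityTheory
open scoped Topology

namespace MultiBase

/-- The set of all products `p₁ ^ α₁ * ⋯ * p_m ^ α_m` with exponents `αⱼ ≥ 0`. -/
def powerProducts {m : ℕ} (p : Fin m → ℕ) : Set ℕ :=
  {h | ∃ α : Fin m → ℕ, h = ∏ j, p j ^ α j}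

/-- The multi-base representations of `n` with bases `p` and digits `0, …, d - 1`: each element `h`
of `powerProducts p` gets a digit `a h`, only finitely many digits are non-zero, and the sum of all
`a h * h` is `n`. (Outside `powerProducts p` the function `a` vanishes.) -/
def representations {m : ℕ} (p : Fin m → ℕ) (d n : ℕ) : Set (ℕ →₀ ℕ) :=
  {a | (∀ h ∈ a.support, h ∈ powerProducts p) ∧ (∀ h, a h < d) ∧ (a.sum fun h c => c * h) = n}

/-- The Hamming weight: the number of non-zero digits. -/
def hammingWeight (a : ℕ →₀ ℕ) : ℝ := (a.support.card : ℝ)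

/-- All sets of digit functions are measurable. -/
instance : MeasurableSpace (ℕ →₀ ℕ) := ⊤

/-- The law of a random multi-base representation of `n`, all representations being equally likely.
(It is a probability measure as soon as `n` has a representation.) -/
noncomputable def randomRep {m : ℕ} (p : Fin m → ℕ) (d n : ℕ) : Measure (ℕ →₀ ℕ) :=
  uniformOn (representations p d n)

/-- The mean of the Hamming weight of a random multi-base representation of `n`. -/
noncomputable def meanWeight {m : ℕ} (p : Fin m → ℕ) (d n : ℕ) : ℝ :=
  ∫ a, hammingWeight a ∂(randomRep p d n)

/-- The variance of the Hamming weight of a random multi-base representation of `n`. -/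
noncomputable def varWeight {m : ℕ} (p : Fin m → ℕ) (d n : ℕ) : ℝ :=
  variance hammingWeight (randomRep p d n)

/-- The constant `κ = (log d / m!) * ∏ j, 1 / log p_j`. -/
noncomputable def kappa {m : ℕ} (p : Fin m → ℕ) (d : ℕ) : ℝ :=
  Real.log d / (m.factorial : ℝ) * ∏ j, 1 / Real.log (p j)

end MultiBase

namespace MultiBase

/-! The proof is a saddle-point argument. For `r > 0` let the digits of the power products `h ≤ n`
be independent, the digit `c` of `h` having probability proportional to `exp (-r h c)`. A digit
vector of value `N` then has probability `exp (-r N)` divided by a constant, so conditioning on the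
value `n` gives exactly the uniform law on representations of `n`. Choose `r` such that the mean
value is `n` (`IsSaddle`). Averages over representations become quotients of Fourier integrals over
`[-π, π]` (`repAvg_prod`).

Write `L = log n`. There are `L ^ m / volConst p + O(L ^ (m - 1))` power products up to `n`, and
`O(L ^ (m - 1))` of them in a block of bounded logarithmic length. Hence `n r` and `r² V`, with `V`
the tilted variance of the value, both have order `L ^ (m - 1)`. On `|t| ≤ 2πr` the integrand is
nearly Gaussian at scale `V ^ (-1/2)`. The covariance between value and weight is negligible,
because most non-zero digits sit at `h` far below `1 / r` while the value is governed by `h` near `1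
/ r`.

On the remaining arcs the integral must be `o(r)` with a power to spare
(`exists_integral_minor_le`). With `t = 2πx`, the integrand decays with the number of `h ≤ 1 / r`
for which `x h` is away from the integers. Two coprime bases give at least a constant times `log (1
/ r)` such `h` for every `x`. This pointwise saving is only a small power of `r`; averaging over `x`
along the powers of one base gives almost a full factor `r`. Splitting the exponent between the two
bounds yields `r ^ (1 + δ)`.

The local limit theorem `tendsto_integral_fourierProd`, used with and without the weight variable,
gives the limiting characteristic function, and Lévy's theorem finishes. The moments need more than
weak convergence: `norm_repAvg_prod_le` shows that centred functions of distinct digits are almost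
uncorrelated. So mean and variance differ from their tilted counterparts by `O(L ^ ((m - 1) / 2))`
and `O(L ^ (m - 1))`. The tilted values are sums over `h` of quantities close to `(d - 1) / d` and
`(d - 1) / d ^ 2` unless `h` is at least about `1 / (r L)`; that exceptional window has logarithmic
length `O(log L)`, which is where the `log log n` comes from (`sum_digit_asymp`). -/

/-! ### Lattice points in a simplex. -/

theorem pow_succ_sub_pow_succ_le {a b : ℝ} (hb : 0 ≤ b) (hab : b ≤ a) (m : ℕ) :
    a ^ (m + 1) - b ^ (m + 1) ≤ (m + 1) * (a - b) * a ^ m := by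
  induction m with
  | zero => simp
  | succ m ih =>
    have h1 : b ^ (m + 1) ≤ a ^ (m + 1) := pow_le_pow_left₀ hb hab _
    have ha : 0 ≤ a := hb.trans hab
    have : a ^ (m + 1 + 1) - b ^ (m + 1 + 1)
        = a * (a ^ (m + 1) - b ^ (m + 1)) + (a - b) * b ^ (m + 1) := by ring
    rw [this]
    have h2 := mul_le_mul_of_nonneg_left ih ha
    have h3 := mul_le_mul_of_nonneg_left h1 (sub_nonneg.2 hab)
    push_cast
    calc _ ≤ a * ((m + 1) * (a - b) * a ^ m) + (a - b) * a ^ (m + 1) := by linarith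
      _ = _ := by ring

theorem le_pow_succ_sub_pow_succ {a b : ℝ} (hb : 0 ≤ b) (hab : b ≤ a) (m : ℕ) :
    (m + 1) * (a - b) * b ^ m ≤ a ^ (m + 1) - b ^ (m + 1) := by
  induction m with
  | zero => simp
  | succ m ih =>
    have ha : 0 ≤ a := hb.trans hab
    have h1 : b ^ (m + 1) ≤ a ^ (m + 1) := pow_le_pow_left₀ hb hab _
    have : a ^ (m + 1 + 1) - b ^ (m + 1 + 1)
        = b * (a ^ (m + 1) - b ^ (m + 1)) + (a - b) * a ^ (m + 1) := by ring
    rw [this]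
    have h2 := mul_le_mul_of_nonneg_left ih hb
    have h3 := mul_le_mul_of_nonneg_left h1 (sub_nonneg.2 hab)
    push_cast
    calc _ = b * ((m + 1) * (a - b) * b ^ m) + (a - b) * b ^ (m + 1) := by ring
      _ ≤ _ := by linarith

/-- The number of lattice points in a simplex, compared with its volume. -/
theorem exists_finset_lattice_simplex (m : ℕ) (w : Fin m → ℝ) (hw : ∀ j, 0 < w j) (y : ℝ)
    (hy : 0 ≤ y) :
    ∃ F : Finset (Fin m → ℕ), (∀ α, α ∈ F ↔ ∑ j, (α j : ℝ) * w j ≤ y) ∧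
      y ^ m ≤ m.factorial * (∏ j, w j) * F.card ∧
      m.factorial * (∏ j, w j) * F.card ≤ (y + ∑ j, w j) ^ m := by
  induction m generalizing y with
  | zero =>
    refine ⟨Finset.univ, fun α => ⟨fun _ => by simpa using hy, fun _ => Finset.mem_univ _⟩, by simp, by simp⟩
  | succ m ih =>
    have hw0 := hw 0
    set w' : Fin m → ℝ := fun j => w j.succ with hw'
    have hw'p : ∀ j, 0 < w' j := fun j => hw _
    -- Induct on the dimension by slicing at the first coordinate `k ≤ K`.
    set K := ⌊y / w 0⌋₊ with hK
    have hk : ∀ k, k ∈ Finset.range (K + 1) → 0 ≤ y - k * w 0 := by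
      intro k hk
      have : k ≤ K := by simpa [Nat.lt_succ_iff] using hk
      have := (Nat.le_floor_iff (by positivity)).1 this
      rw [le_div_iff₀ hw0] at this
      linarith
    choose! F hF1 hF2 hF3 using fun k (h : k ∈ Finset.range (K + 1)) => ih w' hw'p _ (hk k h)
    have hinj : ∀ k : ℕ, Function.Injective (fun α : Fin m → ℕ => (Fin.cons k α : Fin (m + 1) → ℕ)) :=
      fun k => Fin.cons_right_injective (α := fun _ => ℕ) k
    let G := (Finset.range (K + 1)).biUnion fun k =>
      (F k).map ⟨fun α => (Fin.cons k α : Fin (m + 1) → ℕ), hinj k⟩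
    have hcard : G.card = ∑ k ∈ Finset.range (K + 1), (F k).card := by
      rw [Finset.card_biUnion]
      · simp
      · intro a _ b _ hab
        rw [Function.onFun, Finset.disjoint_left]
        intro α ha hb
        simp only [Finset.mem_map, Function.Embedding.coeFn_mk] at ha hb
        obtain ⟨x, _, rfl⟩ := ha
        obtain ⟨z, _, hz⟩ := hb
        exact hab (by simpa using (congrFun hz 0).symm)
    have hW : 0 ≤ ∑ j, w' j := Finset.sum_nonneg fun j _ => (hw'p j).le
    refine ⟨G, ?_, ?_, ?_⟩
    · intro α
      rw [Fin.sum_univ_succ]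
      simp only [G, Finset.mem_biUnion, Finset.mem_map, Function.Embedding.coeFn_mk]
      constructor
      · rintro ⟨k, hk', β, hβ, rfl⟩
        have := (hF1 k hk' β).1 hβ
        simp only [Fin.cons_zero, Fin.cons_succ]
        simp only [hw'] at this
        linarith
      · intro h
        have h0 : 0 ≤ ∑ j : Fin m, (α j.succ : ℝ) * w j.succ :=
          Finset.sum_nonneg fun j _ => mul_nonneg (by positivity) (hw _).le
        have hk' : α 0 ∈ Finset.range (K + 1) := by
          rw [Finset.mem_range, Nat.lt_succ_iff, hK, Nat.le_floor_iff (by positivity),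
            le_div_iff₀ hw0]
          linarith
        refine ⟨α 0, hk', Fin.tail α, (hF1 _ hk' _).2 ?_, Fin.cons_self_tail α⟩
        simp only [Fin.tail, hw']
        linarith
    -- Each slice is compared with the increment of the volume over the step below it. Truncation at
    -- `0` makes the telescoping sum end exactly at `0` after the last, partial step.
    · have key : ∀ k ∈ Finset.range (K + 1),
          max 0 (y - k * w 0) ^ (m + 1) - max 0 (y - ((k + 1 : ℕ) : ℝ) * w 0) ^ (m + 1)
            ≤ (m + 1) * w 0 * (m.factorial * (∏ j, w' j) * (F k).card) := by
        intro k hk'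
        have h0 := hk k hk'
        have h2 := hF2 k hk'
        rw [max_eq_right h0]
        have hb : (0:ℝ) ≤ max 0 (y - ((k + 1 : ℕ) : ℝ) * w 0) := le_max_left _ _
        have hb2 : max 0 (y - ((k + 1 : ℕ) : ℝ) * w 0) ≤ y - k * w 0 := by
          refine max_le h0 ?_
          push_cast; linarith
        have hb3 : y - k * w 0 - w 0 ≤ max 0 (y - ((k + 1 : ℕ) : ℝ) * w 0) := by
          refine le_trans ?_ (le_max_right _ _)
          push_cast; linarith
        refine (pow_succ_sub_pow_succ_le hb hb2 m).trans ?_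
        refine mul_le_mul ?_ h2 (by positivity) (by positivity)
        exact mul_le_mul_of_nonneg_left (by linarith) (by positivity)
      have := Finset.sum_le_sum key
      rw [Finset.sum_range_sub' (fun k : ℕ => max 0 (y - (k : ℝ) * w 0) ^ (m + 1))] at this
      have hlast : max 0 (y - ((K + 1 : ℕ) : ℝ) * w 0) = 0 := by
        apply max_eq_left
        have := Nat.lt_floor_add_one (y / w 0)
        rw [div_lt_iff₀ hw0] at this
        push_cast; linarith
      rw [hlast] at this
      simp only [Nat.cast_zero, zero_mul, sub_zero, max_eq_right hy, ne_eq, Nat.add_eq_zero_iff,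
        one_ne_zero, and_false, not_false_eq_true, zero_pow] at this
      refine this.trans (le_of_eq ?_)
      rw [hcard, Fin.prod_univ_succ, Nat.factorial_succ, ← Finset.mul_sum, ← Finset.mul_sum]
      push_cast
      ring
    -- For the upper bound each slice is compared with the step above it. The extra `w 0` in the
    -- shift makes room for this, so the telescoping sum starts at `y` plus all weights.
    · have key : ∀ k ∈ Finset.range (K + 1),
          (m + 1) * w 0 * (m.factorial * (∏ j, w' j) * (F k).card) ≤
          (y - k * w 0 + ∑ j, w' j + w 0) ^ (m + 1) -
            (y - ((k + 1 : ℕ) : ℝ) * w 0 + ∑ j, w' j + w 0) ^ (m + 1) := by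
        intro k hk'
        have h0 := hk k hk'
        have h3 := hF3 k hk'
        have e : y - ((k + 1 : ℕ) : ℝ) * w 0 + ∑ j, w' j + w 0 = y - k * w 0 + ∑ j, w' j := by
          push_cast; ring
        rw [e]
        refine le_trans ?_ (le_pow_succ_sub_pow_succ (by linarith) (by linarith) m)
        rw [add_sub_cancel_left]
        exact mul_le_mul_of_nonneg_left h3 (by positivity)
      have := Finset.sum_le_sum key
      rw [Finset.sum_range_sub' (fun k : ℕ => (y - (k : ℝ) * w 0 + ∑ j, w' j + w 0) ^ (m + 1))] at this
      have hlast : 0 ≤ y - ((K + 1 : ℕ) : ℝ) * w 0 + ∑ j, w' j + w 0 := by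
        have := hk K (by simp)
        push_cast; linarith
      have h5 : 0 ≤ (y - ((K + 1 : ℕ) : ℝ) * w 0 + ∑ j, w' j + w 0) ^ (m + 1) := by positivity
      rw [hcard, Fin.prod_univ_succ, Fin.sum_univ_succ, Nat.factorial_succ]
      rw [← Finset.mul_sum, ← Finset.mul_sum] at this
      push_cast at this h5 ⊢
      simp only [zero_mul, sub_zero] at this
      calc _ = (m + 1) * w 0 * (m.factorial * (∏ j, w' j) * ∑ k ∈ Finset.range (K + 1), ((F k).card : ℝ)) := by
            ring
        _ ≤ (y + ∑ j, w' j + w 0) ^ (m + 1) := by linarith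
        _ = _ := by ring

/-! ### Counting power products. -/

variable {m : ℕ}

/-- The bases need not be prime, but `p j ^ α j` is coprime to the powers of all other bases, so it
divides `p j ^ β j`; this replaces unique factorisation. -/
theorem prod_pow_injective {p : Fin m → ℕ} (hp1 : ∀ j, 1 < p j)
    (hpcop : ∀ i j, i ≠ j → Nat.Coprime (p i) (p j)) :
    Function.Injective fun α : Fin m → ℕ => ∏ j, p j ^ α j := by
  have key : ∀ α β : Fin m → ℕ, ∏ j, p j ^ α j = ∏ j, p j ^ β j → ∀ j, α j ≤ β j := by
    intro α β h j
    have h1 : p j ^ α j ∣ ∏ i, p i ^ β i := h ▸ Finset.dvd_prod_of_mem _ (Finset.mem_univ j)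
    rw [← Finset.mul_prod_erase _ _ (Finset.mem_univ j)] at h1
    have h2 : Nat.Coprime (p j ^ α j) (∏ i ∈ Finset.univ.erase j, p i ^ β i) :=
      Nat.Coprime.prod_right fun i hi =>
        Nat.Coprime.pow _ _ (hpcop _ _ (Finset.ne_of_mem_erase hi).symm)
    exact (Nat.pow_dvd_pow_iff_le_right (hp1 j)).1 (h2.dvd_of_dvd_mul_right h1)
  intro α β h
  exact funext fun j => le_antisymm (key α β h j) (key β α h.symm j)

open Classical in
/-- The power products in `[1, n]`. -/
noncomputable def ppLe (p : Fin m → ℕ) (n : ℕ) : Finset ℕ :=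
  (Finset.Icc 1 n).filter (· ∈ powerProducts p)

theorem mem_ppLe {p : Fin m → ℕ} {n h : ℕ} :
    h ∈ ppLe p n ↔ (1 ≤ h ∧ h ≤ n) ∧ h ∈ powerProducts p := by
  simp [ppLe]

/-- The constant `m! * ∏ j, log (p j)`. -/
noncomputable def volConst (p : Fin m → ℕ) : ℝ := m.factorial * ∏ j, Real.log (p j)

theorem log_pos_of_base {p : Fin m → ℕ} (hp1 : ∀ j, 1 < p j) (j : Fin m) :
    0 < Real.log (p j) := Real.log_pos (by exact_mod_cast hp1 j)

theorem volConst_pos {p : Fin m → ℕ} (hp1 : ∀ j, 1 < p j) : 0 < volConst p :=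
  mul_pos (by positivity) (Finset.prod_pos fun j _ => log_pos_of_base hp1 j)

/-- Taking logarithms identifies the power products up to `exp y` with the lattice points of a
simplex with weights `log (p j)`. -/
theorem card_ppLe_bounds {p : Fin m → ℕ} (hp1 : ∀ j, 1 < p j)
    (hpcop : ∀ i j, i ≠ j → Nat.Coprime (p i) (p j)) {y : ℝ} (hy : 0 ≤ y) :
    y ^ m ≤ volConst p * (ppLe p ⌊Real.exp y⌋₊).card ∧
      volConst p * (ppLe p ⌊Real.exp y⌋₊).card ≤ (y + ∑ j, Real.log (p j)) ^ m := by
  obtain ⟨F, hF, h1, h2⟩ := exists_finset_lattice_simplex m (fun j => Real.log (p j))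
    (log_pos_of_base hp1) y hy
  have hcast : ∀ α : Fin m → ℕ, ((∏ j, p j ^ α j : ℕ) : ℝ)
      = Real.exp (∑ j, (α j : ℝ) * Real.log (p j)) := by
    intro α
    rw [Real.exp_sum]
    push_cast
    refine Finset.prod_congr rfl fun j _ => ?_
    rw [mul_comm, Real.exp_mul, Real.exp_log (by have := hp1 j; positivity), Real.rpow_natCast]
  have : F.card = (ppLe p ⌊Real.exp y⌋₊).card := by
    have : ppLe p ⌊Real.exp y⌋₊ = F.map ⟨_, prod_pow_injective hp1 hpcop⟩ := by
      ext h
      simp only [mem_ppLe, Finset.mem_map, Function.Embedding.coeFn_mk]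
      rw [Nat.le_floor_iff (Real.exp_nonneg _)]
      constructor
      · rintro ⟨⟨_, hle⟩, α, rfl⟩
        refine ⟨α, (hF α).2 ?_, rfl⟩
        rwa [hcast, Real.exp_le_exp] at hle
      · rintro ⟨α, hα, rfl⟩
        refine ⟨⟨Finset.prod_pos fun j _ => pow_pos (zero_lt_one.trans (hp1 j)) _, ?_⟩, α, rfl⟩
        rw [hcast, Real.exp_le_exp]
        exact (hF α).1 hα
    rw [this, Finset.card_map]
  rw [← this]
  exact ⟨h1, h2⟩

/-- The number of power products up to `exp y`. -/
noncomputable def ppCount (p : Fin m → ℕ) (y : ℝ) : ℝ := (ppLe p ⌊Real.exp y⌋₊).card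

theorem ppLe_mono (p : Fin m → ℕ) {a b : ℕ} (h : a ≤ b) : ppLe p a ⊆ ppLe p b := by
  intro x
  simp only [mem_ppLe]
  exact fun hx => ⟨⟨hx.1.1, hx.1.2.trans h⟩, hx.2⟩

theorem ppLe_exp_mono (p : Fin m → ℕ) {x y : ℝ} (h : x ≤ y) :
    ppLe p ⌊Real.exp x⌋₊ ⊆ ppLe p ⌊Real.exp y⌋₊ :=
  ppLe_mono p (Nat.floor_mono (Real.exp_le_exp.2 h))

theorem ppCount_log (p : Fin m → ℕ) {n : ℕ} (hn : 0 < n) :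
    ppCount p (Real.log n) = (ppLe p n).card := by
  rw [ppCount, Real.exp_log (by positivity), Nat.floor_natCast]

theorem mem_ppLe_exp {p : Fin m → ℕ} {y : ℝ} {h : ℕ} :
    h ∈ ppLe p ⌊Real.exp y⌋₊ ↔ (1 ≤ h ∧ (h : ℝ) ≤ Real.exp y) ∧ h ∈ powerProducts p := by
  rw [mem_ppLe, Nat.le_floor_iff (Real.exp_nonneg _)]

theorem summable_exp_neg_abs_int : Summable fun i : ℤ => Real.exp (-|(i : ℝ)|) := by
  have : Summable fun n : ℕ => Real.exp (-(n : ℝ)) := Real.summable_exp_neg_nat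
  apply Summable.of_nat_of_neg
  · simpa using this
  · simpa using this

section
variable {p : Fin m → ℕ} (hp1 : ∀ j, 1 < p j) (hpcop : ∀ i j, i ≠ j → Nat.Coprime (p i) (p j))
include hp1 hpcop

/-- The increment `η` is carried along so that `η = 0` gives the asymptotic count and general `η`
the size of a logarithmic block. -/
theorem ppCount_sub_le :
    ∃ C > 0, ∀ y η : ℝ, 0 ≤ y → 0 ≤ η →
      ppCount p (y + η) - y ^ m / volConst p ≤ C * (η + 1) * (y + η + 1) ^ (m - 1) := by
  have hW : 0 ≤ ∑ j, Real.log (p j) := Finset.sum_nonneg fun j _ => (log_pos_of_base hp1 j).le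
  set W := ∑ j, Real.log (p j)
  have hv := volConst_pos hp1
  -- The summand `1` only keeps the constant positive when `m = 0`.
  refine ⟨m * (1 + W) * (1 + W) ^ (m - 1) / volConst p + 1, by positivity, fun y η hy hη => ?_⟩
  have h := (card_ppLe_bounds hp1 hpcop (add_nonneg hy hη)).2
  have h1 : ppCount p (y + η) ≤ (y + η + W) ^ m / volConst p := by
    rw [le_div_iff₀ hv, mul_comm]; exact h
  rcases Nat.eq_zero_or_pos m with hm | hm
  · subst hm
    simp only [pow_zero] at h1 ⊢
    simp only [CharP.cast_eq_zero, zero_mul, zero_div, zero_add, one_mul, zero_tsub, pow_zero, mul_one]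
    linarith
  obtain ⟨k, rfl⟩ : ∃ k, m = k + 1 := ⟨m - 1, by omega⟩
  have h2 := pow_succ_sub_pow_succ_le hy (show y ≤ y + η + W by linarith) k
  have h3 : (y + η + W) ^ k ≤ ((1 + W) * (y + η + 1)) ^ k := by
    apply pow_le_pow_left₀ (by linarith)
    nlinarith
  have h4 : y + η + W - y ≤ (1 + W) * (η + 1) := by nlinarith
  have h5 : (y + η + W) ^ (k + 1) - y ^ (k + 1)
      ≤ (k + 1) * ((1 + W) * (η + 1)) * ((1 + W) * (y + η + 1)) ^ k := by
    refine h2.trans ?_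
    gcongr
  rw [mul_pow] at h5
  calc _ ≤ ((y + η + W) ^ (k + 1) - y ^ (k + 1)) / volConst p := by rw [sub_div]; linarith
    _ ≤ (k + 1) * ((1 + W) * (η + 1)) * ((1 + W) ^ k * (y + η + 1) ^ k) / volConst p := by gcongr
    _ = (((k + 1 : ℕ) : ℝ) * (1 + W) * (1 + W) ^ (k + 1 - 1) / volConst p) * (η + 1)
          * (y + η + 1) ^ (k + 1 - 1) := by push_cast; ring_nf
    _ ≤ _ := by
      have : 0 ≤ (η + 1) * (y + η + 1) ^ (k + 1 - 1) := by positivity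
      nlinarith

theorem le_ppCount {y : ℝ} (hy : 0 ≤ y) : y ^ m / volConst p ≤ ppCount p y := by
  rw [div_le_iff₀ (volConst_pos hp1), mul_comm]
  exact (card_ppLe_bounds hp1 hpcop hy).1

theorem ppCount_block_le :
    ∃ C > 0, ∀ y η : ℝ, 0 ≤ y → 0 ≤ η →
      ppCount p (y + η) - ppCount p y ≤ C * (η + 1) * (y + η + 1) ^ (m - 1) := by
  obtain ⟨C, hC, h⟩ := ppCount_sub_le hp1 hpcop
  exact ⟨C, hC, fun y η hy hη => by linarith [h y η hy hη, le_ppCount hp1 hpcop hy]⟩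

theorem ppCount_block_ge :
    ∃ B c : ℝ, 0 < B ∧ 0 < c ∧ ∀ y, 2 * B ≤ y →
      c * y ^ (m - 1) ≤ ppCount p y - ppCount p (y - B) ∨ m = 0 := by
  have hW : 0 ≤ ∑ j, Real.log (p j) := Finset.sum_nonneg fun j _ => (log_pos_of_base hp1 j).le
  have hv := volConst_pos hp1
  -- In a block of length `W + 2` the part `W` absorbs the shift in the upper lattice bound, and a
  -- gain of length `2` remains. For `m = 0` the only power product is `1`, hence the exceptional
  -- alternative.
  refine ⟨(∑ j, Real.log (p j)) + 2, m * 2 * (1 / 2) ^ (m - 1) / volConst p + (if m = 0 then 1 else 0),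
    by positivity, ?_, fun y hy => ?_⟩
  · split_ifs with h
    · positivity
    · have : 0 < m := Nat.pos_of_ne_zero h
      positivity
  set W := ∑ j, Real.log (p j)
  rcases Nat.eq_zero_or_pos m with hm | hm
  · exact Or.inr hm
  left
  rw [if_neg hm.ne', add_zero]
  have h1 := le_ppCount hp1 hpcop (show 0 ≤ y by linarith)
  have h2 := (card_ppLe_bounds hp1 hpcop (show 0 ≤ y - (W + 2) by linarith)).2
  have h3 : ppCount p (y - (W + 2)) ≤ (y - 2) ^ m / volConst p := by
    rw [le_div_iff₀ hv, mul_comm]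
    refine h2.trans (le_of_eq ?_)
    congr 1
    ring
  obtain ⟨k, rfl⟩ : ∃ k, m = k + 1 := ⟨m - 1, by omega⟩
  have h4 := le_pow_succ_sub_pow_succ (show 0 ≤ y - 2 by linarith) (show y - 2 ≤ y by linarith) k
  have h5 : (1 / 2 * y) ^ k ≤ (y - 2) ^ k := pow_le_pow_left₀ (by linarith) (by linarith) k
  rw [mul_pow] at h5
  simp only [add_tsub_cancel_right]
  calc _ = (k + 1) * 2 * ((1 / 2) ^ k * y ^ k) / volConst p := by push_cast; ring
    _ ≤ (y ^ (k + 1) - (y - 2) ^ (k + 1)) / volConst p := by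
      gcongr
      refine le_trans ?_ h4
      rw [sub_sub_cancel]
      gcongr
    _ ≤ _ := by rw [sub_div]; linarith

/-- In terms of `log (h r)` the summand decays exponentially on both sides of `0`, and each unit
window contains `O((log n) ^ (m - 1))` power products. A geometric series results, uniformly in `r`.
-/
theorem sum_min_le :
    ∃ C > 0, ∀ n : ℕ, 1 ≤ Real.log n → ∀ r : ℝ, 0 < r →
      ∑ h ∈ ppLe p n, min (h * r) (h * r)⁻¹ ≤ C * Real.log n ^ (m - 1) := by
  obtain ⟨C, hC, hblock⟩ := ppCount_block_le hp1 hpcop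
  set T := ∑' i : ℤ, Real.exp (-|(i : ℝ)|)
  have hT : 0 ≤ T := tsum_nonneg fun _ => Real.exp_nonneg _
  refine ⟨Real.exp 1 * (C * 3 * 4 ^ (m - 1) + 1) * T + 1, by positivity, fun n hn r hr => ?_⟩
  set L := Real.log n
  set f : ℕ → ℤ := fun h => ⌊Real.log (h * r)⌋
  set I := (ppLe p n).image f
  have hL1 : 1 ≤ L ^ (m - 1) := one_le_pow₀ hn
  have hcard : ∀ i ∈ I, (((ppLe p n).filter (f · = i)).card : ℝ) ≤ (C * 3 * 4 ^ (m - 1) + 1) * L ^ (m - 1) := by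
    intro i hi
    obtain ⟨h0, hh0, hi0⟩ := Finset.mem_image.1 hi
    set y := (i : ℝ) - Real.log r with hy
    have hfib : ∀ h ∈ ppLe p n, f h = i → y ≤ Real.log h ∧ Real.log h < y + 1 := by
      intro h hh hfi
      have hpos : (0 : ℝ) < h := by
        have := (mem_ppLe.1 hh).1.1
        positivity
      have := Int.floor_eq_iff.1 hfi
      rw [Real.log_mul hpos.ne' hr.ne'] at this
      constructor <;> linarith [this.1, this.2]
    have hlogle : ∀ h ∈ ppLe p n, Real.log h ≤ L := by
      intro h hh
      obtain ⟨⟨h1, h2⟩, _⟩ := mem_ppLe.1 hh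
      exact Real.log_le_log (by positivity) (by exact_mod_cast h2)
    -- The block count needs a non-negative left end and excludes it. Starting one unit early keeps
    -- `log h = y` inside; the element `1` can still fall on the end `0` and is added separately.
    set z := max 0 (y - 1) with hz
    have hz0 : 0 ≤ z := le_max_left _ _
    have hzL : z ≤ L := max_le (by linarith) (by linarith [(hfib h0 hh0 hi0).1, hlogle h0 hh0])
    have hsub : (ppLe p n).filter (f · = i) ⊆
        insert 1 (ppLe p ⌊Real.exp (z + 2)⌋₊ \ ppLe p ⌊Real.exp z⌋₊) := by
      intro h hh
      obtain ⟨hh, hfi⟩ := Finset.mem_filter.1 hh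
      obtain ⟨⟨h1, h2⟩, h3⟩ := mem_ppLe.1 hh
      have hpos : (0 : ℝ) < h := by positivity
      rw [Finset.mem_insert, Finset.mem_sdiff, mem_ppLe_exp, mem_ppLe_exp]
      by_cases h1' : h = 1
      · exact Or.inl h1'
      right
      have hlog : 0 < Real.log h := Real.log_pos (by exact_mod_cast (by omega : 1 < h))
      obtain ⟨g1, g2⟩ := hfib h hh hfi
      refine ⟨⟨⟨h1, ?_⟩, h3⟩, fun hcon => ?_⟩
      · rw [← Real.log_le_iff_le_exp hpos]
        linarith [le_max_right 0 (y - 1)]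
      · have := hcon.1.2
        rw [← Real.log_le_iff_le_exp hpos] at this
        rcases max_choice 0 (y - 1) with hc | hc
        · rw [hz, hc] at this; linarith
        · rw [hz, hc] at this; linarith
    have h1 := Finset.card_le_card hsub
    have h2 := (h1.trans (Finset.card_insert_le _ _))
    rw [Finset.card_sdiff_of_subset (ppLe_exp_mono p (by linarith))] at h2
    have h3 : (((ppLe p n).filter (f · = i)).card : ℝ) ≤ ppCount p (z + 2) - ppCount p z + 1 := by
      rw [ppCount, ppCount, ← Nat.cast_sub (Finset.card_le_card (ppLe_exp_mono p (by linarith)))]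
      exact_mod_cast h2
    have h4 := hblock z 2 hz0 (by norm_num)
    have h5 : (z + 2 + 1) ^ (m - 1) ≤ (4 * L) ^ (m - 1) :=
      pow_le_pow_left₀ (by linarith) (by linarith) _
    rw [mul_pow] at h5
    have h6 := mul_le_mul_of_nonneg_left h5 (show 0 ≤ C * (2 + 1) by positivity)
    nlinarith
  calc ∑ h ∈ ppLe p n, min (h * r) (h * r)⁻¹
      ≤ ∑ h ∈ ppLe p n, Real.exp 1 * Real.exp (-|(f h : ℝ)|) := by
        refine Finset.sum_le_sum fun h hh => ?_
        have hpos : (0 : ℝ) < h * r := by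
          have := (mem_ppLe.1 hh).1.1
          positivity
        rw [← Real.exp_add]
        set u := Real.log (h * r) with hu
        have hfl : (f h : ℝ) ≤ u := Int.floor_le _
        have hfl2 : u < f h + 1 := Int.lt_floor_add_one _
        have e1 : (h : ℝ) * r = Real.exp u := (Real.exp_log hpos).symm
        rw [e1, ← Real.exp_neg]
        have : |(f h : ℝ)| ≤ |u| + 1 := by
          have : |(f h : ℝ)| ≤ |u| + |(f h : ℝ) - u| := by
            simpa using abs_add_le u ((f h : ℝ) - u)
          have : |(f h : ℝ) - u| ≤ 1 := by rw [abs_le]; constructor <;> linarith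
          linarith
        rcases abs_cases u with ⟨h1, h2⟩ | ⟨h1, h2⟩
        · exact (min_le_right _ _).trans (Real.exp_le_exp.2 (by linarith))
        · exact (min_le_left _ _).trans (Real.exp_le_exp.2 (by linarith))
    _ = ∑ i ∈ I, ∑ h ∈ (ppLe p n).filter (f · = i), Real.exp 1 * Real.exp (-|(f h : ℝ)|) := by
        rw [Finset.sum_fiberwise_of_maps_to]
        exact fun h hh => Finset.mem_image_of_mem _ hh
    _ ≤ ∑ i ∈ I, (Real.exp 1 * (C * 3 * 4 ^ (m - 1) + 1) * L ^ (m - 1)) * Real.exp (-|(i : ℝ)|) := by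
        refine Finset.sum_le_sum fun i hi => ?_
        rw [Finset.sum_congr rfl (g := fun _ => Real.exp 1 * Real.exp (-|(i : ℝ)|))
          (fun h hh => by rw [(Finset.mem_filter.1 hh).2])]
        rw [Finset.sum_const, nsmul_eq_mul]
        calc _ ≤ (C * 3 * 4 ^ (m - 1) + 1) * L ^ (m - 1) * (Real.exp 1 * Real.exp (-|(i : ℝ)|)) := by
              gcongr
              exact hcard i hi
          _ = _ := by ring
    _ ≤ (Real.exp 1 * (C * 3 * 4 ^ (m - 1) + 1) * L ^ (m - 1)) * T := by
        rw [← Finset.mul_sum]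
        gcongr
        exact summable_exp_neg_abs_int.sum_le_tsum _ fun _ _ => Real.exp_nonneg _
    _ ≤ _ := by nlinarith

end

/-! ### Characteristic functions of finitely supported laws. -/

section weights

variable {d : ℕ} {w : ℕ → ℝ}

theorem norm_exp_mul_I_sub_taylor_two_le (x : ℝ) :
    ‖Complex.exp (x * Complex.I) - (1 + x * Complex.I - (x : ℂ) ^ 2 / 2)‖ ≤ 4 * |x| ^ 3 := by
  have hn : ‖(x : ℂ) * Complex.I‖ = |x| := by simp
  rcases le_or_gt |x| 1 with h | h
  · have := Complex.norm_exp_sub_sum_le_norm_mul_exp ((x : ℂ) * Complex.I) 3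
    rw [hn] at this
    have e : ∑ k ∈ Finset.range 3, ((x : ℂ) * Complex.I) ^ k / (k.factorial : ℂ)
        = 1 + x * Complex.I - (x : ℂ) ^ 2 / 2 := by
      simp [Finset.sum_range_succ, mul_pow]
      ring
    rw [e] at this
    refine this.trans ?_
    have h3 : Real.exp |x| ≤ 4 := by
      have := Real.exp_one_lt_d9
      have := Real.exp_le_exp.2 h
      linarith
    nlinarith [pow_nonneg (abs_nonneg x) 3]
  · have h1 : ‖Complex.exp (x * Complex.I)‖ = 1 := Complex.norm_exp_ofReal_mul_I x
    have h2 : ‖1 + (x : ℂ) * Complex.I - (x : ℂ) ^ 2 / 2‖ ≤ 1 + |x| + |x| ^ 2 / 2 := by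
      refine (norm_sub_le _ _).trans ?_
      have : ‖(x : ℂ) ^ 2 / 2‖ = |x| ^ 2 / 2 := by simp
      rw [this]
      gcongr
      refine (norm_add_le _ _).trans ?_
      simp
    refine (norm_sub_le _ _).trans ?_
    rw [h1]
    have h4 : |x| ≤ |x| ^ 3 := by nlinarith [sq_nonneg (|x| - 1), sq_nonneg (|x|)]
    have h5 : |x| ^ 2 ≤ |x| ^ 3 := by nlinarith [sq_nonneg (|x|)]
    linarith

theorem abs_exp_neg_sub_one_add_le {x : ℝ} (hx : 0 ≤ x) :
    |Real.exp (-x) - (1 - x)| ≤ x ^ 2 := by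
  rcases le_or_gt x 1 with h | h
  · have := Real.abs_exp_sub_one_sub_id_le (x := -x) (by rwa [abs_neg, abs_of_nonneg hx])
    have e : Real.exp (-x) - (1 - x) = Real.exp (-x) - 1 - -x := by ring
    rw [e]
    simpa using this
  · have h1 : Real.exp (-x) ≤ 1 := Real.exp_le_one_iff.2 (by linarith)
    have h2 := Real.exp_pos (-x)
    rw [abs_le]
    constructor <;> nlinarith

/-- The characteristic function of a centred finitely supported law is close to that of the
Gaussian law with the same variance. -/
theorem norm_charFun_sub_gaussian_le (hw : ∀ c, 0 ≤ w c) (hsum : ∑ c ∈ Finset.range d, w c = 1)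
    (Z : ℕ → ℝ) (hZ : ∑ c ∈ Finset.range d, w c * Z c = 0) :
    ‖∑ c ∈ Finset.range d, (w c : ℂ) * Complex.exp (Z c * Complex.I)
        - (Real.exp (-(∑ c ∈ Finset.range d, w c * Z c ^ 2) / 2) : ℂ)‖
      ≤ 4 * ∑ c ∈ Finset.range d, w c * |Z c| ^ 3
        + (∑ c ∈ Finset.range d, w c * Z c ^ 2) ^ 2 := by
  set v := ∑ c ∈ Finset.range d, w c * Z c ^ 2
  have hv : 0 ≤ v := Finset.sum_nonneg fun c _ => mul_nonneg (hw c) (sq_nonneg _)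
  -- Centring kills the linear term, so the averaged Taylor polynomial is `1 - v / 2`, which also
  -- starts the expansion of the Gaussian factor.
  have e1 : ∑ c ∈ Finset.range d, (w c : ℂ) * (1 + Z c * Complex.I - (Z c : ℂ) ^ 2 / 2)
      = ((1 - v / 2 : ℝ) : ℂ) := by
    have : ∑ c ∈ Finset.range d, (w c : ℂ) * (1 + Z c * Complex.I - (Z c : ℂ) ^ 2 / 2)
        = ((∑ c ∈ Finset.range d, w c : ℝ) : ℂ)
          + ((∑ c ∈ Finset.range d, w c * Z c : ℝ) : ℂ) * Complex.I - (v : ℂ) / 2 := by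
      simp only [v]
      push_cast
      rw [Finset.sum_mul, Finset.sum_div, ← Finset.sum_add_distrib, ← Finset.sum_sub_distrib]
      exact Finset.sum_congr rfl fun c _ => by ring
    rw [this, hsum, hZ]
    push_cast
    ring
  have e2 : ∑ c ∈ Finset.range d, (w c : ℂ) * Complex.exp (Z c * Complex.I)
        - (Real.exp (-v / 2) : ℂ)
      = ∑ c ∈ Finset.range d, (w c : ℂ) * (Complex.exp (Z c * Complex.I)
          - (1 + Z c * Complex.I - (Z c : ℂ) ^ 2 / 2))
        - ((Real.exp (-(v / 2)) - (1 - v / 2) : ℝ) : ℂ) := by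
    simp only [mul_sub (w _ : ℂ) (Complex.exp _), Finset.sum_sub_distrib]
    rw [e1, neg_div]
    push_cast
    ring
  rw [e2]
  refine (norm_sub_le _ _).trans (add_le_add ?_ ?_)
  · refine (norm_sum_le _ _).trans ?_
    rw [Finset.mul_sum]
    refine Finset.sum_le_sum fun c _ => ?_
    rw [norm_mul, Complex.norm_real, Real.norm_of_nonneg (hw c)]
    have := mul_le_mul_of_nonneg_left (norm_exp_mul_I_sub_taylor_two_le (Z c)) (hw c)
    linarith
  · rw [Complex.norm_real, Real.norm_eq_abs]
    refine (abs_exp_neg_sub_one_add_le (by positivity)).trans ?_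
    nlinarith

/-- The square of the norm is `(a + b) ^ 2 - 2 a b (1 - cos (y - x))`; because `a + b ≤ 1`, it is at
most the square of the right-hand side. -/
theorem norm_add_mul_exp_le {a b : ℝ} (ha : 0 ≤ a) (hb : 0 ≤ b) (hab : a + b ≤ 1) (x y : ℝ) :
    ‖(a : ℂ) * Complex.exp (x * Complex.I) + b * Complex.exp (y * Complex.I)‖
      ≤ a + b - a * b * (1 - Real.cos (y - x)) := by
  have hc1 := Real.cos_le_one (y - x)
  have hc2 := Real.neg_one_le_cos (y - x)
  have hR : 0 ≤ a + b - a * b * (1 - Real.cos (y - x)) := by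
    have : a * b * (1 - Real.cos (y - x)) ≤ a * b * 2 := by gcongr; linarith
    nlinarith [mul_nonneg ha hb]
  rw [← abs_of_nonneg hR, ← abs_of_nonneg (norm_nonneg _), ← sq_le_sq]
  have e : ‖(a : ℂ) * Complex.exp (x * Complex.I) + b * Complex.exp (y * Complex.I)‖ ^ 2
      = (a + b) ^ 2 - 2 * (a * b) * (1 - Real.cos (y - x)) := by
    rw [← Complex.normSq_eq_norm_sq, Complex.normSq_apply]
    simp only [Complex.exp_mul_I, Complex.add_re, Complex.mul_re, Complex.ofReal_re,
      Complex.ofReal_im, Complex.add_im, Complex.mul_im, ← Complex.ofReal_cos,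
      ← Complex.ofReal_sin, Complex.I_re, Complex.I_im]
    rw [Real.cos_sub]
    have h1 := Real.sin_sq_add_cos_sq x
    have h2 := Real.sin_sq_add_cos_sq y
    ring_nf
    nlinarith
  rw [e]
  have : 0 ≤ a * b * (1 - Real.cos (y - x)) := by
    apply mul_nonneg (mul_nonneg ha hb); linarith
  nlinarith

/-- The digits `0` and `1` alone provide enough cancellation; the others are estimated trivially.
All decay of the Fourier integrand comes from here. -/
theorem norm_sum_exp_le (hd : 2 ≤ d) (hw : ∀ c, 0 ≤ w c) (hsum : ∑ c ∈ Finset.range d, w c = 1)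
    (θ : ℕ → ℝ) :
    ‖∑ c ∈ Finset.range d, (w c : ℂ) * Complex.exp (θ c * Complex.I)‖
      ≤ Real.exp (-(w 0 * w 1 * (1 - Real.cos (θ 1 - θ 0)))) := by
  obtain ⟨k, rfl⟩ : ∃ k, d = 2 + k := ⟨d - 2, by omega⟩
  rw [Finset.sum_range_add, Finset.sum_range_succ, Finset.sum_range_one] at hsum
  rw [Finset.sum_range_add, Finset.sum_range_succ, Finset.sum_range_one]
  have hrest : 0 ≤ ∑ c ∈ Finset.range k, w (2 + c) := Finset.sum_nonneg fun c _ => hw _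
  have h1 := norm_add_mul_exp_le (hw 0) (hw 1) (by linarith) (θ 0) (θ 1)
  have h2 : ‖∑ c ∈ Finset.range k, (w (2 + c) : ℂ) * Complex.exp (θ (2 + c) * Complex.I)‖
      ≤ ∑ c ∈ Finset.range k, w (2 + c) := by
    refine (norm_sum_le _ _).trans (Finset.sum_le_sum fun c _ => ?_)
    rw [norm_mul, Complex.norm_exp_ofReal_mul_I, Complex.norm_real, Real.norm_of_nonneg (hw _),
      mul_one]
  refine (norm_add_le _ _).trans ((add_le_add h1 h2).trans ?_)
  have := Real.add_one_le_exp (-(w 0 * w 1 * (1 - Real.cos (θ 1 - θ 0))))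
  linarith

theorem norm_sum_mul_exp_le_one (hw : ∀ c, 0 ≤ w c) (hsum : ∑ c ∈ Finset.range d, w c = 1)
    (Y θ : ℕ → ℝ) (hY1 : ∀ c, |Y c| ≤ 1) :
    ‖∑ c ∈ Finset.range d, (w c : ℂ) * (Y c * Complex.exp (θ c * Complex.I))‖ ≤ 1 := by
  rw [← hsum]
  refine (norm_sum_le _ _).trans (Finset.sum_le_sum fun c _ => ?_)
  rw [norm_mul, norm_mul, Complex.norm_exp_ofReal_mul_I, Complex.norm_real,
    Real.norm_of_nonneg (hw _), Complex.norm_real, Real.norm_eq_abs, mul_one]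
  exact mul_le_of_le_one_right (hw c) (hY1 c)

/-- Since `Y` is centred, `1` may be subtracted from the exponential, which gains a factor `|t|`
times the mean digit. This gain makes different digits almost uncorrelated after conditioning. -/
theorem norm_sum_centred_mul_exp_le (hw : ∀ c, 0 ≤ w c) (Y : ℕ → ℝ) (hY1 : ∀ c, |Y c| ≤ 1)
    (hY : ∑ c ∈ Finset.range d, w c * Y c = 0) (t : ℝ) :
    ‖∑ c ∈ Finset.range d, (w c : ℂ) * (Y c * Complex.exp ((t * c : ℝ) * Complex.I))‖
      ≤ |t| * ∑ c ∈ Finset.range d, w c * c := by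
  have e : ∑ c ∈ Finset.range d, (w c : ℂ) * (Y c * Complex.exp ((t * c : ℝ) * Complex.I))
      = ∑ c ∈ Finset.range d, (w c : ℂ) * (Y c * (Complex.exp (Complex.I * (t * c : ℝ)) - 1)) := by
    have : ∑ c ∈ Finset.range d, (w c : ℂ) * Y c = 0 := by exact_mod_cast hY
    simp only [mul_sub, Finset.sum_sub_distrib, mul_one, this, sub_zero]
    exact Finset.sum_congr rfl fun c _ => by rw [mul_comm Complex.I]
  rw [e, Finset.mul_sum]
  refine (norm_sum_le _ _).trans (Finset.sum_le_sum fun c _ => ?_)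
  rw [norm_mul, norm_mul, Complex.norm_real, Real.norm_of_nonneg (hw _), Complex.norm_real,
    Real.norm_eq_abs]
  have h1 := Real.norm_exp_I_mul_ofReal_sub_one_le (x := t * c)
  rw [Real.norm_eq_abs, abs_mul, Nat.abs_cast] at h1
  calc w c * (|Y c| * ‖Complex.exp (Complex.I * (t * c : ℝ)) - 1‖)
      ≤ w c * (1 * (|t| * c)) := by gcongr; exacts [hw c, hY1 c]
    _ = _ := by ring

end weights

/-! ### The tilted law of a digit -/

/-- The normalising factor of the tilted digit law. -/
noncomputable def digitZ (d : ℕ) (r : ℝ) (h : ℕ) : ℝ :=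
  ∑ c ∈ Finset.range d, Real.exp (-(r * h * c))

/-- The tilted digit law: the digit `c` of `h` has probability proportional to `exp (-r h c)`. -/
noncomputable def digitW (d : ℕ) (r : ℝ) (h c : ℕ) : ℝ := Real.exp (-(r * h * c)) / digitZ d r h

/-- The mean of the tilted digit law. -/
noncomputable def digitMean (d : ℕ) (r : ℝ) (h : ℕ) : ℝ :=
  ∑ c ∈ Finset.range d, digitW d r h c * c

/-- The variance of the tilted digit law. -/
noncomputable def digitVar (d : ℕ) (r : ℝ) (h : ℕ) : ℝ :=
  ∑ c ∈ Finset.range d, digitW d r h c * (c - digitMean d r h) ^ 2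

/-- The probability of a non-zero digit under the tilted digit law. -/
noncomputable def digitQ (d : ℕ) (r : ℝ) (h : ℕ) : ℝ := 1 - digitW d r h 0

/-- The indicator of a non-zero digit. -/
noncomputable def nz (c : ℕ) : ℝ := if c = 0 then 0 else 1

section digits

variable {d : ℕ} {r : ℝ} {h : ℕ}

theorem digitZ_pos (hd : 2 ≤ d) : 0 < digitZ d r h :=
  Finset.sum_pos (fun _ _ => Real.exp_pos _) ⟨0, by simp; omega⟩

theorem one_le_digitZ (hd : 2 ≤ d) : 1 ≤ digitZ d r h := by
  have := Finset.single_le_sum (f := fun c : ℕ => Real.exp (-(r * h * c)))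
    (fun c _ => Real.exp_nonneg _) (show 0 ∈ Finset.range d by simp; omega)
  simpa [digitZ] using this

theorem digitZ_le (hr : 0 ≤ r) : digitZ d r h ≤ d := by
  calc _ ≤ ∑ c ∈ Finset.range d, (1 : ℝ) :=
        Finset.sum_le_sum fun c _ => Real.exp_le_one_iff.2 (by
          have : 0 ≤ r * h * c := by positivity
          linarith)
    _ = d := by simp

theorem digitW_nonneg (hd : 2 ≤ d) (c : ℕ) : 0 ≤ digitW d r h c :=
  div_nonneg (Real.exp_nonneg _) (digitZ_pos hd).le

theorem sum_digitW (hd : 2 ≤ d) : ∑ c ∈ Finset.range d, digitW d r h c = 1 := by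
  simp only [digitW]
  rw [← Finset.sum_div]
  exact div_self (digitZ_pos hd).ne'

theorem digitW_le_one (hd : 2 ≤ d) {c : ℕ} (hc : c < d) : digitW d r h c ≤ 1 := by
  rw [← sum_digitW (r := r) (h := h) hd]
  exact Finset.single_le_sum (fun c _ => digitW_nonneg hd c) (Finset.mem_range.2 hc)

theorem digitW_le (hd : 2 ≤ d) (hr : 0 ≤ r) {c : ℕ} (hc : 1 ≤ c) :
    digitW d r h c ≤ Real.exp (-(r * h)) := by
  rw [digitW, div_le_iff₀ (digitZ_pos hd)]
  have h1 : Real.exp (-(r * h * c)) ≤ Real.exp (-(r * h)) := by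
    apply Real.exp_le_exp.2
    have : (1 : ℝ) ≤ c := by exact_mod_cast hc
    have : 0 ≤ r * h := by positivity
    nlinarith
  nlinarith [one_le_digitZ (r := r) (h := h) hd, Real.exp_pos (-(r * h))]

/-- For `h ≤ 1 / r` the digits `0` and `1` have probabilities bounded below; these `h` supply the
lower bounds for means, variances and decay. -/
theorem le_digitW (hd : 2 ≤ d) (hr : 0 ≤ r) (hrh : r * h ≤ 1) {c : ℕ} (hc : c ≤ 1) :
    Real.exp (-1) / d ≤ digitW d r h c := by
  rw [digitW]
  have h0 : 0 ≤ r * h := by positivity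
  have hc' : (c : ℝ) ≤ 1 := by exact_mod_cast hc
  have hc0 : (0 : ℝ) ≤ c := by positivity
  apply div_le_div₀ (Real.exp_nonneg _) _ (digitZ_pos hd) (digitZ_le hr)
  apply Real.exp_le_exp.2
  nlinarith

theorem digitMean_nonneg (hd : 2 ≤ d) : 0 ≤ digitMean d r h :=
  Finset.sum_nonneg fun c _ => mul_nonneg (digitW_nonneg hd c) (by positivity)

theorem digitMean_le (hd : 2 ≤ d) (hr : 0 ≤ r) :
    digitMean d r h ≤ d ^ 2 * Real.exp (-(r * h)) := by
  calc digitMean d r h ≤ ∑ c ∈ Finset.range d, (d : ℝ) * Real.exp (-(r * h)) := by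
        refine Finset.sum_le_sum fun c hc => ?_
        rcases Nat.eq_zero_or_pos c with rfl | hc1
        · simp; positivity
        · rw [mul_comm]
          have : (c : ℝ) ≤ d := by exact_mod_cast (Finset.mem_range.1 hc).le
          exact mul_le_mul this (digitW_le hd hr hc1) (digitW_nonneg hd c) (by positivity)
    _ = _ := by simp; ring

theorem digitMean_le_d (hd : 2 ≤ d) : digitMean d r h ≤ d := by
  calc digitMean d r h ≤ ∑ c ∈ Finset.range d, digitW d r h c * d := by
        refine Finset.sum_le_sum fun c hc => ?_
        have : (c : ℝ) ≤ d := by exact_mod_cast (Finset.mem_range.1 hc).le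
        exact mul_le_mul_of_nonneg_left this (digitW_nonneg hd c)
    _ = d := by rw [← Finset.sum_mul, sum_digitW hd, one_mul]

theorem digitW_one_le_digitMean (hd : 2 ≤ d) : digitW d r h 1 ≤ digitMean d r h := by
  have := Finset.single_le_sum (f := fun c : ℕ => digitW d r h c * c)
    (fun c _ => mul_nonneg (digitW_nonneg hd c) (by positivity)) (show 1 ∈ Finset.range d by simp; omega)
  simpa [digitMean] using this

theorem sum_digitW_mul_centred (hd : 2 ≤ d) :
    ∑ c ∈ Finset.range d, digitW d r h c * (c - digitMean d r h) = 0 := by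
  simp only [mul_sub, Finset.sum_sub_distrib, ← Finset.sum_mul, sum_digitW hd, one_mul]
  exact sub_self _

theorem sum_digitW_mul_abs_le (hd : 2 ≤ d) :
    ∑ c ∈ Finset.range d, digitW d r h c * |c - digitMean d r h| ≤ 2 * digitMean d r h := by
  have hm := digitMean_nonneg (r := r) (h := h) hd
  calc _ ≤ ∑ c ∈ Finset.range d, (digitW d r h c * c + digitW d r h c * digitMean d r h) := by
        refine Finset.sum_le_sum fun c _ => ?_
        rw [← mul_add]
        refine mul_le_mul_of_nonneg_left ?_ (digitW_nonneg hd c)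
        refine (abs_sub _ _).trans ?_
        rw [Nat.abs_cast, abs_of_nonneg hm]
    _ = _ := by
        rw [Finset.sum_add_distrib, ← Finset.sum_mul, sum_digitW hd]
        simp only [digitMean]
        ring

theorem abs_sub_digitMean_le (hd : 2 ≤ d) {c : ℕ} (hc : c < d) :
    |(c : ℝ) - digitMean d r h| ≤ d := by
  have : (c : ℝ) ≤ d := by exact_mod_cast hc.le
  rw [abs_le]
  constructor <;> linarith [digitMean_nonneg (r := r) (h := h) hd,
    digitMean_le_d (r := r) (h := h) hd, (Nat.cast_nonneg c : (0 : ℝ) ≤ c)]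

theorem sum_digitW_mul_abs_pow_le (hd : 2 ≤ d) (hr : 0 ≤ r) (k : ℕ) :
    ∑ c ∈ Finset.range d, digitW d r h c * |c - digitMean d r h| ^ (k + 1)
      ≤ 2 * d ^ (k + 2) * Real.exp (-(r * h)) := by
  calc _ ≤ ∑ c ∈ Finset.range d, (d : ℝ) ^ k * (digitW d r h c * |c - digitMean d r h|) := by
        refine Finset.sum_le_sum fun c hc => ?_
        have h1 := pow_le_pow_left₀ (abs_nonneg _)
          (abs_sub_digitMean_le (r := r) (h := h) hd (Finset.mem_range.1 hc)) k
        have h2 := mul_le_mul_of_nonneg_right h1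
          (mul_nonneg (digitW_nonneg (r := r) (h := h) hd c) (abs_nonneg (c - digitMean d r h)))
        calc _ = |(c : ℝ) - digitMean d r h| ^ k * (digitW d r h c * |c - digitMean d r h|) := by ring
          _ ≤ _ := h2
    _ ≤ d ^ k * (2 * (d ^ 2 * Real.exp (-(r * h)))) := by
        rw [← Finset.mul_sum]
        gcongr
        exact (sum_digitW_mul_abs_le hd).trans (by linarith [digitMean_le (h := h) hd hr])
    _ = _ := by ring

theorem digitVar_nonneg (hd : 2 ≤ d) : 0 ≤ digitVar d r h :=
  Finset.sum_nonneg fun c _ => mul_nonneg (digitW_nonneg hd c) (sq_nonneg _)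

theorem digitVar_le (hd : 2 ≤ d) (hr : 0 ≤ r) :
    digitVar d r h ≤ 2 * d ^ 3 * Real.exp (-(r * h)) := by
  have := sum_digitW_mul_abs_pow_le (h := h) hd hr 1
  simpa [digitVar] using this

theorem le_digitVar (hd : 2 ≤ d) : digitW d r h 0 * digitW d r h 1 ≤ digitVar d r h := by
  set μ := digitMean d r h
  have h0 : 0 ≤ digitW d r h 0 := digitW_nonneg hd 0
  have h1 : 0 ≤ digitW d r h 1 := digitW_nonneg hd 1
  have hsub : Finset.range 2 ⊆ Finset.range d := Finset.range_subset_range.2 hd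
  have hs : digitW d r h 0 + digitW d r h 1 ≤ 1 := by
    rw [← sum_digitW (r := r) (h := h) hd]
    have := Finset.sum_le_sum_of_subset_of_nonneg (f := digitW d r h) hsub
      (fun c _ _ => digitW_nonneg hd c)
    simpa [Finset.sum_range_succ] using this
  have hv : digitW d r h 0 * μ ^ 2 + digitW d r h 1 * (1 - μ) ^ 2 ≤ digitVar d r h := by
    have := Finset.sum_le_sum_of_subset_of_nonneg
      (f := fun c : ℕ => digitW d r h c * (c - digitMean d r h) ^ 2) hsub
      (fun c _ _ => mul_nonneg (digitW_nonneg hd c) (sq_nonneg _))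
    simpa [Finset.sum_range_succ, digitVar] using this
  refine le_trans ?_ hv
  have hA : 0 ≤ digitW d r h 0 * μ ^ 2 + digitW d r h 1 * (1 - μ) ^ 2 := by positivity
  -- For weights `a`, `b` one has `(a + b) (a μ² + b (1 - μ)²) = a b + (a μ - b (1 - μ))²`, and `a +
  -- b ≤ 1`.
  nlinarith [sq_nonneg (digitW d r h 0 * μ - digitW d r h 1 * (1 - μ))]

theorem digitQ_nonneg (hd : 2 ≤ d) : 0 ≤ digitQ d r h :=
  sub_nonneg.2 (digitW_le_one hd (by omega))

theorem digitQ_le_one (hd : 2 ≤ d) : digitQ d r h ≤ 1 := by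
  have := digitW_nonneg (r := r) (h := h) hd 0
  rw [digitQ]; linarith

theorem abs_nz_sub_digitQ_le (hd : 2 ≤ d) (c : ℕ) : |nz c - digitQ d r h| ≤ 1 := by
  have h1 := digitQ_nonneg (r := r) (h := h) hd
  have h2 := digitQ_le_one (r := r) (h := h) hd
  rw [nz, abs_le]
  split_ifs <;> constructor <;> linarith

theorem sum_digitW_mul_nz (hd : 2 ≤ d) :
    ∑ c ∈ Finset.range d, digitW d r h c * nz c = digitQ d r h := by
  obtain ⟨k, rfl⟩ : ∃ k, d = k + 1 := ⟨d - 1, by omega⟩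
  rw [digitQ, ← sum_digitW (r := r) (h := h) hd, Finset.sum_range_succ', Finset.sum_range_succ']
  simp [nz]

theorem sum_digitW_mul_nz_sub (hd : 2 ≤ d) :
    ∑ c ∈ Finset.range d, digitW d r h c * (nz c - digitQ d r h) = 0 := by
  simp only [mul_sub, Finset.sum_sub_distrib, ← Finset.sum_mul, sum_digitW hd, one_mul,
    sum_digitW_mul_nz hd, sub_self]

theorem sum_digitW_mul_nz_sub_sq (hd : 2 ≤ d) :
    ∑ c ∈ Finset.range d, digitW d r h c * (nz c - digitQ d r h) ^ 2
      = digitQ d r h * (1 - digitQ d r h) := by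
  have e : ∀ c : ℕ, digitW d r h c * (nz c - digitQ d r h) ^ 2
      = digitW d r h c * nz c * (1 - 2 * digitQ d r h) + digitW d r h c * digitQ d r h ^ 2 := by
    intro c
    have : nz c ^ 2 = nz c := by rw [nz]; split_ifs <;> simp
    calc _ = digitW d r h c * (nz c ^ 2 - 2 * nz c * digitQ d r h + digitQ d r h ^ 2) := by ring
      _ = _ := by rw [this]; ring
  simp only [e, Finset.sum_add_distrib, ← Finset.sum_mul, sum_digitW hd, sum_digitW_mul_nz hd]
  ring

/-- For small `r h` the digit is nearly uniform: the normalising factor lies between `d - d² r h`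
and `d`. -/
theorem abs_digitQ_sub_le (hd : 2 ≤ d) (hr : 0 ≤ r) :
    |digitQ d r h - (d - 1) / d| ≤ d * (r * h) := by
  have hZ1 := one_le_digitZ (r := r) (h := h) hd
  have hZd := digitZ_le (d := d) (h := h) hr
  have hd0 : (0 : ℝ) < d := by positivity
  have hlow : d - d ^ 2 * (r * h) ≤ digitZ d r h := by
    calc (d : ℝ) - d ^ 2 * (r * h) = ∑ c ∈ Finset.range d, (1 - r * h * d) := by simp; ring
      _ ≤ _ := by
        refine Finset.sum_le_sum fun c hc => ?_
        have h1 := Real.add_one_le_exp (-(r * h * c))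
        have : (c : ℝ) ≤ d := by exact_mod_cast (Finset.mem_range.1 hc).le
        have : r * h * c ≤ r * h * d := by gcongr
        linarith
  have e : digitQ d r h - (d - 1) / d = -((d - digitZ d r h) / (d * digitZ d r h)) := by
    rw [digitQ, digitW]
    have := (digitZ_pos (r := r) (h := h) hd).ne'
    simp
    field_simp
    ring
  rw [e, abs_neg, abs_of_nonneg (div_nonneg (by linarith) (by positivity)), div_le_iff₀ (by positivity)]
  have h5 : d * (r * h) * d * 1 ≤ d * (r * h) * d * digitZ d r h := by gcongr
  nlinarith

/-- The phase attached to a digit by the joint characteristic function of value and weight. -/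
noncomputable def phase (d : ℕ) (r : ℝ) (t s : ℝ) (h c : ℕ) : ℝ :=
  t * h * (c - digitMean d r h) + s * (nz c - digitQ d r h)

/-- The covariance of the digit and its indicator of being non-zero. -/
noncomputable def digitCov (d : ℕ) (r : ℝ) (h : ℕ) : ℝ :=
  ∑ c ∈ Finset.range d, digitW d r h c * ((c - digitMean d r h) * (nz c - digitQ d r h))

/-- A bound by the mean, rather than by a constant, is needed: after multiplication by `h` and
summation the saddle equation turns it into `2 n`. -/
theorem abs_digitCov_le (hd : 2 ≤ d) : |digitCov d r h| ≤ 2 * digitMean d r h := by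
  refine le_trans ?_ (sum_digitW_mul_abs_le hd)
  refine (Finset.abs_sum_le_sum_abs _ _).trans (Finset.sum_le_sum fun c _ => ?_)
  rw [abs_mul, abs_mul, abs_of_nonneg (digitW_nonneg hd c)]
  refine mul_le_mul_of_nonneg_left ?_ (digitW_nonneg hd c)
  exact mul_le_of_le_one_right (abs_nonneg _) (abs_nz_sub_digitQ_le hd c)

theorem sum_digitW_mul_phase (hd : 2 ≤ d) (t s : ℝ) :
    ∑ c ∈ Finset.range d, digitW d r h c * phase d r t s h c = 0 := by
  have : ∀ c : ℕ, digitW d r h c * phase d r t s h c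
      = t * h * (digitW d r h c * (c - digitMean d r h))
        + s * (digitW d r h c * (nz c - digitQ d r h)) := fun c => by rw [phase]; ring
  simp only [this, Finset.sum_add_distrib, ← Finset.mul_sum, sum_digitW_mul_centred hd,
    sum_digitW_mul_nz_sub hd, mul_zero, add_zero]

theorem sum_digitW_mul_phase_sq (hd : 2 ≤ d) (t s : ℝ) :
    ∑ c ∈ Finset.range d, digitW d r h c * phase d r t s h c ^ 2
      = t ^ 2 * (h ^ 2 * digitVar d r h) + 2 * t * s * (h * digitCov d r h)
        + s ^ 2 * (digitQ d r h * (1 - digitQ d r h)) := by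
  have : ∀ c : ℕ, digitW d r h c * phase d r t s h c ^ 2
      = t ^ 2 * h ^ 2 * (digitW d r h c * (c - digitMean d r h) ^ 2)
        + 2 * t * s * h * (digitW d r h c * ((c - digitMean d r h) * (nz c - digitQ d r h)))
        + s ^ 2 * (digitW d r h c * (nz c - digitQ d r h) ^ 2) := fun c => by rw [phase]; ring
  simp only [this, Finset.sum_add_distrib, ← Finset.mul_sum, sum_digitW_mul_nz_sub_sq hd]
  rw [digitVar, digitCov]
  ring

theorem sum_digitW_mul_phase_cube_le (hd : 2 ≤ d) (hr : 0 ≤ r) (t s : ℝ) :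
    ∑ c ∈ Finset.range d, digitW d r h c * |phase d r t s h c| ^ 3
      ≤ 8 * d ^ 4 * (|t| ^ 3 * (h ^ 3 * Real.exp (-(r * h)))) + 4 * |s| ^ 3 := by
  have h1 : ∀ c : ℕ, digitW d r h c * |phase d r t s h c| ^ 3
      ≤ 4 * |t| ^ 3 * h ^ 3 * (digitW d r h c * |c - digitMean d r h| ^ 3)
        + 4 * |s| ^ 3 * digitW d r h c := by
    intro c
    have hA : |phase d r t s h c| ≤ |t| * h * |c - digitMean d r h| + |s| := by
      rw [phase]
      refine (abs_add_le _ _).trans ?_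
      rw [abs_mul, abs_mul, abs_mul, Nat.abs_cast]
      gcongr
      exact mul_le_of_le_one_right (abs_nonneg _) (abs_nz_sub_digitQ_le hd c)
    set A := |t| * h * |c - digitMean d r h| with hAdef
    have hA0 : 0 ≤ A := by positivity
    have hB : (A + |s|) ^ 3 ≤ 4 * (A ^ 3 + |s| ^ 3) := by
      have hs := abs_nonneg s
      nlinarith [mul_nonneg (add_nonneg hA0 hs) (sq_nonneg (A - |s|))]
    have hC := (pow_le_pow_left₀ (abs_nonneg _) hA 3).trans hB
    calc _ ≤ digitW d r h c * (4 * (A ^ 3 + |s| ^ 3)) :=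
          mul_le_mul_of_nonneg_left hC (digitW_nonneg hd c)
      _ = _ := by rw [hAdef]; ring
  refine (Finset.sum_le_sum fun c _ => h1 c).trans ?_
  rw [Finset.sum_add_distrib, ← Finset.mul_sum, ← Finset.mul_sum, sum_digitW hd]
  have h2 := sum_digitW_mul_abs_pow_le (h := h) hd hr 2
  have h3 : 4 * |t| ^ 3 * h ^ 3 * ∑ c ∈ Finset.range d, digitW d r h c * |c - digitMean d r h| ^ 3
      ≤ 4 * |t| ^ 3 * h ^ 3 * (2 * d ^ 4 * Real.exp (-(r * h))) := by gcongr
  calc _ ≤ 4 * |t| ^ 3 * h ^ 3 * (2 * d ^ 4 * Real.exp (-(r * h))) + 4 * |s| ^ 3 * 1 := by gcongr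
    _ = _ := by ring

theorem sum_digitW_mul_phase_sq_sq_le (hd : 2 ≤ d) (hr : 0 ≤ r) (t s : ℝ) :
    (∑ c ∈ Finset.range d, digitW d r h c * phase d r t s h c ^ 2) ^ 2
      ≤ 32 * d ^ 6 * (|t| ^ 4 * (h ^ 4 * Real.exp (-(r * h)))) + 8 * |s| ^ 4 := by
  have h1 : ∀ c : ℕ, digitW d r h c * phase d r t s h c ^ 2
      ≤ 2 * t ^ 2 * h ^ 2 * (digitW d r h c * (c - digitMean d r h) ^ 2)
        + 2 * s ^ 2 * digitW d r h c := by
    intro c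
    have hq : (nz c - digitQ d r h) ^ 2 ≤ 1 := by
      rw [← sq_abs]; exact pow_le_one₀ (abs_nonneg _) (abs_nz_sub_digitQ_le hd c)
    have : phase d r t s h c ^ 2 ≤ 2 * t ^ 2 * h ^ 2 * (c - digitMean d r h) ^ 2 + 2 * s ^ 2 := by
      have h3 : 2 * s ^ 2 * (nz c - digitQ d r h) ^ 2 ≤ 2 * s ^ 2 * 1 := by gcongr
      rw [phase]
      nlinarith [sq_nonneg (t * h * (c - digitMean d r h) - s * (nz c - digitQ d r h))]
    nlinarith [mul_le_mul_of_nonneg_left this (digitW_nonneg (r := r) (h := h) hd c)]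
  have h2 := Finset.sum_le_sum fun c (_ : c ∈ Finset.range d) => h1 c
  rw [Finset.sum_add_distrib, ← Finset.mul_sum, ← Finset.mul_sum, sum_digitW hd] at h2
  have h0 : 0 ≤ ∑ c ∈ Finset.range d, digitW d r h c * phase d r t s h c ^ 2 :=
    Finset.sum_nonneg fun c _ => mul_nonneg (digitW_nonneg hd c) (sq_nonneg _)
  have h4 := pow_le_pow_left₀ h0 h2 2
  rw [← digitVar] at h4
  refine h4.trans ?_
  have hv := digitVar_le (h := h) hd hr
  have hv0 := digitVar_nonneg (r := r) (h := h) hd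
  have he : Real.exp (-(r * h)) ≤ 1 := Real.exp_le_one_iff.2 (by
    have : 0 ≤ r * h := by positivity
    linarith)
  have he0 := Real.exp_pos (-(r * h))
  have hv2 : digitVar d r h ^ 2 ≤ 4 * d ^ 6 * Real.exp (-(r * h)) := by
    calc _ ≤ (2 * d ^ 3 * Real.exp (-(r * h))) ^ 2 := pow_le_pow_left₀ hv0 hv 2
      _ = 4 * d ^ 6 * (Real.exp (-(r * h)) * Real.exp (-(r * h))) := by ring
      _ ≤ 4 * d ^ 6 * (1 * Real.exp (-(r * h))) := by gcongr
      _ = _ := by ring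
  have e3 : |t| ^ 4 = t ^ 4 := by rw [← abs_pow, abs_of_nonneg (by positivity)]
  have e4 : |s| ^ 4 = s ^ 4 := by rw [← abs_pow, abs_of_nonneg (by positivity)]
  rw [e3, e4]
  calc _ ≤ 8 * (t ^ 4 * h ^ 4 * digitVar d r h ^ 2) + 8 * s ^ 4 := by
        nlinarith [sq_nonneg (2 * t ^ 2 * h ^ 2 * digitVar d r h - 2 * s ^ 2)]
    _ ≤ 8 * (t ^ 4 * h ^ 4 * (4 * d ^ 6 * Real.exp (-(r * h)))) + 8 * s ^ 4 := by gcongr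
    _ = _ := by ring

end digits

/-! ### Representations selected by a Fourier integral. -/

/-- The multi-base representations of `n`, as a finset. -/
noncomputable def repFin (p : Fin m → ℕ) (d n : ℕ) : Finset (ℕ →₀ ℕ) :=
  ((ppLe p n).finsupp fun _ => Finset.range d).filter fun a => ∑ h ∈ ppLe p n, a h * h = n

theorem mem_repFin {p : Fin m → ℕ} {d n : ℕ} {a : ℕ →₀ ℕ} :
    a ∈ repFin p d n ↔ a.support ⊆ ppLe p n ∧ (∀ h ∈ ppLe p n, a h < d) ∧
      ∑ h ∈ ppLe p n, a h * h = n := by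
  simp [repFin, Finset.mem_finsupp_iff, and_assoc]

theorem coe_repFin {p : Fin m → ℕ} (hp1 : ∀ j, 1 < p j) {d : ℕ} (hd : 2 ≤ d) (n : ℕ) :
    representations p d n = ↑(repFin p d n) := by
  ext a
  simp only [representations, Set.mem_ofPred_eq, Finset.mem_coe, mem_repFin]
  constructor
  · rintro ⟨h1, h2, h3⟩
    have hsub : a.support ⊆ ppLe p n := by
      intro h hh
      have hmem := h1 h hh
      rw [mem_ppLe]
      refine ⟨⟨?_, ?_⟩, hmem⟩
      · obtain ⟨α, rfl⟩ := hmem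
        exact Finset.prod_pos fun j _ => pow_pos (zero_lt_one.trans (hp1 j)) _
      · rw [← h3, Finsupp.sum]
        have h4 := Finset.single_le_sum (f := fun h => a h * h) (fun _ _ => Nat.zero_le _) hh
        have : 1 ≤ a h := Nat.one_le_iff_ne_zero.2 (Finsupp.mem_support_iff.1 hh)
        exact le_trans (Nat.le_mul_of_pos_left _ this) h4
    refine ⟨hsub, fun h _ => h2 h, ?_⟩
    conv_rhs => rw [← h3, Finsupp.sum]
    exact (Finset.sum_subset hsub fun h _ hh => by
      rw [Finsupp.notMem_support_iff.1 hh, zero_mul]).symm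
  · rintro ⟨h1, h2, h3⟩
    refine ⟨fun h hh => (mem_ppLe.1 (h1 hh)).2, fun h => ?_, ?_⟩
    · by_cases hh : h ∈ ppLe p n
      · exact h2 h hh
      · have : a h = 0 := Finsupp.notMem_support_iff.1 fun hc => hh (h1 hc)
        omega
    · conv_rhs => rw [← h3]
      rw [Finsupp.sum]
      exact Finset.sum_subset h1 fun h _ hh => by
        rw [Finsupp.notMem_support_iff.1 hh, zero_mul]

theorem prod_sum_eq_sum_finsupp (S : Finset ℕ) (d : ℕ) (f : ℕ → ℕ → ℂ) :
    ∏ h ∈ S, ∑ c ∈ Finset.range d, f h c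
      = ∑ a ∈ S.finsupp fun _ => Finset.range d, ∏ h ∈ S, f h (a h) := by
  rw [Finset.prod_sum, Finset.finsupp, Finset.sum_map]
  refine Finset.sum_congr (by congr!) fun a _ => ?_
  rw [← Finset.prod_attach S]
  refine Finset.prod_congr rfl fun h _ => ?_
  simp [Finsupp.indicator_apply]

theorem integral_exp_int_mul_I (k : ℤ) :
    ∫ t in -Real.pi..Real.pi, Complex.exp ((t * k : ℝ) * Complex.I)
      = if k = 0 then 2 * Real.pi else 0 := by
  split_ifs with hk
  · subst hk
    simp
    ring
  · have hc : (k : ℂ) * Complex.I ≠ 0 := mul_ne_zero (by exact_mod_cast hk) Complex.I_ne_zero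
    have e : ∀ t : ℝ, Complex.exp ((t * k : ℝ) * Complex.I) = Complex.exp ((k : ℂ) * Complex.I * t) := by
      intro t; congr 1; push_cast; ring
    simp only [e]
    rw [integral_exp_mul_complex hc]
    have : Complex.exp ((k : ℂ) * Complex.I * (Real.pi : ℝ))
        = Complex.exp ((k : ℂ) * Complex.I * ((-Real.pi : ℝ) : ℂ)) := by
      rw [Complex.exp_eq_exp_iff_exists_int]
      exact ⟨k, by push_cast; ring⟩
    rw [this, sub_self, zero_div, Complex.ofReal_zero]

/-- The Fourier integrand which selects the representations of `n`, with test functions `g h`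
applied to the digits. -/
noncomputable def fourierProd (p : Fin m → ℕ) (d : ℕ) (r : ℝ) (n : ℕ) (g : ℕ → ℕ → ℂ) (t : ℝ) : ℂ :=
  ∏ h ∈ ppLe p n, ∑ c ∈ Finset.range d,
    (digitW d r h c : ℂ) * (g h c * Complex.exp ((t * h * (c - digitMean d r h) : ℝ) * Complex.I))

/-- The tilting parameter `r` is such that the mean of the tilted random sum is `n`. -/
def IsSaddle (p : Fin m → ℕ) (d n : ℕ) (r : ℝ) : Prop :=
  0 < r ∧ ∑ h ∈ ppLe p n, h * digitMean d r h = n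

theorem continuous_fourierProd (p : Fin m → ℕ) (d : ℕ) (r : ℝ) (n : ℕ) (g : ℕ → ℕ → ℂ) :
    Continuous (fourierProd p d r n g) := by
  unfold fourierProd
  fun_prop

/-- Expand the product over all digit vectors. By the saddle equation the phase of a vector of value
`N` is `t (N - n)`, so only `N = n` survives integration, and all such vectors carry the same tilted
weight. -/
theorem integral_fourierProd {p : Fin m → ℕ} {d n : ℕ} {r : ℝ} (hs : IsSaddle p d n r)
    (g : ℕ → ℕ → ℂ) :
    ∫ t in -Real.pi..Real.pi, fourierProd p d r n g t
      = (2 * Real.pi * Real.exp (-(r * n)) / ∏ h ∈ ppLe p n, digitZ d r h : ℝ) *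
        ∑ a ∈ repFin p d n, ∏ h ∈ ppLe p n, g h (a h) := by
  set S := ppLe p n
  have key : ∀ (t : ℝ) (a : ℕ →₀ ℕ), (∏ h ∈ S, (digitW d r h (a h) : ℂ) * (g h (a h) *
      Complex.exp ((t * h * (a h - digitMean d r h) : ℝ) * Complex.I)))
      = ((Real.exp (-(r * (∑ h ∈ S, a h * h : ℕ))) / ∏ h ∈ S, digitZ d r h : ℝ) : ℂ)
        * (∏ h ∈ S, g h (a h)) *
        Complex.exp ((t * (((∑ h ∈ S, a h * h : ℕ) : ℤ) - (n : ℤ) : ℤ) : ℝ) * Complex.I) := by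
    intro t a
    rw [Finset.prod_mul_distrib, Finset.prod_mul_distrib, ← Complex.exp_sum, ← mul_assoc]
    congr 1
    · congr 1
      rw [← Complex.ofReal_prod]
      congr 1
      simp only [digitW]
      rw [Finset.prod_div_distrib, ← Real.exp_sum]
      congr 2
      push_cast
      rw [Finset.mul_sum, ← Finset.sum_neg_distrib]
      exact Finset.sum_congr rfl fun h _ => by ring
    · congr 1
      rw [← Finset.sum_mul]
      congr 1
      have h2 := hs.2
      rw [← Complex.ofReal_sum]
      congr 1
      push_cast
      rw [← h2, ← Finset.sum_sub_distrib, Finset.mul_sum]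
      exact Finset.sum_congr rfl fun h _ => by ring
  have e1 : ∀ t : ℝ, fourierProd p d r n g t
      = ∑ a ∈ S.finsupp fun _ => Finset.range d,
        ((Real.exp (-(r * (∑ h ∈ S, a h * h : ℕ))) / ∏ h ∈ S, digitZ d r h : ℝ) : ℂ)
        * (∏ h ∈ S, g h (a h)) *
        Complex.exp ((t * (((∑ h ∈ S, a h * h : ℕ) : ℤ) - (n : ℤ) : ℤ) : ℝ) * Complex.I) := by
    intro t
    rw [fourierProd, prod_sum_eq_sum_finsupp]
    exact Finset.sum_congr rfl fun a _ => key t a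
  simp only [e1]
  rw [intervalIntegral.integral_finsetSum]
  · simp only [intervalIntegral.integral_const_mul, integral_exp_int_mul_I]
    rw [repFin, Finset.sum_filter, Finset.mul_sum]
    refine Finset.sum_congr rfl fun a _ => ?_
    by_cases ha : ∑ h ∈ S, a h * h = n
    · rw [if_pos (by rw [ha]; simp), if_pos ha, ha]
      push_cast
      ring
    · rw [if_neg, if_neg ha, Complex.ofReal_zero, mul_zero, mul_zero]
      rw [sub_eq_zero]
      exact_mod_cast ha
  · intro a _
    apply Continuous.intervalIntegrable
    fun_prop

/-- The average of a function over all representations of `n`. -/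
noncomputable def repAvg (p : Fin m → ℕ) (d n : ℕ) (F : (ℕ →₀ ℕ) → ℂ) : ℂ :=
  (∑ a ∈ repFin p d n, F a) / (repFin p d n).card

/-- Existence of representations is a by-product of the local limit theorem, which makes this
integral non-zero for large `n`. -/
theorem repFin_nonempty_of_integral_ne_zero {p : Fin m → ℕ} {d n : ℕ} {r : ℝ}
    (hs : IsSaddle p d n r)
    (h : ∫ t in -Real.pi..Real.pi, fourierProd p d r n (fun _ _ => 1) t ≠ 0) :
    (repFin p d n).Nonempty := by
  rw [Finset.nonempty_iff_ne_empty]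
  intro he
  rw [integral_fourierProd hs, he] at h
  simp at h

theorem repAvg_prod {p : Fin m → ℕ} {d n : ℕ} {r : ℝ} (hd : 2 ≤ d) (hs : IsSaddle p d n r)
    (hne : (repFin p d n).Nonempty) (g : ℕ → ℕ → ℂ) :
    repAvg p d n (fun a => ∏ h ∈ ppLe p n, g h (a h))
      = (∫ t in -Real.pi..Real.pi, fourierProd p d r n g t) /
        ∫ t in -Real.pi..Real.pi, fourierProd p d r n (fun _ _ => 1) t := by
  rw [integral_fourierProd hs, integral_fourierProd hs, repAvg]
  have h1 : ((2 * Real.pi * Real.exp (-(r * n)) / ∏ h ∈ ppLe p n, digitZ d r h : ℝ) : ℂ) ≠ 0 := by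
    have : 0 < ∏ h ∈ ppLe p n, digitZ d r h := Finset.prod_pos fun h _ => digitZ_pos hd
    have : 0 < 2 * Real.pi * Real.exp (-(r * n)) / ∏ h ∈ ppLe p n, digitZ d r h := by
      have := Real.pi_pos
      positivity
    exact_mod_cast this.ne'
  have h2 : ((repFin p d n).card : ℂ) ≠ 0 := by
    exact_mod_cast (Finset.card_pos.2 hne).ne'
  rw [mul_div_mul_left _ _ h1]
  simp

/-! ### The saddle point: existence, size, and tilted sums. -/

theorem tendsto_log_natCast : Tendsto (fun n : ℕ => Real.log n) atTop atTop :=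
  Real.tendsto_log_atTop.comp tendsto_natCast_atTop_atTop

theorem eventually_le_log (C : ℝ) : ∀ᶠ n : ℕ in atTop, C ≤ Real.log n :=
  tendsto_log_natCast.eventually_ge_atTop C

theorem eventually_log_pow_le (C : ℝ) (k : ℕ) :
    ∀ᶠ n : ℕ in atTop, C * Real.log n ^ k ≤ n := by
  have h := (Real.isLittleO_pow_log_id_atTop (n := k)).comp_tendsto
    (tendsto_natCast_atTop_atTop (R := ℝ))
  have h2 := h.bound (show (0 : ℝ) < 1 / (|C| + 1) by positivity)
  filter_upwards [h2, eventually_le_log 0] with n hn hL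
  simp only [Function.comp_apply, id_eq, Real.norm_eq_abs, Nat.abs_cast, abs_pow,
    abs_of_nonneg hL] at hn
  have h3 : C * Real.log n ^ k ≤ (|C| + 1) * (1 / (|C| + 1) * n) := by
    refine mul_le_mul ?_ hn (by positivity) (by positivity)
    linarith [le_abs_self C]
  have : (|C| + 1) ≠ 0 := by positivity
  rw [← mul_assoc, mul_one_div_cancel this, one_mul] at h3
  exact h3

/-- Uses `exp (-x) ≤ j! / x ^ j` with `j = k` and `j = k + 2`, bringing moment sums into the shape
of `sum_min_le`. -/
theorem pow_mul_exp_neg_le_min {x : ℝ} (hx : 0 < x) (k : ℕ) :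
    x ^ (k + 1) * Real.exp (-x) ≤ (k + 2).factorial * min x x⁻¹ := by
  have key : ∀ j : ℕ, x ^ j * Real.exp (-x) ≤ j.factorial := by
    intro j
    have := Real.pow_div_factorial_le_exp x hx.le j
    rw [div_le_iff₀ (by positivity)] at this
    rw [Real.exp_neg, ← div_eq_mul_inv, div_le_iff₀ (Real.exp_pos _)]
    linarith
  rw [mul_min_of_nonneg _ _ (by positivity)]
  apply le_min
  · calc _ = x ^ k * Real.exp (-x) * x := by ring
      _ ≤ k.factorial * x := by gcongr; exact key k
      _ ≤ _ := by gcongr; omega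
  · rw [← div_eq_mul_inv, le_div_iff₀ hx]
    calc _ = x ^ (k + 2) * Real.exp (-x) := by ring
      _ ≤ _ := key _

section
variable {p : Fin m → ℕ} (hp1 : ∀ j, 1 < p j) (hpcop : ∀ i j, i ≠ j → Nat.Coprime (p i) (p j))
include hp1 hpcop

theorem sum_pow_mul_exp_le (k : ℕ) :
    ∃ C > 0, ∀ n : ℕ, 1 ≤ Real.log n → ∀ r : ℝ, 0 < r →
      ∑ h ∈ ppLe p n, (h * r) ^ (k + 1) * Real.exp (-(r * h)) ≤ C * Real.log n ^ (m - 1) := by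
  obtain ⟨C, hC, h⟩ := sum_min_le hp1 hpcop
  refine ⟨(k + 2).factorial * C, by positivity, fun n hn r hr => ?_⟩
  calc _ ≤ ∑ h ∈ ppLe p n, (k + 2).factorial * min (h * r) (h * r)⁻¹ := by
        refine Finset.sum_le_sum fun h hh => ?_
        have h0 : (0 : ℝ) < h := by
          have := (mem_ppLe.1 hh).1.1
          positivity
        rw [mul_comm r]
        exact pow_mul_exp_neg_le_min (by positivity) k
    _ ≤ _ := by
        rw [← Finset.mul_sum, mul_assoc]
        gcongr
        exact h n hn r hr

theorem exists_block_card_ge (hm : 1 ≤ m) :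
    ∃ B c : ℝ, 0 < B ∧ 0 < c ∧ ∀ y, 2 * B ≤ y → ∀ n : ℕ, Real.exp y ≤ n →
      c * y ^ (m - 1) ≤
        ((ppLe p n).filter fun h : ℕ => Real.exp (y - B) < h ∧ (h : ℝ) ≤ Real.exp y).card := by
  obtain ⟨B, c, hB, hc, h⟩ := ppCount_block_ge hp1 hpcop
  refine ⟨B, c, hB, hc, fun y hy n hn => ?_⟩
  rcases h y hy with h | h
  · refine h.trans ?_
    rw [ppCount, ppCount, ← Nat.cast_sub (Finset.card_le_card (ppLe_exp_mono p (by linarith))),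
      ← Finset.card_sdiff_of_subset (ppLe_exp_mono p (by linarith))]
    refine Nat.cast_le.2 (Finset.card_le_card fun h hh => ?_)
    rw [Finset.mem_sdiff, mem_ppLe_exp, mem_ppLe_exp] at hh
    rw [Finset.mem_filter, mem_ppLe]
    obtain ⟨⟨⟨h1, h2⟩, h3⟩, h4⟩ := hh
    refine ⟨⟨⟨h1, by exact_mod_cast h2.trans hn⟩, h3⟩, ?_, h2⟩
    by_contra hcon
    exact h4 ⟨⟨h1, not_lt.1 hcon⟩, h3⟩
  · omega

/-- Only the top block of fixed logarithmic length is kept; there every `h` is comparable with `exp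
y`. -/
theorem exists_block_sum_ge (hm : 1 ≤ m) :
    ∃ B c : ℝ, 0 < B ∧ 0 < c ∧ ∀ y, 2 * B ≤ y → ∀ n : ℕ, Real.exp y ≤ n → ∀ k : ℕ,
      c * y ^ (m - 1) * (Real.exp (-B) * Real.exp y) ^ k ≤
        ∑ h ∈ (ppLe p n).filter fun h : ℕ => (h : ℝ) ≤ Real.exp y, (h : ℝ) ^ k := by
  obtain ⟨B, c, hB, hc, hcard⟩ := exists_block_card_ge hp1 hpcop hm
  refine ⟨B, c, hB, hc, fun y hy n hn k => ?_⟩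
  calc _ ≤ ∑ h ∈ (ppLe p n).filter fun h : ℕ => Real.exp (y - B) < h ∧ (h : ℝ) ≤ Real.exp y,
        (Real.exp (-B) * Real.exp y) ^ k := by
        rw [Finset.sum_const, nsmul_eq_mul]
        gcongr
        exact hcard y hy n hn
    _ ≤ ∑ h ∈ (ppLe p n).filter fun h : ℕ => Real.exp (y - B) < h ∧ (h : ℝ) ≤ Real.exp y,
        (h : ℝ) ^ k := by
        refine Finset.sum_le_sum fun h hh => ?_
        have := (Finset.mem_filter.1 hh).2.1
        rw [← Real.exp_add, neg_add_eq_sub]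
        gcongr
    _ ≤ _ := by
        refine Finset.sum_le_sum_of_subset_of_nonneg (fun h hh => ?_) fun _ _ _ => by positivity
        rw [Finset.mem_filter] at hh ⊢
        exact ⟨hh.1, hh.2.2⟩

/-- Intermediate value theorem for the tilted mean. At `r = 0` the power products in the block just
below `n` already contribute at least `2 n`, because `(log n) ^ (m - 1)` is unbounded for `m ≥ 2`;
for large `r` the mean is at most `n`. -/
theorem eventually_exists_saddle {d : ℕ} (hd : 2 ≤ d) (hm : 2 ≤ m) :
    ∀ᶠ n : ℕ in atTop, ∃ r, IsSaddle p d n r := by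
  obtain ⟨B, c, hB, hc, hsum⟩ := exists_block_sum_ge hp1 hpcop (by omega)
  set K := c * (Real.exp (-1) / d) * Real.exp (-B) with hK
  have hKpos : 0 < K := by positivity
  filter_upwards [eventually_le_log (2 * B), eventually_le_log 1, eventually_le_log (2 / K),
    eventually_gt_atTop 0] with n h1 h2 h3 h4
  set L := Real.log n
  have hn0 : (0 : ℝ) < n := by exact_mod_cast h4
  have hexp : Real.exp L = n := Real.exp_log hn0
  set f : ℝ → ℝ := fun r => ∑ h ∈ ppLe p n, h * digitMean d r h with hf
  have hfc : Continuous f := by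
    simp only [hf, digitMean, digitW, digitZ]
    refine continuous_finsetSum _ fun h _ => continuous_const.mul
      (continuous_finsetSum _ fun c _ => Continuous.mul (Continuous.div (by fun_prop) (by fun_prop) ?_)
        continuous_const)
    exact fun r => (digitZ_pos hd).ne'
  have hf0 : 2 * n ≤ f 0 := by
    have hs := hsum L h1 n hexp.le 1
    simp only [pow_one] at hs
    have hLp : L ≤ L ^ (m - 1) := le_self_pow₀ h2 (by omega)
    have h5 : 2 ≤ K * L := by
      rw [div_le_iff₀ hKpos] at h3; linarith
    calc (2 : ℝ) * n ≤ K * L ^ (m - 1) * n := by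
          gcongr
          exact h5.trans (by gcongr)
      _ = (c * L ^ (m - 1) * (Real.exp (-B) * Real.exp L)) * (Real.exp (-1) / d) := by
          rw [hexp, hK]; ring
      _ ≤ (∑ h ∈ (ppLe p n).filter fun h : ℕ => (h : ℝ) ≤ Real.exp L, (h : ℝ)) * (Real.exp (-1) / d) := by
          gcongr
      _ ≤ (∑ h ∈ ppLe p n, (h : ℝ)) * (Real.exp (-1) / d) := by
          gcongr
          exact Finset.filter_subset _ _
      _ ≤ f 0 := by
          rw [Finset.sum_mul]
          refine Finset.sum_le_sum fun h _ => ?_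
          gcongr
          exact (le_digitW hd le_rfl (by simp) le_rfl).trans (digitW_one_le_digitMean hd)
  have hcard : ((ppLe p n).card : ℝ) ≤ n := by
    have : (ppLe p n).card ≤ (Finset.Icc 1 n).card :=
      Finset.card_le_card fun h hh => Finset.mem_Icc.2 (mem_ppLe.1 hh).1
    simpa using this
  -- Chosen so that every summand is at most `1`; there are at most `n` of them.
  set R : ℝ := n * d ^ 2 with hR
  have hd0 : (0 : ℝ) < d := by positivity
  have hRpos : 0 < R := by positivity
  have hfR : f R ≤ n := by
    calc f R ≤ ∑ h ∈ ppLe p n, (1 : ℝ) := by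
          refine Finset.sum_le_sum fun h hh => ?_
          obtain ⟨⟨g1, g2⟩, _⟩ := mem_ppLe.1 hh
          have g1' : (1 : ℝ) ≤ h := by exact_mod_cast g1
          have g2' : (h : ℝ) ≤ n := by exact_mod_cast g2
          have : Real.exp (-(R * h)) ≤ R⁻¹ := by
            rw [Real.exp_neg]
            apply inv_anti₀ hRpos
            have := Real.add_one_le_exp (R * h)
            nlinarith
          calc (h : ℝ) * digitMean d R h ≤ n * (d ^ 2 * R⁻¹) := by
                refine mul_le_mul g2' ((digitMean_le hd hRpos.le).trans ?_) (digitMean_nonneg hd)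
                  hn0.le
                gcongr
            _ = 1 := by rw [hR]; field_simp
      _ ≤ n := by simpa using hcard
  obtain ⟨r, hr, hfr⟩ := intermediate_value_Icc' hRpos.le hfc.continuousOn
    (show (n : ℝ) ∈ Set.Icc (f R) (f 0) from ⟨hfR, by linarith⟩)
  refine ⟨r, lt_of_le_of_ne hr.1 ?_, hfr⟩
  rintro rfl
  rw [hfr] at hf0
  linarith

/-- Multiply the saddle equation by `r`: the mean of the digit decays like `exp (-r h)`, and the
resulting sum is bounded uniformly in `r`. -/
theorem saddle_upper {d : ℕ} (hd : 2 ≤ d) :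
    ∃ C > 0, ∀ n : ℕ, 1 ≤ Real.log n → ∀ r, IsSaddle p d n r → n * r ≤ C * Real.log n ^ (m - 1) := by
  obtain ⟨C, hC, h⟩ := sum_pow_mul_exp_le hp1 hpcop 0
  refine ⟨d ^ 2 * C, by positivity, fun n hn r hr => ?_⟩
  calc n * r = ∑ h ∈ ppLe p n, h * digitMean d r h * r := by rw [← Finset.sum_mul, hr.2]
    _ ≤ ∑ h ∈ ppLe p n, d ^ 2 * ((h * r) ^ (0 + 1) * Real.exp (-(r * h))) := by
        refine Finset.sum_le_sum fun h _ => ?_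
        have hr0 := hr.1
        calc _ = h * r * digitMean d r h := by ring
          _ ≤ h * r * (d ^ 2 * Real.exp (-(r * h))) := by
            gcongr; exact digitMean_le hd hr.1.le
          _ = _ := by ring
    _ ≤ _ := by
        rw [← Finset.mul_sum, mul_assoc]
        gcongr
        exact h n hn r hr.1

/-- A deliberately rough form of the previous bound: `n r` is at most a power of `log n`, hence at
most `√n`, so `1 / r ≥ √n`. -/
theorem saddle_log_lower {d : ℕ} (hd : 2 ≤ d) :
    ∀ᶠ n : ℕ in atTop, ∀ r, IsSaddle p d n r → Real.log n / 2 ≤ Real.log (1 / r) := by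
  obtain ⟨C, hC, h⟩ := saddle_upper hp1 hpcop hd
  filter_upwards [eventually_le_log 1, eventually_log_pow_le (C ^ 2) (2 * (m - 1)),
    eventually_gt_atTop 0] with n h1 h2 h3 r hr
  have hn0 : (0 : ℝ) < n := by exact_mod_cast h3
  have h4 := h n h1 r hr
  have hr0 := hr.1
  have h5 : (n * r) ^ 2 ≤ n := by
    calc (n * r) ^ 2 ≤ (C * Real.log n ^ (m - 1)) ^ 2 := by gcongr
      _ = C ^ 2 * Real.log n ^ (2 * (m - 1)) := by rw [mul_pow, ← pow_mul, mul_comm (m - 1)]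
      _ ≤ n := h2
  have h6 := Real.log_le_log (by positivity) h5
  rw [Real.log_pow, Real.log_mul hn0.ne' hr0.ne'] at h6
  rw [one_div, Real.log_inv]
  push_cast at h6
  linarith

theorem saddle_lower {d : ℕ} (hd : 2 ≤ d) (hm : 2 ≤ m) :
    ∃ c > 0, ∀ᶠ n : ℕ in atTop, ∀ r, IsSaddle p d n r →
      c * Real.log n ^ (m - 1) ≤ n * r ∧ 1 / r ≤ n := by
  obtain ⟨B, c, hB, hc, hsum⟩ := exists_block_sum_ge hp1 hpcop (by omega)
  have hd0 : (0 : ℝ) < d := by positivity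
  set K := c * (1 / 2) ^ (m - 1) * Real.exp (-B) * (Real.exp (-1) / d) with hK
  have hKpos : 0 < K := by positivity
  refine ⟨K, hKpos, ?_⟩
  filter_upwards [saddle_log_lower hp1 hpcop hd, eventually_le_log (4 * B), eventually_le_log 1,
    eventually_le_log (2 / K), eventually_gt_atTop 0] with n h1 h2 h3 h4 h5 r hr
  have hn0 : (0 : ℝ) < n := by exact_mod_cast h5
  have h1 := h1 r hr
  have hr0 := hr.1
  set L := Real.log n
  -- Below `exp y` both `h ≤ n` and `r h ≤ 1` hold. If the minimum were `log n`, the estimate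
  -- `hmain` would read `K (log n) ^ (m - 1) n ≤ n`, which is false for large `n`; so it is `log (1
  -- / r)`, and `1 / r ≤ n` follows.
  set y := min L (Real.log (1 / r))
  have hy1 : L / 2 ≤ y := le_min (by linarith) h1
  have hexpn : Real.exp y ≤ n := by
    rw [← Real.exp_log hn0]; exact Real.exp_le_exp.2 (min_le_left _ _)
  have hexpr : Real.exp y ≤ 1 / r := by
    rw [← Real.exp_log (show 0 < 1 / r by positivity)]; exact Real.exp_le_exp.2 (min_le_right _ _)
  have hs := hsum y (by linarith) n hexpn 1
  simp only [pow_one] at hs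
  have hmain : K * L ^ (m - 1) * Real.exp y ≤ n := by
    calc K * L ^ (m - 1) * Real.exp y
        = (c * (L / 2) ^ (m - 1) * (Real.exp (-B) * Real.exp y)) * (Real.exp (-1) / d) := by
          rw [hK, div_eq_mul_one_div L, mul_pow]; ring
      _ ≤ (c * y ^ (m - 1) * (Real.exp (-B) * Real.exp y)) * (Real.exp (-1) / d) := by gcongr
      _ ≤ (∑ h ∈ (ppLe p n).filter fun h : ℕ => (h : ℝ) ≤ Real.exp y, (h : ℝ)) * (Real.exp (-1) / d) := by
          gcongr
      _ ≤ ∑ h ∈ (ppLe p n).filter fun h : ℕ => (h : ℝ) ≤ Real.exp y, h * digitMean d r h := by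
          rw [Finset.sum_mul]
          refine Finset.sum_le_sum fun h hh => ?_
          have hle := (Finset.mem_filter.1 hh).2
          have : r * h ≤ 1 := by
            have := hle.trans hexpr
            rw [le_div_iff₀ hr0] at this
            linarith
          gcongr
          exact (le_digitW hd hr0.le this le_rfl).trans (digitW_one_le_digitMean hd)
      _ ≤ ∑ h ∈ ppLe p n, h * digitMean d r h :=
          Finset.sum_le_sum_of_subset_of_nonneg (Finset.filter_subset _ _)
            fun h _ _ => mul_nonneg (by positivity) (digitMean_nonneg hd)
      _ = n := hr.2
  have hLp : L ≤ L ^ (m - 1) := le_self_pow₀ h3 (by omega)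
  have h2K : 2 ≤ K * L ^ (m - 1) := by
    rw [div_le_iff₀ hKpos] at h4
    nlinarith
  have hyr : y = Real.log (1 / r) := by
    rcases min_choice L (Real.log (1 / r)) with hc | hc
    · exfalso
      have : Real.exp y = n := by rw [show y = L from hc, Real.exp_log hn0]
      rw [this] at hmain
      nlinarith
    · exact hc
  have hey : Real.exp y = 1 / r := by rw [hyr, Real.exp_log (by positivity)]
  refine ⟨?_, hey ▸ hexpn⟩
  rw [hey, mul_one_div, div_le_iff₀ hr0] at hmain
  exact hmain

/-- The variance of the tilted random sum. -/
noncomputable def sumVar (p : Fin m → ℕ) (d n : ℕ) (r : ℝ) : ℝ :=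
  ∑ h ∈ ppLe p n, (h : ℝ) ^ 2 * digitVar d r h

/-- The threshold `1 / 4` serves the central arc: `|t| ≤ 2πr` and `r h ≤ 1 / 4` force `|t h| ≤ π /
2`. -/
theorem sum_sq_lower {d : ℕ} (hd : 2 ≤ d) (hm : 2 ≤ m) :
    ∃ c > 0, ∀ᶠ n : ℕ in atTop, ∀ r, IsSaddle p d n r →
      c * Real.log n ^ (m - 1) ≤
        (∑ h ∈ (ppLe p n).filter fun h : ℕ => r * h ≤ 1 / 4, (h : ℝ) ^ 2) * r ^ 2 := by
  obtain ⟨B, c, hB, hc, hsum⟩ := exists_block_sum_ge hp1 hpcop (by omega)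
  obtain ⟨c1, hc1, hlow⟩ := saddle_lower hp1 hpcop hd hm
  refine ⟨c * (1 / 4) ^ (m - 1) * (Real.exp (-B) * (1 / 4)) ^ 2, by positivity, ?_⟩
  filter_upwards [saddle_log_lower hp1 hpcop hd, hlow, eventually_le_log (8 * B),
    eventually_le_log (4 * Real.log 4), eventually_le_log 0] with n h1 h2 h3 h4 h5 r hr
  have hr0 := hr.1
  have h1 := h1 r hr
  have h2 := (h2 r hr).2
  set L := Real.log n
  set y := Real.log (1 / r) - Real.log 4 with hy
  have hey : Real.exp y = 1 / r / 4 := by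
    rw [hy, Real.exp_sub, Real.exp_log (by positivity), Real.exp_log (by norm_num)]
  have hy1 : L / 4 ≤ y := by linarith
  have hs := hsum y (by linarith) n (by
    rw [hey]
    have : 0 < 1 / r := by positivity
    linarith) 2
  rw [hey] at hs
  have e : (ppLe p n).filter (fun h : ℕ => (h : ℝ) ≤ 1 / r / 4)
      = (ppLe p n).filter fun h : ℕ => r * h ≤ 1 / 4 := by
    refine Finset.filter_congr fun h _ => ?_
    rw [div_div, le_div_iff₀ (by positivity)]
    constructor <;> intro hh <;> linarith
  rw [e] at hs
  calc _ = c * (L / 4) ^ (m - 1) * (Real.exp (-B) * (1 / r / 4)) ^ 2 * r ^ 2 := by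
        rw [div_eq_mul_one_div L, mul_pow L]
        field_simp
    _ ≤ c * y ^ (m - 1) * (Real.exp (-B) * (1 / r / 4)) ^ 2 * r ^ 2 := by gcongr
    _ ≤ _ := by gcongr

/-- The variance of the value comes from `h` of order `1 / r`: about `(log n) ^ (m - 1)` of them,
each contributing about `1 / r²`. -/
theorem sumVar_bounds {d : ℕ} (hd : 2 ≤ d) (hm : 2 ≤ m) :
    ∃ c > 0, ∃ C > 0, ∀ᶠ n : ℕ in atTop, ∀ r, IsSaddle p d n r →
      c * Real.log n ^ (m - 1) ≤ sumVar p d n r * r ^ 2 ∧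
      sumVar p d n r * r ^ 2 ≤ C * Real.log n ^ (m - 1) := by
  obtain ⟨c, hc, hlow⟩ := sum_sq_lower hp1 hpcop hd hm
  obtain ⟨C, hC, hup⟩ := sum_pow_mul_exp_le hp1 hpcop 1
  refine ⟨(Real.exp (-1) / d) * (Real.exp (-1) / d) * c, by positivity, 2 * d ^ 3 * C, by positivity, ?_⟩
  filter_upwards [hlow, eventually_le_log 1] with n h1 h2 r hr
  have hr0 := hr.1
  constructor
  · calc _ ≤ (Real.exp (-1) / d) * (Real.exp (-1) / d) *
          ((∑ h ∈ (ppLe p n).filter fun h : ℕ => r * h ≤ 1 / 4, (h : ℝ) ^ 2) * r ^ 2) := by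
          rw [mul_assoc (Real.exp (-1) / d * (Real.exp (-1) / d))]
          exact mul_le_mul_of_nonneg_left (h1 r hr) (by positivity)
      _ = (∑ h ∈ (ppLe p n).filter fun h : ℕ => r * h ≤ 1 / 4,
          (h : ℝ) ^ 2 * ((Real.exp (-1) / d) * (Real.exp (-1) / d))) * r ^ 2 := by
          rw [← Finset.sum_mul]; ring
      _ ≤ (∑ h ∈ (ppLe p n).filter fun h : ℕ => r * h ≤ 1 / 4,
          (h : ℝ) ^ 2 * digitVar d r h) * r ^ 2 := by
          gcongr with h hh
          have hle := (Finset.mem_filter.1 hh).2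
          refine le_trans ?_ (le_digitVar hd)
          have := digitW_nonneg (r := r) (h := h) hd 0
          gcongr
          · exact le_digitW hd hr0.le (by linarith) (by norm_num)
          · exact le_digitW hd hr0.le (by linarith) le_rfl
      _ ≤ _ := by
          rw [sumVar]
          refine mul_le_mul_of_nonneg_right ?_ (by positivity)
          exact Finset.sum_le_sum_of_subset_of_nonneg (Finset.filter_subset _ _)
            fun h _ _ => mul_nonneg (by positivity) (digitVar_nonneg hd)
  · calc _ ≤ (∑ h ∈ ppLe p n, (h : ℝ) ^ 2 * (2 * d ^ 3 * Real.exp (-(r * h)))) * r ^ 2 := by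
          rw [sumVar]
          gcongr
          exact digitVar_le hd hr0.le
      _ = 2 * d ^ 3 * ∑ h ∈ ppLe p n, (h * r) ^ (1 + 1) * Real.exp (-(r * h)) := by
          rw [Finset.sum_mul, Finset.mul_sum]
          exact Finset.sum_congr rfl fun h _ => by ring
      _ ≤ _ := by
          rw [mul_assoc (2 * (d : ℝ) ^ 3)]
          exact mul_le_mul_of_nonneg_left (hup n h2 r hr0) (by positivity)

theorem card_ppLe_asymp :
    ∃ C > 0, ∀ n : ℕ, 1 ≤ Real.log n →
      |((ppLe p n).card : ℝ) - Real.log n ^ m / volConst p| ≤ C * Real.log n ^ (m - 1) := by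
  obtain ⟨C, hC, h⟩ := ppCount_sub_le hp1 hpcop
  refine ⟨C * 2 ^ (m - 1), by positivity, fun n hn => ?_⟩
  have hn0 : 0 < n := by
    rcases Nat.eq_zero_or_pos n with h | h
    · subst h; norm_num at hn
    · exact h
  have h1 := h (Real.log n) 0 (by linarith) le_rfl
  have h2 := le_ppCount hp1 hpcop (show 0 ≤ Real.log n by linarith)
  rw [add_zero, ppCount_log p hn0] at h1
  rw [ppCount_log p hn0] at h2
  rw [abs_of_nonneg (by linarith)]
  refine h1.trans ?_
  have : (Real.log n + 1) ^ (m - 1) ≤ (2 * Real.log n) ^ (m - 1) := by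
    gcongr; linarith
  rw [mul_pow] at this
  calc _ ≤ C * (0 + 1) * (2 ^ (m - 1) * Real.log n ^ (m - 1)) := by gcongr
    _ = _ := by ring

/-- A function of the tilted digit law which is close to `a` for `h` small compared with `1 / r`
sums up to `a` times the number of power products, with a small error. -/
theorem sum_digit_asymp {d : ℕ} (hd : 2 ≤ d) (hm : 2 ≤ m) (a K : ℝ) (ha : |a| ≤ 1) (hK : 0 < K) :
    ∃ C > 0, ∀ᶠ n : ℕ in atTop, ∀ r, IsSaddle p d n r → ∀ g : ℕ → ℝ,
      (∀ h, |g h - a| ≤ K * (r * h)) → (∀ h, |g h - a| ≤ K) →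
      |∑ h ∈ ppLe p n, g h - a * (Real.log n ^ m / volConst p)|
        ≤ C * (Real.log n ^ (m - 1) * Real.log (Real.log n)) := by
  obtain ⟨C1, hC1, hcard⟩ := card_ppLe_asymp hp1 hpcop
  obtain ⟨C2, hC2, hblock⟩ := ppCount_block_le hp1 hpcop
  obtain ⟨C3, hC3, hup⟩ := saddle_upper hp1 hpcop hd
  obtain ⟨c4, hc4, hlow⟩ := saddle_lower hp1 hpcop hd hm
  have hv := volConst_pos hp1
  refine ⟨C1 + K * (C1 + 1 / volConst p) + K * (C2 * (m + 2) * 2 ^ (m - 1)), by positivity, ?_⟩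
  have hLL : ∀ᶠ n : ℕ in atTop, max 1 (Real.log C3) ≤ Real.log (Real.log n) :=
    (Real.tendsto_log_atTop.comp tendsto_log_natCast).eventually_ge_atTop _
  have hlogle : ∀ᶠ n : ℕ in atTop, Real.log (Real.log n) ≤ Real.log n / 2 := by
    have := (Real.isLittleO_log_id_atTop.comp_tendsto tendsto_log_natCast).bound
      (show (0 : ℝ) < 1 / 2 by norm_num)
    filter_upwards [this, eventually_le_log 0] with n h1 h2
    simp only [Function.comp_apply, id_eq, Real.norm_eq_abs, abs_of_nonneg h2] at h1
    linarith [le_abs_self (Real.log (Real.log n))]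
  filter_upwards [eventually_le_log 1, hLL, hlogle, hlow, saddle_log_lower hp1 hpcop hd,
    eventually_gt_atTop 0] with n h1 h2 h3 h4 h5 h6 r hr g hg1 hg2
  have hr0 := hr.1
  have h4 := h4 r hr
  have h5 := h5 r hr
  have h7 := hup n h1 r hr
  have hn0 : (0 : ℝ) < n := by exact_mod_cast h6
  set L := Real.log n with hL
  have hL0 : 0 < L := by linarith
  have h2a := (le_max_left _ _).trans h2
  have h2b := (le_max_right _ _).trans h2
  -- Cut at `h = 1 / (r L)`. Below the cut each error is at most `K / L`, in total `O(L ^ (m - 1))`.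
  -- Above it the errors are only bounded, but the window has logarithmic length at most `(m + 1)
  -- log L` since `n r = O(L ^ (m - 1))`.
  set y := Real.log (1 / r) - Real.log L with hy
  have hy0 : 0 ≤ y := by linarith
  have hey : Real.exp y = 1 / (r * L) := by
    rw [hy, Real.exp_sub, Real.exp_log (by positivity), Real.exp_log hL0]
    field_simp
  have hη : L - y ≤ (m + 1) * Real.log L := by
    have e : L - y = Real.log (n * r) + Real.log L := by
      rw [hy, one_div, Real.log_inv, Real.log_mul hn0.ne' hr0.ne']; ring
    have : Real.log (n * r) ≤ Real.log L + (m - 1 : ℕ) * Real.log L := by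
      have := Real.log_le_log (by positivity) h7
      rw [Real.log_mul hC3.ne' (by positivity), Real.log_pow] at this
      linarith
    have hm' : ((m - 1 : ℕ) : ℝ) = m - 1 := by
      rw [Nat.cast_sub (by omega)]; simp
    rw [hm'] at this
    rw [e]
    linarith
  have hyL : y ≤ L := by
    have : Real.log (1 / r) ≤ L := Real.log_le_log (by positivity) h4.2
    linarith
  have hsplit : ∑ h ∈ ppLe p n, |g h - a| ≤
      K * ((ppLe p n).card / L) + K * (ppCount p L - ppCount p y) := by
    rw [← Finset.sum_filter_add_sum_filter_not (ppLe p n) (fun h : ℕ => (h : ℝ) ≤ Real.exp y)]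
    apply add_le_add
    · calc _ ≤ ∑ h ∈ (ppLe p n).filter fun h : ℕ => (h : ℝ) ≤ Real.exp y, K * (1 / L) := by
            refine Finset.sum_le_sum fun h hh => (hg1 h).trans ?_
            have := (Finset.mem_filter.1 hh).2
            rw [hey, le_div_iff₀ (by positivity)] at this
            gcongr
            rw [le_div_iff₀ hL0]
            linarith
        _ ≤ _ := by
            rw [Finset.sum_const, nsmul_eq_mul]
            have : (((ppLe p n).filter fun h : ℕ => (h : ℝ) ≤ Real.exp y).card : ℝ) ≤ (ppLe p n).card := by
              exact_mod_cast Finset.card_le_card (Finset.filter_subset _ _)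
            calc _ ≤ ((ppLe p n).card : ℝ) * (K * (1 / L)) := by gcongr
              _ = _ := by ring
    · have hLn : ppLe p n = ppLe p ⌊Real.exp L⌋₊ := by
        rw [hL, Real.exp_log hn0, Nat.floor_natCast]
      calc _ ≤ ∑ h ∈ (ppLe p n).filter fun h : ℕ => ¬ (h : ℝ) ≤ Real.exp y, K :=
            Finset.sum_le_sum fun h _ => hg2 h
        _ ≤ _ := by
            rw [Finset.sum_const, nsmul_eq_mul, mul_comm K]
            gcongr
            rw [ppCount, ppCount, ← Nat.cast_sub (Finset.card_le_card (ppLe_exp_mono p hyL)),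
              ← Finset.card_sdiff_of_subset (ppLe_exp_mono p hyL)]
            refine Nat.cast_le.2 (Finset.card_le_card fun h hh => ?_)
            rw [Finset.mem_filter] at hh
            rw [Finset.mem_sdiff, ← hLn, mem_ppLe_exp]
            exact ⟨hh.1, fun hc => hh.2 hc.1.2⟩
  have hcardle := hcard n h1
  have hblk := hblock y (L - y) hy0 (by linarith)
  rw [add_sub_cancel] at hblk
  have hpow : L ^ m = L ^ (m - 1) * L := by
    rw [← pow_succ, Nat.sub_add_cancel (by omega)]
  set P := L ^ (m - 1) with hP
  have hP0 : 0 < P := by positivity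
  have hlogL : 0 < Real.log L := by linarith
  have hA : ((ppLe p n).card : ℝ) / L ≤ (C1 + 1 / volConst p) * P := by
    rw [div_le_iff₀ hL0]
    have h8 := (abs_le.1 hcardle).2
    rw [hpow] at h8
    have h9 : C1 * P ≤ C1 * P * L := le_mul_of_one_le_right (by positivity) h1
    calc ((ppLe p n).card : ℝ) ≤ C1 * P * L + P * L / volConst p := by linarith
      _ = _ := by ring
  have hB : ppCount p L - ppCount p y ≤ C2 * (m + 2) * 2 ^ (m - 1) * (P * Real.log L) := by
    have : (L + 1) ^ (m - 1) ≤ 2 ^ (m - 1) * P := by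
      rw [hP, ← mul_pow]; gcongr; linarith
    calc _ ≤ C2 * (L - y + 1) * (L + 1) ^ (m - 1) := hblk
      _ ≤ C2 * ((m + 2) * Real.log L) * (2 ^ (m - 1) * P) := by
        gcongr
        linarith
      _ = _ := by ring
  have hmain : |∑ h ∈ ppLe p n, g h - a * (L ^ m / volConst p)| ≤
      ∑ h ∈ ppLe p n, |g h - a| + |a| * |((ppLe p n).card : ℝ) - L ^ m / volConst p| := by
    have e : ∑ h ∈ ppLe p n, g h - a * (L ^ m / volConst p)
        = ∑ h ∈ ppLe p n, (g h - a) + a * (((ppLe p n).card : ℝ) - L ^ m / volConst p) := by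
      rw [Finset.sum_sub_distrib, Finset.sum_const, nsmul_eq_mul]; ring
    rw [e, ← abs_mul]
    exact (abs_add_le _ _).trans (add_le_add (Finset.abs_sum_le_sum_abs _ _) le_rfl)
  have hPl : P ≤ P * Real.log L := le_mul_of_one_le_right hP0.le h2a
  calc _ ≤ _ := hmain
    _ ≤ (K * ((C1 + 1 / volConst p) * P) + K * (C2 * (m + 2) * 2 ^ (m - 1) * (P * Real.log L)))
        + 1 * (C1 * P) := by
      gcongr
      exact hsplit.trans (by gcongr)
    _ ≤ (K * ((C1 + 1 / volConst p) * (P * Real.log L))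
        + K * (C2 * (m + 2) * 2 ^ (m - 1) * (P * Real.log L))) + 1 * (C1 * (P * Real.log L)) := by
      gcongr
    _ = _ := by ring

end

/-! ### Distances to integers and the minor arc integral. -/

/-- The distance of a real number to the nearest integer. -/
noncomputable def distInt (x : ℝ) : ℝ := ‖(x : UnitAddCircle)‖

theorem distInt_eq (x : ℝ) : distInt x = |x - round x| := UnitAddCircle.norm_eq

theorem distInt_le_half (x : ℝ) : distInt x ≤ 1 / 2 := by
  rw [distInt_eq]; exact abs_sub_round x

theorem measurable_distInt : Measurable distInt := by
  unfold distInt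
  exact (continuous_norm.comp (AddCircle.continuous_mk' (1 : ℝ))).measurable

theorem distInt_le_abs_sub_int (x : ℝ) (k : ℤ) : distInt x ≤ |x - k| := by
  rw [distInt_eq]; exact round_le x k

theorem distInt_add_int (x : ℝ) (k : ℤ) : distInt (x + k) = distInt x := by
  rw [distInt_eq, distInt_eq, round_add_intCast]
  push_cast
  congr 1
  ring

theorem distInt_eq_abs {x : ℝ} (hx : |x| ≤ 1 / 2) : distInt x = |x| := by
  have := (AddCircle.norm_coe_eq_abs_iff (1 : ℝ) (x := x) one_ne_zero).2 (by simpa using hx)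
  exact this

theorem distInt_sub_le (x y : ℝ) : distInt (x - y) ≤ distInt x + distInt y := by
  unfold distInt
  rw [AddCircle.coe_sub]
  exact norm_sub_le _ _

theorem distInt_le_add (x y : ℝ) : distInt x ≤ distInt (x + y) + |y| := by
  have h1 := distInt_sub_le (x + y) y
  have h2 := distInt_le_abs_sub_int y 0
  simp only [add_sub_cancel_right, Int.cast_zero, sub_zero] at h1 h2
  linarith

theorem le_distInt_div {q : ℕ} (hq : 1 < q) {a : ℤ} (ha : ¬ (q : ℤ) ∣ a) :
    1 / (q : ℝ) ≤ distInt (a / q) := by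
  have hq0 : (0 : ℝ) < q := by positivity
  rw [distInt_eq]
  set N := round ((a : ℝ) / q)
  have h1 : a - N * q ≠ 0 := by
    intro h
    exact ha ⟨N, by linarith⟩
  have h2 : (1 : ℝ) ≤ |((a - N * q : ℤ) : ℝ)| := by exact_mod_cast Int.one_le_abs h1
  have e : (a : ℝ) / q - N = ((a - N * q : ℤ) : ℝ) / q := by
    push_cast
    field_simp
  rw [e, abs_div, abs_of_pos hq0]
  gcongr

/-- While `p ^ k` times the distance stays at most `1 / 2`, multiplication by `p ^ k` scales the
distance exactly. The first `k` reaching `1 / (2 p)` cannot overshoot `1 / 2`. -/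
theorem exists_pow_mul_distInt_large {p : ℕ} (hp : 1 < p) {y : ℝ} (hy : 0 < distInt y) :
    ∃ k : ℕ, (p : ℝ) ^ k * distInt y ≤ 1 / 2 ∧ 1 / (2 * p) ≤ distInt (p ^ k * y) := by
  have hp' : (1 : ℝ) < p := by exact_mod_cast hp
  have hp0 : (0 : ℝ) < p := by linarith
  have hex : ∃ k : ℕ, 1 / (2 * p) ≤ (p : ℝ) ^ k * distInt y := by
    obtain ⟨k, hk⟩ := pow_unbounded_of_one_lt (1 / distInt y) hp'
    refine ⟨k, ?_⟩
    rw [div_lt_iff₀ hy] at hk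
    have : 1 / (2 * (p : ℝ)) ≤ 1 := by
      rw [div_le_one (by positivity)]; linarith
    linarith
  classical
  set k := Nat.find hex with hk
  have h1 := Nat.find_spec hex
  have hhalf : (p : ℝ) ^ k * distInt y ≤ 1 / 2 := by
    rcases Nat.eq_zero_or_pos k with h0 | h0
    · rw [h0, pow_zero, one_mul]; exact distInt_le_half y
    · have := Nat.find_min hex (show k - 1 < Nat.find hex by omega)
      have e : (p : ℝ) ^ k = p * p ^ (k - 1) := by
        rw [← pow_succ', Nat.sub_add_cancel h0]
      rw [not_le, lt_div_iff₀ (by positivity)] at this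
      rw [e]
      linarith
  refine ⟨k, hhalf, ?_⟩
  have e : (p : ℝ) ^ k * y = p ^ k * (y - round y) + ((p ^ k * round y : ℤ) : ℝ) := by
    push_cast; ring
  have habs : |(p : ℝ) ^ k * (y - round y)| = p ^ k * distInt y := by
    rw [abs_mul, abs_of_pos (by positivity), distInt_eq]
  rw [e, distInt_add_int, distInt_eq_abs (by rw [habs]; exact hhalf), habs]
  exact h1

theorem pow_mul_pow_injective {p q : ℕ} (hp : 1 < p) (hq : 1 < q) (hpq : p.Coprime q)
    {a b a' b' : ℕ} (h : p ^ a * q ^ b = p ^ a' * q ^ b') : a = a' ∧ b = b' := by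
  have key : ∀ {p q : ℕ}, 1 < p → p.Coprime q → ∀ {a b a' b' : ℕ},
      p ^ a * q ^ b = p ^ a' * q ^ b' → a ≤ a' := by
    intro p q hp hpq a b a' b' h
    have h1 : p ^ a ∣ p ^ a' * q ^ b' := h ▸ Dvd.intro _ rfl
    exact (Nat.pow_dvd_pow_iff_le_right hp).1 ((hpq.pow a b').dvd_of_dvd_mul_right h1)
  have h' : q ^ b * p ^ a = q ^ b' * p ^ a' := by rw [mul_comm, h, mul_comm]
  exact ⟨le_antisymm (key hp hpq h) (key hp hpq h.symm),
    le_antisymm (key hq hpq.symm h') (key hq hpq.symm h'.symm)⟩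

/-- The elements `h` of `T` such that `x * h` is at distance at least `θ` from the integers. -/
noncomputable def hits (T : Finset ℕ) (θ x : ℝ) : Finset ℕ :=
  T.filter fun h : ℕ => θ ≤ distInt (x * h)

/-- If no `x q ^ j` with `j ≤ J` is very close to an integer, every row `j` yields a hit `p ^ k q ^
j`. Otherwise take the first `j` where this fails: `x q ^ (j - 1)` is very close to some `a / q`
with `q ∤ a`, and multiplying by `p ^ k`, coprime to `q`, keeps it near a non-integral multiple of
`1 / q`, so every `k ≤ K` gives a hit. -/
theorem min_le_card_hits {p q : ℕ} (hp : 1 < p) (hq : 1 < q) (hpq : p.Coprime q) {Q : ℝ}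
    (hQ : 0 < Q) {T : Finset ℕ} (hT : ∀ k j : ℕ, (p : ℝ) ^ k * q ^ j ≤ Q → p ^ k * q ^ j ∈ T)
    {J K : ℕ} (hJK : 2 * ((p : ℝ) ^ K * q ^ J) ≤ Q) {x : ℝ} (hx1 : |x| ≤ 1 / 2) (hx2 : 1 / Q < |x|) :
    min (J + 1) (K + 1) ≤ (hits T (1 / (2 * p * q)) x).card := by
  have hp' : (1 : ℝ) < p := by exact_mod_cast hp
  have hq' : (1 : ℝ) < q := by exact_mod_cast hq
  have hθp : 1 / (2 * (p : ℝ) * q) ≤ 1 / (2 * p) := by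
    apply one_div_le_one_div_of_le (by positivity)
    nlinarith
  have hθq : 1 / (2 * (p : ℝ) * q) ≤ 1 / (2 * q) := by
    apply one_div_le_one_div_of_le (by positivity)
    nlinarith
  by_cases hall : ∀ j ≤ J, (q : ℝ) ^ j / Q < distInt (x * q ^ j)
  · refine (min_le_left _ _).trans ?_
    have hex : ∀ j ≤ J, ∃ k : ℕ, p ^ k * q ^ j ∈ hits T (1 / (2 * p * q)) x := by
      intro j hj
      have hpos : 0 < (q : ℝ) ^ j / Q := by positivity
      obtain ⟨k, hk1, hk2⟩ := exists_pow_mul_distInt_large hp (hpos.trans (hall j hj))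
      refine ⟨k, Finset.mem_filter.2 ⟨hT k j ?_, ?_⟩⟩
      · have h3 : (p : ℝ) ^ k * (q ^ j / Q) ≤ 1 / 2 :=
          le_trans (by gcongr; exact (hall j hj).le) hk1
        rw [← mul_div_assoc, div_le_iff₀ hQ] at h3
        linarith
      · refine hθp.trans (hk2.trans (le_of_eq ?_))
        congr 1
        push_cast
        ring
    choose! k hk using hex
    have := Finset.card_le_card_of_injOn (s := Finset.range (J + 1)) (fun j => p ^ k j * q ^ j)
      (t := hits T (1 / (2 * p * q)) x) (fun j hj => hk j (by simpa [Nat.lt_succ_iff] using hj))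
      (fun a _ b _ hab => (pow_mul_pow_injective hp hq hpq hab).2)
    simpa using this
  · refine (min_le_right _ _).trans ?_
    push Not at hall
    classical
    set j := Nat.find hall with hj
    obtain ⟨hjJ, hjd⟩ := Nat.find_spec hall
    rw [← hj] at hjJ hjd
    -- The index `0` cannot fail, because `|x| > 1 / Q`.
    have hj1 : 1 ≤ j := by
      by_contra h0
      have : j = 0 := by omega
      rw [this, pow_zero, mul_one, distInt_eq_abs hx1] at hjd
      linarith
    have hprev : (q : ℝ) ^ (j - 1) / Q < distInt (x * q ^ (j - 1)) := by
      have := Nat.find_min hall (show j - 1 < Nat.find hall by omega)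
      by_contra hcon
      exact this ⟨by omega, not_lt.1 hcon⟩
    have hqj : (q : ℝ) ^ j = q ^ (j - 1) * q := by
      rw [← pow_succ, Nat.sub_add_cancel hj1]
    set a := round (x * (q : ℝ) ^ j) with ha
    set δ := x * (q : ℝ) ^ j - a with hδ
    have hδle : |δ| ≤ q ^ j / Q := by rw [hδ, ha, ← distInt_eq]; exact hjd
    have hxq : x * (q : ℝ) ^ (j - 1) = (a + δ) / q := by
      rw [eq_div_iff (by positivity), hδ, hqj]; ring
    -- If `q` divided `a`, dividing by `q` would make `j - 1` a failing index, against minimality.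
    have hqa : ¬ (q : ℤ) ∣ a := by
      rintro ⟨b, hb⟩
      have h1 := distInt_le_abs_sub_int (x * (q : ℝ) ^ (j - 1)) b
      have h2 : x * (q : ℝ) ^ (j - 1) - b = δ / q := by
        rw [hxq, hb]; push_cast; field_simp; ring
      rw [h2, abs_div, abs_of_pos (by positivity : (0 : ℝ) < q)] at h1
      have h3 : |δ| / q ≤ q ^ (j - 1) / Q := by
        rw [div_le_iff₀ (by positivity)]
        calc |δ| ≤ q ^ j / Q := hδle
          _ = _ := by rw [hqj]; ring
      linarith
    have hmem : ∀ k ≤ K, p ^ k * q ^ (j - 1) ∈ hits T (1 / (2 * p * q)) x := by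
      intro k hk
      have hkK : (p : ℝ) ^ k ≤ p ^ K := pow_le_pow_right₀ hp'.le hk
      have hjJ' : (q : ℝ) ^ j ≤ q ^ J := pow_le_pow_right₀ hq'.le hjJ
      have hjj : (q : ℝ) ^ (j - 1) ≤ q ^ J := pow_le_pow_right₀ hq'.le (by omega)
      refine Finset.mem_filter.2 ⟨hT k _ ?_, ?_⟩
      · have h5 : (p : ℝ) ^ k * q ^ (j - 1) ≤ p ^ K * q ^ J := by gcongr
        have h6 : 0 < (p : ℝ) ^ K * q ^ J := by positivity
        linarith
      · have hndvd : ¬ (q : ℤ) ∣ p ^ k * a := by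
          intro hdvd
          have hcop : IsCoprime (q : ℤ) ((p : ℤ) ^ k) :=
            (Nat.isCoprime_iff_coprime.2 hpq.symm).pow_right
          exact hqa (hcop.dvd_of_dvd_mul_left hdvd)
        have h1 := le_distInt_div hq hndvd
        have h2 := distInt_le_add (((p ^ k * a : ℤ) : ℝ) / q) (p ^ k * δ / q)
        have e : ((p ^ k * a : ℤ) : ℝ) / q + p ^ k * δ / q
            = x * ((p ^ k * q ^ (j - 1) : ℕ) : ℝ) := by
          push_cast
          calc _ = (p : ℝ) ^ k * ((a + δ) / q) := by ring
            _ = _ := by rw [← hxq]; ring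
        rw [e] at h2
        have h3 : |(p : ℝ) ^ k * δ / q| ≤ 1 / (2 * q) := by
          rw [abs_div, abs_mul, abs_of_pos (by positivity : (0 : ℝ) < p ^ k),
            abs_of_pos (by positivity : (0 : ℝ) < q)]
          have h4 : (p : ℝ) ^ k * |δ| ≤ 1 / 2 := by
            calc (p : ℝ) ^ k * |δ| ≤ p ^ K * (q ^ J / Q) := by
                  gcongr
                  exact hδle.trans (by gcongr)
              _ = p ^ K * q ^ J / Q := by ring
              _ ≤ 1 / 2 := by rw [div_le_iff₀ hQ]; linarith
          calc _ ≤ (1 / 2) / (q : ℝ) := by gcongr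
            _ = _ := by rw [div_div]
        have h4 : 1 / (q : ℝ) = 1 / (2 * q) + 1 / (2 * q) := by field_simp; norm_num
        linarith
    have := Finset.card_le_card_of_injOn (s := Finset.range (K + 1)) (fun k => p ^ k * q ^ (j - 1))
      (t := hits T (1 / (2 * p * q)) x) (fun k hk => hmem k (by simpa [Nat.lt_succ_iff] using hk))
      (fun a _ b _ hab => (pow_mul_pow_injective hp hq hpq hab).1)
    simpa using this

/-- One factor of the row product: `1` near the integers and `lam` elsewhere. -/
noncomputable def rowFactor (p : ℕ) (lam y : ℝ) : ℝ := if distInt y < 1 / (2 * p) then 1 else lam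

/-- `lam` to the number of `k < K` with `p ^ k * y` not close to an integer. -/
noncomputable def rowProd (p : ℕ) (lam : ℝ) (K : ℕ) (y : ℝ) : ℝ :=
  ∏ k ∈ Finset.range K, rowFactor p lam (p ^ k * y)

section row

variable {p : ℕ} {lam : ℝ}

theorem measurable_rowFactor : Measurable (rowFactor p lam) :=
  Measurable.ite (measurableSet_lt measurable_distInt measurable_const) measurable_const
    measurable_const

theorem measurable_rowProd (K : ℕ) : Measurable (rowProd p lam K) := by
  unfold rowProd
  exact Finset.measurable_fun_prod _ fun k _ => measurable_rowFactor.comp (measurable_const_mul _)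

theorem rowFactor_nonneg (h0 : 0 ≤ lam) (y : ℝ) : 0 ≤ rowFactor p lam y := by
  rw [rowFactor]; split_ifs <;> linarith

theorem rowFactor_le_one (h1 : lam ≤ 1) (y : ℝ) : rowFactor p lam y ≤ 1 := by
  rw [rowFactor]; split_ifs <;> linarith

theorem rowProd_nonneg (h0 : 0 ≤ lam) (K : ℕ) (y : ℝ) : 0 ≤ rowProd p lam K y :=
  Finset.prod_nonneg fun _ _ => rowFactor_nonneg h0 _

theorem rowProd_le_one (h0 : 0 ≤ lam) (h1 : lam ≤ 1) (K : ℕ) (y : ℝ) : rowProd p lam K y ≤ 1 :=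
  Finset.prod_le_one (fun _ _ => rowFactor_nonneg h0 _) fun _ _ => rowFactor_le_one h1 _

theorem periodic_rowProd (K : ℕ) : Function.Periodic (rowProd p lam K) 1 := by
  intro y
  unfold rowProd
  refine Finset.prod_congr rfl fun k _ => ?_
  have : (p : ℝ) ^ k * (y + 1) = p ^ k * y + ((p ^ k : ℤ) : ℝ) := by push_cast; ring
  rw [rowFactor, rowFactor, this, distInt_add_int]

theorem intervalIntegrable_of_bounded {f : ℝ → ℝ} (hf : Measurable f) (h0 : ∀ y, 0 ≤ f y)
    {C : ℝ} (h1 : ∀ y, f y ≤ C) (a b : ℝ) : IntervalIntegrable f volume a b := by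
  rw [intervalIntegrable_iff]
  refine Measure.integrableOn_of_bounded (M := C) (by simp) hf.aestronglyMeasurable ?_
  refine Eventually.of_forall fun y => ?_
  rw [Real.norm_of_nonneg (h0 y)]
  exact h1 y

/-- The points `(y + i) / p` are at mutual distance at least `1 / p` modulo `1`, so at most one lies
within `1 / (2 p)` of an integer. -/
theorem sum_rowFactor_le (hp : 1 < p) (h0 : 0 ≤ lam) (y : ℝ) :
    ∑ i ∈ Finset.range p, rowFactor p lam ((y + i) / p) ≤ 1 + p * lam := by
  have hp0 : (0 : ℝ) < p := by positivity
  set A := (Finset.range p).filter fun i : ℕ => distInt ((y + i) / p) < 1 / (2 * p) with hA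
  have hcard : A.card ≤ 1 := by
    rw [Finset.card_le_one]
    intro i hi j hj
    by_contra hij
    obtain ⟨hi1, hi2⟩ := Finset.mem_filter.1 hi
    obtain ⟨hj1, hj2⟩ := Finset.mem_filter.1 hj
    rw [Finset.mem_range] at hi1 hj1
    have hnd : ¬ (p : ℤ) ∣ ((i : ℤ) - j) := by
      intro hd
      have := Int.eq_zero_of_abs_lt_dvd hd (by rw [abs_lt]; constructor <;> omega)
      omega
    have h1 := le_distInt_div hp hnd
    have h2 := distInt_sub_le ((y + i) / p) ((y + j) / p)
    have e : (y + i) / p - (y + j) / p = (((i : ℤ) - j : ℤ) : ℝ) / p := by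
      push_cast; ring
    rw [e] at h2
    have h3 : 1 / (p : ℝ) = 1 / (2 * p) + 1 / (2 * p) := by field_simp; norm_num
    linarith
  calc _ ≤ ∑ i ∈ Finset.range p, (lam + if distInt ((y + i) / p) < 1 / (2 * p) then 1 else 0) := by
        refine Finset.sum_le_sum fun i _ => ?_
        rw [rowFactor]
        split_ifs <;> linarith
    _ = p * lam + A.card := by
        rw [Finset.sum_add_distrib, Finset.sum_boole]
        simp [hA]
    _ ≤ _ := by
        have : (A.card : ℝ) ≤ 1 := by exact_mod_cast hcard
        linarith

/-- A transfer operator bound for `y ↦ p y` modulo `1`: change variables, use the period of `g`, and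
sum the row factor over the `p` preimages of a point. -/
theorem integral_rowFactor_mul_comp_le (hp : 1 < p) (h0 : 0 ≤ lam) (h1 : lam ≤ 1) {g : ℝ → ℝ}
    (hg : Measurable g) (hg0 : ∀ y, 0 ≤ g y) (hg1 : ∀ y, g y ≤ 1) (hper : Function.Periodic g 1) :
    ∫ y in (0 : ℝ)..1, rowFactor p lam y * g (p * y)
      ≤ (1 + p * lam) / p * ∫ y in (0 : ℝ)..1, g y := by
  have hp0 : (0 : ℝ) < p := by positivity
  set F : ℝ → ℝ := fun y => rowFactor p lam (y / p) * g y with hF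
  have hFm : Measurable F := (measurable_rowFactor.comp (measurable_id.div_const _)).mul hg
  have hF0 : ∀ y, 0 ≤ F y := fun y => mul_nonneg (rowFactor_nonneg h0 _) (hg0 y)
  have hF1 : ∀ y, F y ≤ 1 := fun y => mul_le_one₀ (rowFactor_le_one h1 _) (hg0 y) (hg1 y)
  have e1 : ∫ y in (0 : ℝ)..1, rowFactor p lam y * g (p * y) = (p : ℝ)⁻¹ * ∫ y in (0 : ℝ)..p, F y := by
    have := intervalIntegral.integral_comp_mul_left (a := 0) (b := 1) F hp0.ne'
    rw [mul_zero, mul_one, smul_eq_mul] at this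
    rw [← this]
    refine intervalIntegral.integral_congr fun y _ => ?_
    simp only [hF]
    rw [mul_div_cancel_left₀ _ hp0.ne']
  have e2 : ∫ y in (0 : ℝ)..p, F y = ∑ i ∈ Finset.range p, ∫ y in (0 : ℝ)..1, F (y + i) := by
    have := intervalIntegral.sum_integral_adjacent_intervals (f := F) (μ := volume)
      (a := fun i : ℕ => (i : ℝ)) (n := p)
      (fun k _ => intervalIntegrable_of_bounded hFm hF0 hF1 _ _)
    rw [Nat.cast_zero] at this
    rw [← this]
    refine Finset.sum_congr rfl fun i _ => ?_
    rw [intervalIntegral.integral_comp_add_right]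
    congr 1 <;> push_cast <;> ring
  have e3 : ∑ i ∈ Finset.range p, ∫ y in (0 : ℝ)..1, F (y + i)
      = ∫ y in (0 : ℝ)..1, (∑ i ∈ Finset.range p, rowFactor p lam ((y + i) / p)) * g y := by
    rw [← intervalIntegral.integral_finsetSum]
    · refine intervalIntegral.integral_congr fun y _ => ?_
      simp only [hF]
      rw [Finset.sum_mul]
      refine Finset.sum_congr rfl fun i _ => ?_
      have := hper.nat_mul i y
      rw [mul_one] at this
      rw [this]
    · intro i _
      exact intervalIntegrable_of_bounded (hFm.comp (measurable_add_const _)) (fun y => hF0 _)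
        (fun y => hF1 _) _ _
  rw [e1, e2, e3, div_eq_inv_mul, mul_assoc]
  refine mul_le_mul_of_nonneg_left ?_ (by positivity)
  rw [← intervalIntegral.integral_const_mul]
  have hm1 : Measurable fun y : ℝ => ∑ i ∈ Finset.range p, rowFactor p lam ((y + i) / p) :=
    Finset.measurable_fun_sum _ fun i _ =>
      measurable_rowFactor.comp ((measurable_id.add_const _).div_const _)
  have hs0 : ∀ y : ℝ, 0 ≤ ∑ i ∈ Finset.range p, rowFactor p lam ((y + i) / p) :=
    fun y => Finset.sum_nonneg fun _ _ => rowFactor_nonneg h0 _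
  have hle : ∀ y : ℝ, (∑ i ∈ Finset.range p, rowFactor p lam ((y + i) / p)) * g y
      ≤ (1 + p * lam) * g y := fun y =>
    mul_le_mul_of_nonneg_right (sum_rowFactor_le hp h0 y) (hg0 y)
  have hub : ∀ y : ℝ, (1 + p * lam) * g y ≤ 1 + p * lam := fun y =>
    mul_le_of_le_one_right (by positivity) (hg1 y)
  refine intervalIntegral.integral_mono_on zero_le_one ?_ ?_ fun y _ => hle y
  · exact intervalIntegrable_of_bounded (hm1.mul hg) (fun y => mul_nonneg (hs0 y) (hg0 y))
      (fun y => (hle y).trans (hub y)) _ _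
  · exact intervalIntegrable_of_bounded (measurable_const.mul hg)
      (fun y => mul_nonneg (by positivity) (hg0 y)) hub _ _

/-- The factor with `k = 0` is peeled off and the rest is a function of `p y`, so the transfer bound
iterates. -/
theorem integral_rowProd_le (hp : 1 < p) (h0 : 0 ≤ lam) (h1 : lam ≤ 1) (K : ℕ) :
    ∫ y in (0 : ℝ)..1, rowProd p lam K y ≤ ((1 + p * lam) / p) ^ K := by
  induction K with
  | zero => simp [rowProd]
  | succ K ih =>
    have e : ∀ y, rowProd p lam (K + 1) y = rowFactor p lam y * rowProd p lam K (p * y) := by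
      intro y
      rw [rowProd, Finset.prod_range_succ', mul_comm, rowProd]
      congr 1
      · simp
      · refine Finset.prod_congr rfl fun k _ => ?_
        congr 1
        ring
    simp only [e]
    refine (integral_rowFactor_mul_comp_le hp h0 h1 (measurable_rowProd K) (rowProd_nonneg h0 K)
      (rowProd_le_one h0 h1 K) (periodic_rowProd K)).trans ?_
    rw [pow_succ']
    gcongr

/-- Multiplication by `N` preserves Lebesgue measure modulo `1`; hence all rows `x q ^ j` have the
same integral. -/
theorem integral_comp_nat_mul_of_periodic {g : ℝ → ℝ} (hg : Measurable g) (hg0 : ∀ y, 0 ≤ g y)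
    (hg1 : ∀ y, g y ≤ 1) (hper : Function.Periodic g 1) {N : ℕ} (hN : 0 < N) :
    ∫ y in (-(1 / 2) : ℝ)..1 / 2, g (y * N) = ∫ y in (0 : ℝ)..1, g y := by
  have hN0 : (N : ℝ) ≠ 0 := by positivity
  rw [intervalIntegral.integral_comp_mul_right _ hN0]
  have h := hper.intervalIntegral_add_zsmul_eq N (-(1 / 2) * (N : ℝ))
    (intervalIntegrable_of_bounded hg hg0 hg1)
  have e : -(1 / 2) * (N : ℝ) + (N : ℤ) • (1 : ℝ) = 1 / 2 * N := by
    simp; ring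
  rw [e] at h
  rw [h]
  have := hper.intervalIntegral_add_eq 0 (-(1 / 2) * (N : ℝ))
  rw [zero_add] at this
  rw [← this]
  simp [hN0]

end row

/-- A cheap substitute for Hölder's inequality: the sum is at least `s.card` times its least term.
It decouples the rows at the price of a factor equal to their number. -/
theorem exp_neg_sum_le {ι : Type*} (s : Finset ι) (hs : s.Nonempty) (b : ι → ℝ) :
    Real.exp (-∑ i ∈ s, b i) ≤ ∑ i ∈ s, Real.exp (-(s.card * b i)) := by
  obtain ⟨i, hi, hmin⟩ := s.exists_min_image b hs
  have h1 : s.card * b i ≤ ∑ j ∈ s, b j := by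
    rw [← nsmul_eq_mul]
    exact Finset.card_nsmul_le_sum s b (b i) hmin
  calc _ ≤ Real.exp (-(s.card * b i)) := Real.exp_le_exp.2 (by linarith)
    _ ≤ _ := Finset.single_le_sum (f := fun i => Real.exp (-(s.card * b i)))
      (fun _ _ => Real.exp_nonneg _) hi

/-- The indices of the elements in a row which are counted by `hits`. -/
noncomputable def rowHits (p K : ℕ) (y : ℝ) : Finset ℕ :=
  (Finset.range K).filter fun k : ℕ => ¬ distInt (p ^ k * y) < 1 / (2 * p)

theorem rowProd_eq (p : ℕ) (lam : ℝ) (K : ℕ) (y : ℝ) :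
    rowProd p lam K y = lam ^ (rowHits p K y).card := by
  rw [rowProd, rowHits]
  simp only [rowFactor]
  rw [Finset.prod_ite]
  simp

theorem sum_card_rowHits_le {p q : ℕ} (hp : 1 < p) (hq : 1 < q) (hpq : p.Coprime q) {Q : ℝ}
    {T : Finset ℕ} (hT : ∀ k j : ℕ, (p : ℝ) ^ k * q ^ j ≤ Q → p ^ k * q ^ j ∈ T)
    {J K : ℕ} (hJK : (p : ℝ) ^ K * q ^ J ≤ Q) (x : ℝ) :
    ∑ j ∈ Finset.range J, (rowHits p K (x * (q ^ j : ℕ))).card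
      ≤ (hits T (1 / (2 * p * q)) x).card := by
  have hp' : (1 : ℝ) < p := by exact_mod_cast hp
  have hq' : (1 : ℝ) < q := by exact_mod_cast hq
  rw [← Finset.card_sigma]
  refine Finset.card_le_card_of_injOn (fun z => p ^ z.2 * q ^ z.1) ?_ ?_
  · rintro ⟨j, k⟩ hz
    simp only [Finset.coe_sigma, Set.mem_sigma_iff, Finset.mem_coe, Finset.mem_range, rowHits,
      Finset.mem_filter, not_lt] at hz
    obtain ⟨hj, hk, hd⟩ := hz
    refine Finset.mem_coe.2 (Finset.mem_filter.2 ⟨hT k j ?_, ?_⟩)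
    · refine le_trans ?_ hJK
      gcongr
      · exact hp'.le
      · exact hq'.le
    · have : 1 / (2 * (p : ℝ) * q) ≤ 1 / (2 * p) := by
        apply one_div_le_one_div_of_le (by positivity)
        nlinarith
      refine this.trans (hd.trans (le_of_eq ?_))
      congr 1
      push_cast
      ring
  · rintro ⟨j, k⟩ _ ⟨j', k'⟩ _ h
    obtain ⟨h1, h2⟩ := pow_mul_pow_injective hp hq hpq h
    dsimp only at h1 h2
    rw [h1, h2]

theorem measurable_card_hits (T : Finset ℕ) (θ : ℝ) :
    Measurable fun x => ((hits T θ x).card : ℝ) := by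
  have : ∀ x, ((hits T θ x).card : ℝ) = ∑ h ∈ T, if θ ≤ distInt (x * h) then 1 else 0 := by
    intro x; rw [hits, Finset.sum_boole]
  simp only [this]
  exact Finset.measurable_fun_sum _ fun h _ => Measurable.ite
    (measurableSet_le measurable_const (measurable_distInt.comp (measurable_mul_const _)))
    measurable_const measurable_const

theorem exists_log_le_card_hits {p q : ℕ} (hp : 1 < p) (hq : 1 < q) (hpq : p.Coprime q) :
    ∃ γ > 0, ∀ Q : ℝ, 16 ≤ Q → ∀ T : Finset ℕ,
      (∀ k j : ℕ, (p : ℝ) ^ k * q ^ j ≤ Q → p ^ k * q ^ j ∈ T) →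
      ∀ x : ℝ, |x| ≤ 1 / 2 → 1 / Q < |x| →
        γ * Real.log Q ≤ (hits T (1 / (2 * p * q)) x).card := by
  have hp' : (1 : ℝ) < p := by exact_mod_cast hp
  have hq' : (1 : ℝ) < q := by exact_mod_cast hq
  have hlp : 0 < Real.log p := Real.log_pos hp'
  have hlq : 0 < Real.log q := Real.log_pos hq'
  set γ := min (1 / (2 * Real.log q)) (1 / (4 * Real.log p)) with hγ
  have hγ0 : 0 < γ := lt_min (by positivity) (by positivity)
  have hγq : γ * (2 * Real.log q) ≤ 1 := by
    rw [← le_div_iff₀ (by positivity)]; exact min_le_left _ _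
  have hγp : γ * (4 * Real.log p) ≤ 1 := by
    rw [← le_div_iff₀ (by positivity)]; exact min_le_right _ _
  refine ⟨γ, hγ0, fun Q hQ16 T hT => ?_⟩
  have hQ0 : 0 < Q := by linarith
  have hlQ : 0 < Real.log Q := Real.log_pos (by linarith)
  have hsq : Real.sqrt Q * Real.sqrt Q = Q := Real.mul_self_sqrt hQ0.le
  have hs4 : 4 ≤ Real.sqrt Q := Real.le_sqrt_of_sq_le (by linarith)
  intro x hx1 hx2
  -- Take `q ^ j` near `√Q` and `p ^ k` near `√Q / 2`, so that `2 p ^ k q ^ j ≤ Q`. The bound `Q ≥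
  -- 16` gives `log (√Q / 2) ≥ log Q / 4`.
  obtain ⟨j, hj1, hj2⟩ := exists_nat_pow_near (show 1 ≤ Real.sqrt Q by linarith) hq'
  obtain ⟨k, hk1, hk2⟩ := exists_nat_pow_near (show 1 ≤ Real.sqrt Q / 2 by linarith) hp'
  have hmin := min_le_card_hits hp hq hpq hQ0 hT (J := j) (K := k) (by
    calc 2 * ((p : ℝ) ^ k * q ^ j) ≤ 2 * (Real.sqrt Q / 2 * Real.sqrt Q) := by gcongr
      _ = Q := by linarith) hx1 hx2
  have hmin' : min ((j : ℝ) + 1) (k + 1) ≤ (hits T (1 / (2 * p * q)) x).card := by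
    exact_mod_cast hmin
  refine le_trans (le_min ?_ ?_) hmin'
  · have h1 := Real.log_le_log (by linarith) hj2.le
    rw [Real.log_pow, Real.log_sqrt hQ0.le] at h1
    push_cast at h1
    have h2 : γ * Real.log Q ≤ γ * (2 * Real.log q) * (j + 1) := by nlinarith
    nlinarith
  · have h1 := Real.log_le_log (by linarith) hk2.le
    rw [Real.log_pow, Real.log_div (by linarith) (by norm_num), Real.log_sqrt hQ0.le] at h1
    push_cast at h1
    have h16 : 4 * Real.log 2 ≤ Real.log Q := by
      have := Real.log_le_log (by norm_num) hQ16
      rw [show (16 : ℝ) = 2 ^ 4 by norm_num, Real.log_pow] at this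
      exact_mod_cast this
    have h2 : γ * Real.log Q ≤ γ * (4 * Real.log p) * (k + 1) := by nlinarith
    nlinarith

set_option maxHeartbeats 600000 in
/-- The minor arc estimate. -/
theorem exists_integral_minor_le {p q : ℕ} (hp : 1 < p) (hq : 1 < q) (hpq : p.Coprime q) {c : ℝ}
    (hc : 0 < c) :
    ∃ δ > 0, ∃ C > 0, ∃ Q₀ > 1, ∀ Q ≥ Q₀, ∀ T : Finset ℕ,
      (∀ k j : ℕ, (p : ℝ) ^ k * q ^ j ≤ Q → p ^ k * q ^ j ∈ T) →
      ∫ x in Set.Icc (-(1 / 2) : ℝ) (1 / 2) ∩ {x | 1 / Q < |x|},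
          Real.exp (-(c * (hits T (1 / (2 * p * q)) x).card))
        ≤ C * Real.exp (-((1 + δ) * Real.log Q)) := by
  have hp' : (1 : ℝ) < p := by exact_mod_cast hp
  have hq' : (1 : ℝ) < q := by exact_mod_cast hq
  have hlp : 0 < Real.log p := Real.log_pos hp'
  obtain ⟨γ, hγ0, hpoint'⟩ := exists_log_le_card_hits hp hq hpq
  -- The number `J` of rows is chosen so large that `(1 + p lam) ^ K` costs at most `Q ^ (c γ / 4)`,
  -- half of the pointwise saving `Q ^ (-c γ / 2)` encoded in `E`. What remains is `δ = c γ / 4`.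
  obtain ⟨J, hJ1, hJ⟩ : ∃ J : ℕ, 1 ≤ J ∧ p * Real.exp (-(J * (c / 2))) ≤ c * γ / 4 * Real.log p := by
    have h1 : Tendsto (fun J : ℕ => (p : ℝ) * Real.exp (-(J * (c / 2)))) atTop (𝓝 (p * 0)) := by
      refine Tendsto.const_mul _ (Real.tendsto_exp_neg_atTop_nhds_zero.comp ?_)
      exact tendsto_natCast_atTop_atTop.atTop_mul_const (by positivity)
    rw [mul_zero] at h1
    have h2 := h1.eventually_le_const (show 0 < c * γ / 4 * Real.log p by positivity)
    obtain ⟨J, h3, h4⟩ := (h2.and (eventually_ge_atTop 1)).exists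
    exact ⟨J, h4, h3⟩
  set lam := Real.exp (-(J * (c / 2))) with hlam
  have hlam0 : 0 ≤ lam := Real.exp_nonneg _
  have hlam1 : lam ≤ 1 := Real.exp_le_one_iff.2 (by
    have : 0 ≤ J * (c / 2) := by positivity
    linarith)
  refine ⟨c * γ / 4, by positivity, J * (p * q ^ J), by positivity, max 16 (q ^ J), by simp, ?_⟩
  intro Q hQ T hT
  have hQ16 : (16 : ℝ) ≤ Q := (le_max_left _ _).trans hQ
  have hQJ : (q : ℝ) ^ J ≤ Q := (le_max_right _ _).trans hQ
  have hQ0 : 0 < Q := by linarith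
  have hlQ : 0 < Real.log Q := Real.log_pos (by linarith)
  have hpoint := hpoint' Q hQ16 T hT
  obtain ⟨K, hK1, hK2⟩ := exists_nat_pow_near (show 1 ≤ Q / q ^ J by
    rw [one_le_div (by positivity)]; exact hQJ) hp'
  have hKJ : (p : ℝ) ^ K * q ^ J ≤ Q := by rwa [le_div_iff₀ (by positivity)] at hK1
  have hrow := sum_card_rowHits_le hp hq hpq hT hKJ
  have hJne : (Finset.range J).Nonempty := ⟨0, by simp; omega⟩
  set E := Real.exp (-(c * γ / 2 * Real.log Q)) with hE
  have hbound : ∀ x ∈ Set.Icc (-(1 / 2) : ℝ) (1 / 2) ∩ {x | 1 / Q < |x|},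
      Real.exp (-(c * (hits T (1 / (2 * p * q)) x).card))
        ≤ E * ∑ j ∈ Finset.range J, rowProd p lam K (x * (q ^ j : ℕ)) := by
    rintro x ⟨hx1, hx2⟩
    have h1 := hpoint x (abs_le.2 hx1) hx2
    have h2 : ((∑ j ∈ Finset.range J, (rowHits p K (x * (q ^ j : ℕ))).card : ℕ) : ℝ)
      ≤ (hits T (1 / (2 * p * q)) x).card := by exact_mod_cast hrow x
    push_cast at h2
    -- Half of `c H` is bounded below by the pointwise estimate, the other half by the row counts;
    -- only the latter is integrated.
    set H : ℝ := ((hits T (1 / (2 * p * q)) x).card : ℝ)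
    have h3 := exp_neg_sum_le (Finset.range J) hJne
      (fun j => c / 2 * ((rowHits p K (x * (q ^ j : ℕ))).card : ℝ))
    have h4 : ∀ j, Real.exp (-((Finset.range J).card *
        (c / 2 * ((rowHits p K (x * (q ^ j : ℕ))).card : ℝ)))) = rowProd p lam K (x * (q ^ j : ℕ)) := by
      intro j
      rw [rowProd_eq, hlam, ← Real.exp_nat_mul, Finset.card_range]
      congr 1
      ring
    simp only [h4] at h3
    rw [← Finset.mul_sum] at h3
    push_cast at h3 ⊢
    calc Real.exp (-(c * H)) ≤ Real.exp (-(c * γ / 2 * Real.log Q)) *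
          Real.exp (-(c / 2 * ∑ j ∈ Finset.range J, ((rowHits p K (x * q ^ j)).card : ℝ))) := by
          rw [← Real.exp_add]
          apply Real.exp_le_exp.2
          nlinarith
      _ ≤ _ := by rw [hE]; gcongr
  have hmeas : ∀ j, Measurable fun x : ℝ => rowProd p lam K (x * (q ^ j : ℕ)) :=
    fun j => (measurable_rowProd K).comp (measurable_mul_const _)
  have hint : ∀ j, IntegrableOn (fun x : ℝ => rowProd p lam K (x * (q ^ j : ℕ)))
      (Set.Icc (-(1 / 2)) (1 / 2)) := fun j => by
    refine Measure.integrableOn_of_bounded (M := 1) (by simp) (hmeas j).aestronglyMeasurable ?_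
    refine Eventually.of_forall fun y => ?_
    rw [Real.norm_of_nonneg (rowProd_nonneg hlam0 _ _)]
    exact rowProd_le_one hlam0 hlam1 _ _
  have hintS : IntegrableOn (fun x : ℝ => E * ∑ j ∈ Finset.range J, rowProd p lam K (x * (q ^ j : ℕ)))
      (Set.Icc (-(1 / 2)) (1 / 2)) :=
    (integrable_finsetSum _ fun j _ => hint j).const_mul _
  have hSmeas : MeasurableSet (Set.Icc (-(1 / 2) : ℝ) (1 / 2) ∩ {x | 1 / Q < |x|}) :=
    measurableSet_Icc.inter (measurableSet_lt measurable_const measurable_norm)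
  have hrowint : ∀ j, ∫ x in Set.Icc (-(1 / 2) : ℝ) (1 / 2), rowProd p lam K (x * (q ^ j : ℕ))
      ≤ ((1 + p * lam) / p) ^ K := by
    intro j
    rw [integral_Icc_eq_integral_Ioc, ← intervalIntegral.integral_of_le (by norm_num),
      integral_comp_nat_mul_of_periodic (measurable_rowProd K) (rowProd_nonneg hlam0 K)
        (rowProd_le_one hlam0 hlam1 K) (periodic_rowProd K) (by positivity)]
    exact integral_rowProd_le hp hlam0 hlam1 K
  have hKlog : K * Real.log p ≤ Real.log Q := by
    have h1 : (p : ℝ) ^ K ≤ Q := by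
      have : 1 ≤ (q : ℝ) ^ J := one_le_pow₀ hq'.le
      have : 0 < (p : ℝ) ^ K := by positivity
      nlinarith
    have := Real.log_le_log (by positivity) h1
    rwa [Real.log_pow] at this
  -- `p ^ (-K)` is within a factor `p q ^ J` of `1 / Q`, by maximality of `K`.
  have hpow : ((1 + p * lam) / p) ^ K ≤ Real.exp (c * γ / 4 * Real.log Q) * (p * q ^ J / Q) := by
    rw [div_pow, div_eq_mul_inv]
    have h1 : (1 + p * lam) ^ K ≤ Real.exp (c * γ / 4 * Real.log Q) := by
      calc (1 + p * lam) ^ K ≤ (Real.exp (p * lam)) ^ K := by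
            gcongr
            linarith [Real.add_one_le_exp (p * lam)]
        _ = Real.exp (K * (p * lam)) := by rw [← Real.exp_nat_mul]
        _ ≤ _ := by
          apply Real.exp_le_exp.2
          calc (K : ℝ) * (p * lam) ≤ K * (c * γ / 4 * Real.log p) := by gcongr
            _ = c * γ / 4 * (K * Real.log p) := by ring
            _ ≤ _ := by gcongr
    have h2 : ((p : ℝ) ^ K)⁻¹ ≤ p * q ^ J / Q := by
      rw [div_lt_iff₀ (by positivity), pow_succ] at hK2
      rw [inv_eq_one_div, div_le_div_iff₀ (by positivity) hQ0]
      linarith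
    exact mul_le_mul h1 h2 (by positivity) (Real.exp_nonneg _)
  calc _ ≤ ∫ x in Set.Icc (-(1 / 2) : ℝ) (1 / 2) ∩ {x | 1 / Q < |x|},
        E * ∑ j ∈ Finset.range J, rowProd p lam K (x * (q ^ j : ℕ)) := by
        refine setIntegral_mono_on ?_ (hintS.mono_set Set.inter_subset_left) hSmeas hbound
        refine Measure.integrableOn_of_bounded (M := 1) ?_
          ((measurable_card_hits T _).const_mul c).neg.exp.aestronglyMeasurable ?_
        · exact ((measure_mono Set.inter_subset_left).trans_lt (by simp)).ne
        · refine Eventually.of_forall fun y => ?_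
          rw [Real.norm_of_nonneg (Real.exp_nonneg _)]
          exact Real.exp_le_one_iff.2 (by
            have : 0 ≤ c * ((hits T (1 / (2 * p * q)) y).card : ℝ) := by positivity
            linarith)
    _ ≤ ∫ x in Set.Icc (-(1 / 2) : ℝ) (1 / 2),
        E * ∑ j ∈ Finset.range J, rowProd p lam K (x * (q ^ j : ℕ)) := by
        refine setIntegral_mono_set hintS ?_ (LE.le.eventuallyLE Set.inter_subset_left)
        exact Eventually.of_forall fun x => mul_nonneg (Real.exp_nonneg _)
          (Finset.sum_nonneg fun _ _ => rowProd_nonneg hlam0 _ _)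
    _ = E * ∑ j ∈ Finset.range J, ∫ x in Set.Icc (-(1 / 2) : ℝ) (1 / 2), rowProd p lam K (x * (q ^ j : ℕ)) := by
        rw [integral_const_mul, integral_finsetSum _ fun j _ => hint j]
    _ ≤ E * ∑ j ∈ Finset.range J, Real.exp (c * γ / 4 * Real.log Q) * (p * q ^ J / Q) := by
        gcongr with j _
        exact (hrowint j).trans hpow
    _ = J * (p * q ^ J) * (E * Real.exp (c * γ / 4 * Real.log Q) * Real.exp (-Real.log Q)) := by
        rw [Finset.sum_const, Finset.card_range, nsmul_eq_mul, Real.exp_neg (Real.log Q),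
          Real.exp_log hQ0]
        ring
    _ = _ := by
        rw [hE, ← Real.exp_add, ← Real.exp_add]
        congr 2
        ring

/-! ### Decay of the Fourier integrand on the two arcs. -/

/-- The exponent controlling the decay of `fourierProd`. -/
noncomputable def decay (p : Fin m → ℕ) (d n : ℕ) (r t s : ℝ) : ℝ :=
  ∑ h ∈ ppLe p n, digitW d r h 0 * digitW d r h 1 * (1 - Real.cos (t * h + s))

theorem decay_term_nonneg {d : ℕ} (hd : 2 ≤ d) (r t s : ℝ) (h : ℕ) :
    0 ≤ digitW d r h 0 * digitW d r h 1 * (1 - Real.cos (t * h + s)) :=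
  mul_nonneg (mul_nonneg (digitW_nonneg hd 0) (digitW_nonneg hd 1))
    (sub_nonneg.2 (Real.cos_le_one _))

theorem decay_term_le_two {d : ℕ} (hd : 2 ≤ d) (r t s : ℝ) (h : ℕ) :
    digitW d r h 0 * digitW d r h 1 * (1 - Real.cos (t * h + s)) ≤ 2 := by
  have h0 := digitW_le_one (r := r) (h := h) hd (show 0 < d by omega)
  have h1 := digitW_le_one (r := r) (h := h) hd (show 1 < d by omega)
  have h0' := digitW_nonneg (r := r) (h := h) hd 0
  have h1' := digitW_nonneg (r := r) (h := h) hd 1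
  have hc := Real.neg_one_le_cos (t * h + s)
  calc _ ≤ 1 * 2 := mul_le_mul (mul_le_one₀ h0 h1' h1) (by linarith)
        (sub_nonneg.2 (Real.cos_le_one _)) zero_le_one
    _ = 2 := one_mul _

theorem continuous_decay (p : Fin m → ℕ) (d n : ℕ) (r s : ℝ) :
    Continuous fun t => decay p d n r t s := by
  unfold decay
  fun_prop

theorem norm_fourierProd_charFun_le {p : Fin m → ℕ} {d : ℕ} (hd : 2 ≤ d) (n : ℕ) (r t s : ℝ) :
    ‖fourierProd p d r n (fun h c => Complex.exp ((s * (nz c - digitQ d r h) : ℝ) * Complex.I)) t‖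
      ≤ Real.exp (-decay p d n r t s) := by
  rw [fourierProd, norm_prod, decay, ← Finset.sum_neg_distrib, Real.exp_sum]
  refine Finset.prod_le_prod (fun _ _ => norm_nonneg _) fun h _ => ?_
  have := norm_sum_exp_le hd (fun c => digitW_nonneg (r := r) (h := h) hd c) (sum_digitW hd)
    (fun c => phase d r t s h c)
  have e : phase d r t s h 1 - phase d r t s h 0 = t * h + s := by
    simp only [phase, nz]
    push_cast
    simp
    ring
  rw [e] at this
  refine le_trans (le_of_eq ?_) this
  congr 1
  refine Finset.sum_congr rfl fun c _ => ?_
  rw [← Complex.exp_add]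
  congr 2
  rw [phase]
  push_cast
  ring

/-- Test functions for joint moments: centred functions of the digits of `h ∈ A`. -/
noncomputable def testFun (A : Finset ℕ) (Y : ℕ → ℕ → ℝ) (h c : ℕ) : ℂ :=
  if h ∈ A then (Y h c : ℂ) else 1

/-- For `h ∈ A` centring gains `|t| h` times the mean digit, but the decay factor of `h` is not
obtained at the same time. One term of `decay` is at most `2`, so a factor `exp 2` per element
restores the complete exponent. -/
theorem norm_fourierProd_testFun_le {p : Fin m → ℕ} {d : ℕ} (hd : 2 ≤ d) (n : ℕ) (r t : ℝ)
    {A : Finset ℕ} (hA : A ⊆ ppLe p n) {Y : ℕ → ℕ → ℝ} (hY1 : ∀ h c, |Y h c| ≤ 1)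
    (hY : ∀ h ∈ A, ∑ c ∈ Finset.range d, digitW d r h c * Y h c = 0) :
    ‖fourierProd p d r n (testFun A Y) t‖
      ≤ (∏ h ∈ A, Real.exp 2 * min 1 (|t| * (h * digitMean d r h))) * Real.exp (-decay p d n r t 0) := by
  have hterm : ∀ h, ‖∑ c ∈ Finset.range d, (digitW d r h c : ℂ) * (testFun A Y h c *
      Complex.exp ((t * h * (c - digitMean d r h) : ℝ) * Complex.I))‖
      ≤ (if h ∈ A then Real.exp 2 * min 1 (|t| * (h * digitMean d r h)) else 1) *
        Real.exp (-(digitW d r h 0 * digitW d r h 1 * (1 - Real.cos (t * h + 0)))) := by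
    intro h
    have hw : ∀ c, 0 ≤ digitW d r h c := fun c => digitW_nonneg hd c
    have hs := sum_digitW (r := r) (h := h) hd
    by_cases hh : h ∈ A
    · simp only [testFun, if_pos hh]
      have h1 := norm_sum_mul_exp_le_one hw hs (Y h)
        (fun c => t * h * (c - digitMean d r h)) (hY1 h)
      have h2 := norm_sum_centred_mul_exp_le hw (Y h) (hY1 h) (hY h hh) (t * h)
      rw [abs_mul, Nat.abs_cast, mul_assoc, ← digitMean] at h2
      have h3 : ‖∑ c ∈ Finset.range d, (digitW d r h c : ℂ) * ((Y h c : ℂ) *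
          Complex.exp ((t * h * (c - digitMean d r h) : ℝ) * Complex.I))‖
          = ‖∑ c ∈ Finset.range d, (digitW d r h c : ℂ) * ((Y h c : ℂ) *
          Complex.exp ((t * h * c : ℝ) * Complex.I))‖ := by
        have : ∀ c : ℕ, (digitW d r h c : ℂ) * ((Y h c : ℂ) *
          Complex.exp ((t * h * (c - digitMean d r h) : ℝ) * Complex.I))
          = ((digitW d r h c : ℂ) * ((Y h c : ℂ) * Complex.exp ((t * h * c : ℝ) * Complex.I)))
            * Complex.exp ((-(t * h * digitMean d r h) : ℝ) * Complex.I) := by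
          intro c
          have h4 : Complex.exp ((t * h * (c - digitMean d r h) : ℝ) * Complex.I)
              = Complex.exp ((t * h * c : ℝ) * Complex.I)
                * Complex.exp ((-(t * h * digitMean d r h) : ℝ) * Complex.I) := by
            rw [← Complex.exp_add]
            congr 1
            push_cast
            ring
          rw [h4]
          ring
        simp only [this]
        rw [← Finset.sum_mul, norm_mul, Complex.norm_exp_ofReal_mul_I, mul_one]
      have h4 := le_min h1 (h3.trans_le h2)
      have h5 : 1 ≤ Real.exp 2 *
          Real.exp (-(digitW d r h 0 * digitW d r h 1 * (1 - Real.cos (t * h + 0)))) := by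
        rw [← Real.exp_add]
        apply Real.one_le_exp
        linarith [decay_term_le_two hd r t 0 h]
      have h6 : 0 ≤ min 1 (|t| * (h * digitMean d r h)) := le_trans (norm_nonneg _) h4
      calc _ ≤ min 1 (|t| * (h * digitMean d r h)) * 1 := by rw [mul_one]; exact h4
        _ ≤ min 1 (|t| * (h * digitMean d r h)) * (Real.exp 2 *
          Real.exp (-(digitW d r h 0 * digitW d r h 1 * (1 - Real.cos (t * h + 0))))) := by gcongr
        _ = _ := by ring
    · simp only [testFun, if_neg hh, one_mul]
      have := norm_sum_exp_le hd hw hs (fun c => t * h * (c - digitMean d r h))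
      refine this.trans (le_of_eq ?_)
      congr 5
      push_cast
      ring
  rw [fourierProd, norm_prod, decay, ← Finset.sum_neg_distrib, Real.exp_sum]
  refine (Finset.prod_le_prod (fun _ _ => norm_nonneg _) fun h _ => hterm h).trans (le_of_eq ?_)
  rw [Finset.prod_mul_distrib, Finset.prod_ite_mem, Finset.inter_eq_right.2 hA]

section
variable {p : Fin m → ℕ} (hp1 : ∀ j, 1 < p j) (hpcop : ∀ i j, i ≠ j → Nat.Coprime (p i) (p j))
include hp1 hpcop

/-- Only `h ≤ 1 / (4 r)` are used: there `|t h + s| ≤ π`, so `1 - cos` dominates a parabola, and `(t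
h + s)² ≥ (t h)² / 2 - s²` separates `s`. The sum of these `h ^ 2` is at least a constant multiple
of `sumVar`. The loss `s²` per element is harmless for `s` of the order of one over the standard
deviation of the weight. -/
theorem decay_quadratic {d : ℕ} (hd : 2 ≤ d) (hm : 2 ≤ m) :
    ∃ c > 0, ∀ᶠ n : ℕ in atTop, ∀ r, IsSaddle p d n r → ∀ t s : ℝ,
      |t| ≤ 2 * Real.pi * r → |s| ≤ 1 →
      c * (sumVar p d n r * t ^ 2) - s ^ 2 * (ppLe p n).card ≤ decay p d n r t s := by
  obtain ⟨c1, hc1, hlow⟩ := sum_sq_lower hp1 hpcop hd hm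
  obtain ⟨_, _, C2, hC2, hV⟩ := sumVar_bounds hp1 hpcop hd hm
  have hd0 : (0 : ℝ) < d := by positivity
  set a := Real.exp (-1) / d * (Real.exp (-1) / d) with ha
  have ha0 : 0 < a := by positivity
  have ha1 : a ≤ 1 := by
    have h1 : Real.exp (-1) / d ≤ 1 := by
      rw [div_le_one hd0]
      have : (2 : ℝ) ≤ d := by exact_mod_cast hd
      have : Real.exp (-1) ≤ 1 := Real.exp_le_one_iff.2 (by norm_num)
      linarith
    exact mul_le_one₀ h1 (by positivity) h1
  have hpi := Real.pi_pos
  have hpi3 := Real.pi_gt_three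
  refine ⟨a * (1 / Real.pi ^ 2) * (c1 / C2), by positivity, ?_⟩
  filter_upwards [hlow, hV, eventually_le_log 1] with n h1 h2 h3 r hr t s ht hs
  have hr0 := hr.1
  have h1 := h1 r hr
  have h2 := (h2 r hr).2
  set F := (ppLe p n).filter fun h : ℕ => r * h ≤ 1 / 4 with hF
  have hL : 0 < Real.log n ^ (m - 1) := by positivity
  have hsum : c1 / C2 * sumVar p d n r ≤ ∑ h ∈ F, (h : ℝ) ^ 2 := by
    have : c1 / C2 * sumVar p d n r * r ^ 2 ≤ (∑ h ∈ F, (h : ℝ) ^ 2) * r ^ 2 := by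
      calc c1 / C2 * sumVar p d n r * r ^ 2 = c1 / C2 * (sumVar p d n r * r ^ 2) := by ring
        _ ≤ c1 / C2 * (C2 * Real.log n ^ (m - 1)) := by gcongr
        _ = c1 * Real.log n ^ (m - 1) := by field_simp
        _ ≤ _ := h1
    exact le_of_mul_le_mul_right this (by positivity)
  have hterm : ∀ h ∈ F, a * (1 / Real.pi ^ 2) * t ^ 2 * (h : ℝ) ^ 2 - s ^ 2
      ≤ digitW d r h 0 * digitW d r h 1 * (1 - Real.cos (t * h + s)) := by
    intro h hh
    have hrh := (Finset.mem_filter.1 hh).2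
    have hth : |t * h| ≤ Real.pi / 2 := by
      rw [abs_mul, Nat.abs_cast]
      calc |t| * h ≤ 2 * Real.pi * r * h := by gcongr
        _ = 2 * Real.pi * (r * h) := by ring
        _ ≤ 2 * Real.pi * (1 / 4) := by gcongr
        _ = _ := by ring
    have habs : |t * h + s| ≤ Real.pi := (abs_add_le _ _).trans (by linarith)
    have hcos := Real.cos_le_one_sub_mul_cos_sq habs
    have hw : a ≤ digitW d r h 0 * digitW d r h 1 := by
      have := digitW_nonneg (r := r) (h := h) hd 0
      rw [ha]
      gcongr
      · exact le_digitW hd hr0.le (by linarith) (by norm_num)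
      · exact le_digitW hd hr0.le (by linarith) le_rfl
    have hsq : (t * h) ^ 2 / 2 - s ^ 2 ≤ (t * h + s) ^ 2 := by nlinarith [sq_nonneg (t * h + 2 * s)]
    have hb : 2 / Real.pi ^ 2 ≤ 1 := by
      rw [div_le_one (by positivity)]; nlinarith
    calc a * (1 / Real.pi ^ 2) * t ^ 2 * (h : ℝ) ^ 2 - s ^ 2
        ≤ a * (1 / Real.pi ^ 2) * t ^ 2 * (h : ℝ) ^ 2 - a * (2 / Real.pi ^ 2) * s ^ 2 := by
          have : a * (2 / Real.pi ^ 2) ≤ 1 := mul_le_one₀ ha1 (by positivity) hb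
          have : a * (2 / Real.pi ^ 2) * s ^ 2 ≤ 1 * s ^ 2 := by gcongr
          linarith
      _ = a * (2 / Real.pi ^ 2 * ((t * h) ^ 2 / 2 - s ^ 2)) := by ring
      _ ≤ a * (2 / Real.pi ^ 2 * (t * h + s) ^ 2) := by gcongr
      _ ≤ a * (1 - Real.cos (t * h + s)) := by gcongr; linarith
      _ ≤ _ := by
        refine mul_le_mul_of_nonneg_right hw (sub_nonneg.2 (Real.cos_le_one _))
  calc _ ≤ ∑ h ∈ F, (a * (1 / Real.pi ^ 2) * t ^ 2 * (h : ℝ) ^ 2 - s ^ 2) := by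
        rw [Finset.sum_sub_distrib, ← Finset.mul_sum, Finset.sum_const, nsmul_eq_mul]
        have hc : (F.card : ℝ) ≤ (ppLe p n).card := by
          exact_mod_cast Finset.card_le_card (Finset.filter_subset _ _)
        have h5 : a * (1 / Real.pi ^ 2) * t ^ 2 * (c1 / C2 * sumVar p d n r)
            ≤ a * (1 / Real.pi ^ 2) * t ^ 2 * ∑ h ∈ F, (h : ℝ) ^ 2 := by gcongr
        have h6 : s ^ 2 * F.card ≤ s ^ 2 * (ppLe p n).card := by gcongr
        linarith
    _ ≤ ∑ h ∈ F, digitW d r h 0 * digitW d r h 1 * (1 - Real.cos (t * h + s)) :=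
        Finset.sum_le_sum hterm
    _ ≤ _ := Finset.sum_le_sum_of_subset_of_nonneg (Finset.filter_subset _ _)
        fun h _ _ => decay_term_nonneg hd r t s h

omit hp1 hpcop in
theorem eight_mul_distInt_sq_le (y : ℝ) : 8 * distInt y ^ 2 ≤ 1 - Real.cos (2 * Real.pi * y) := by
  have hpi := Real.pi_pos
  have h1 : Real.cos (2 * Real.pi * y) = Real.cos (2 * Real.pi * (y - round y)) := by
    rw [show 2 * Real.pi * (y - round y) = 2 * Real.pi * y - (round y : ℤ) * (2 * Real.pi) by ring,
      Real.cos_sub_int_mul_two_pi]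
  have h2 : |2 * Real.pi * (y - round y)| ≤ Real.pi := by
    rw [abs_mul, abs_of_pos (by positivity)]
    have := abs_sub_round y
    nlinarith
  have h3 := Real.cos_le_one_sub_mul_cos_sq h2
  rw [h1, distInt_eq, sq_abs]
  have e : 2 / Real.pi ^ 2 * (2 * Real.pi * (y - round y)) ^ 2 = 8 * (y - round y) ^ 2 := by
    field_simp
    ring
  linarith

omit hp1 hpcop in
theorem pow_mul_pow_mem_powerProducts {i j : Fin m} (hij : i ≠ j) (a b : ℕ) :
    p i ^ a * p j ^ b ∈ powerProducts p := by
  refine ⟨fun k => if k = i then a else if k = j then b else 0, ?_⟩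
  rw [Finset.prod_eq_mul i j hij]
  · simp [hij.symm]
  · intro k _ hk
    simp [hk.1, hk.2]
  · simp
  · simp

/-- The part of `[-π, π]` away from the origin. -/
def minorArc (r : ℝ) : Set ℝ := Set.Icc (-Real.pi) Real.pi ∩ {t | 2 * Real.pi * r < |t|}

/-- The part of `[-π, π]` close to the origin. -/
def majorArc (r : ℝ) : Set ℝ := Set.Icc (-Real.pi) Real.pi ∩ {t | |t| ≤ 2 * Real.pi * r}

omit hp1 hpcop in
theorem measurableSet_minorArc (r : ℝ) : MeasurableSet (minorArc r) :=
  measurableSet_Icc.inter (measurableSet_lt measurable_const measurable_norm)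

omit hp1 hpcop in
theorem measurableSet_majorArc (r : ℝ) : MeasurableSet (majorArc r) :=
  measurableSet_Icc.inter (measurableSet_le measurable_norm measurable_const)

/-- Put `t = 2πx` and `Q = 1 / r`; two of the bases suffice. The weight variable shifts each phase
by `s / (2π)`, at most half the hit threshold `θ` when `|s| ≤ πθ`, so the estimate is uniform in
such `s`. -/
theorem exists_minorArc_integral_le {d : ℕ} (hd : 2 ≤ d) (hm : 2 ≤ m) :
    ∃ δ > 0, ∃ C > 0, ∃ s₀ > 0, ∀ᶠ n : ℕ in atTop, ∀ r, IsSaddle p d n r → ∀ s : ℝ, |s| ≤ s₀ →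
      ∫ t in minorArc r, Real.exp (-decay p d n r t s)
        ≤ C * Real.exp (-((1 + δ) * Real.log (1 / r))) := by
  set i : Fin m := ⟨0, by omega⟩
  set j : Fin m := ⟨1, by omega⟩
  have hij : i ≠ j := by simp [i, j]
  have hd0 : (0 : ℝ) < d := by positivity
  have hpi := Real.pi_pos
  set a := Real.exp (-1) / d * (Real.exp (-1) / d) with ha
  have ha0 : 0 < a := by positivity
  have hpi0 : (0 : ℝ) < p i := by have := hp1 i; positivity
  have hpj0 : (0 : ℝ) < p j := by have := hp1 j; positivity
  set θ : ℝ := 1 / (2 * p i * p j) with hθ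
  have hθ0 : 0 < θ := by positivity
  obtain ⟨δ, hδ, C, hC, Q₀, hQ₀, hmin⟩ := exists_integral_minor_le (hp1 i) (hp1 j)
    (hpcop i j hij) (show 0 < a * (8 * (θ / 2) ^ 2) by positivity)
  obtain ⟨c4, hc4, hlow⟩ := saddle_lower hp1 hpcop hd hm
  refine ⟨δ, hδ, 2 * Real.pi * C, by positivity, Real.pi * θ, by positivity, ?_⟩
  filter_upwards [hlow, saddle_log_lower hp1 hpcop hd, eventually_le_log (2 * Real.log Q₀)]
    with n h1 h2 h3 r hr s hs
  have hr0 := hr.1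
  have h1 := (h1 r hr).2
  have h2 := h2 r hr
  have hQ : Q₀ ≤ 1 / r := by
    rw [← Real.log_le_log_iff (by linarith) (by positivity)]
    linarith
  set T := (ppLe p n).filter fun h : ℕ => r * h ≤ 1 with hT
  have hTmem : ∀ k l : ℕ, (p i : ℝ) ^ k * p j ^ l ≤ 1 / r → p i ^ k * p j ^ l ∈ T := by
    intro k l hkl
    rw [hT, Finset.mem_filter, mem_ppLe]
    refine ⟨⟨⟨?_, ?_⟩, pow_mul_pow_mem_powerProducts hij k l⟩, ?_⟩
    · have := hp1 i; have := hp1 j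
      exact Nat.one_le_iff_ne_zero.2 (by positivity)
    · exact_mod_cast hkl.trans h1
    · push_cast
      rw [le_div_iff₀ hr0] at hkl
      linarith
  have hpt : ∀ x : ℝ, a * (8 * (θ / 2) ^ 2) * (hits T θ x).card
      ≤ decay p d n r (2 * Real.pi * x) s := by
    intro x
    calc a * (8 * (θ / 2) ^ 2) * (hits T θ x).card = ∑ h ∈ hits T θ x, a * (8 * (θ / 2) ^ 2) := by
          rw [Finset.sum_const, nsmul_eq_mul]; ring
      _ ≤ ∑ h ∈ hits T θ x, digitW d r h 0 * digitW d r h 1 *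
          (1 - Real.cos (2 * Real.pi * x * h + s)) := by
          refine Finset.sum_le_sum fun h hh => ?_
          obtain ⟨hh1, hh2⟩ := Finset.mem_filter.1 hh
          have hrh := (Finset.mem_filter.1 hh1).2
          have hw : a ≤ digitW d r h 0 * digitW d r h 1 := by
            have := digitW_nonneg (r := r) (h := h) hd 0
            rw [ha]
            gcongr
            · exact le_digitW hd hr0.le (by linarith) (by norm_num)
            · exact le_digitW hd hr0.le (by linarith) le_rfl
          have hd1 := distInt_le_add (x * h) (s / (2 * Real.pi))
          have hs2 : |s / (2 * Real.pi)| ≤ θ / 2 := by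
            rw [abs_div, abs_of_pos (by positivity : 0 < 2 * Real.pi), div_le_iff₀ (by positivity)]
            linarith
          have hd2 : θ / 2 ≤ distInt (x * h + s / (2 * Real.pi)) := by linarith
          have h8 := eight_mul_distInt_sq_le (x * h + s / (2 * Real.pi))
          have e : 2 * Real.pi * (x * h + s / (2 * Real.pi)) = 2 * Real.pi * x * h + s := by
            field_simp
          rw [e] at h8
          have h9 : 8 * (θ / 2) ^ 2 ≤ 1 - Real.cos (2 * Real.pi * x * h + s) :=
            le_trans (by gcongr) h8
          exact mul_le_mul hw h9 (by positivity) (mul_nonneg (digitW_nonneg hd 0) (digitW_nonneg hd 1))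
      _ ≤ _ := Finset.sum_le_sum_of_subset_of_nonneg
          ((Finset.filter_subset _ _).trans (Finset.filter_subset _ _))
          fun h _ _ => decay_term_nonneg hd r _ s h
  set M := Set.Icc (-(1 / 2) : ℝ) (1 / 2) ∩ {x | 1 / (1 / r) < |x|} with hM
  have hMmeas : MeasurableSet M :=
    measurableSet_Icc.inter (measurableSet_lt measurable_const measurable_norm)
  have hMfin : volume M ≠ ⊤ := ((measure_mono Set.inter_subset_left).trans_lt (by simp)).ne
  have hscale : ∫ t in minorArc r, Real.exp (-decay p d n r t s)
      = 2 * Real.pi * ∫ x in M, Real.exp (-decay p d n r (2 * Real.pi * x) s) := by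
    rw [← integral_indicator (measurableSet_minorArc r), ← integral_indicator hMmeas]
    have h5 := Measure.integral_comp_mul_left
      ((minorArc r).indicator fun t => Real.exp (-decay p d n r t s)) (2 * Real.pi)
    have h6 : ∀ x, (minorArc r).indicator (fun t => Real.exp (-decay p d n r t s)) (2 * Real.pi * x)
        = M.indicator (fun x => Real.exp (-decay p d n r (2 * Real.pi * x) s)) x := by
      intro x
      have hiff : 2 * Real.pi * x ∈ minorArc r ↔ x ∈ M := by
        rw [hM, minorArc, Set.mem_inter_iff, Set.mem_inter_iff, ← abs_le.trans Set.mem_Icc.symm,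
          ← abs_le.trans Set.mem_Icc.symm, Set.mem_ofPred_eq, Set.mem_ofPred_eq, abs_mul,
          abs_of_pos (by positivity : 0 < 2 * Real.pi), one_div_one_div]
        constructor
        · rintro ⟨g1, g2⟩
          exact ⟨by nlinarith, lt_of_mul_lt_mul_left g2 (by positivity)⟩
        · rintro ⟨g1, g2⟩
          exact ⟨by nlinarith, by gcongr⟩
      by_cases hx : x ∈ M
      · rw [Set.indicator_of_mem hx, Set.indicator_of_mem (hiff.2 hx)]
      · rw [Set.indicator_of_notMem hx, Set.indicator_of_notMem (fun hc => hx (hiff.1 hc))]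
    simp only [h6] at h5
    rw [h5, abs_of_pos (show 0 < (2 * Real.pi)⁻¹ by positivity), smul_eq_mul,
      ← mul_assoc, mul_inv_cancel₀ (show 2 * Real.pi ≠ 0 by positivity), one_mul]
  rw [hscale, mul_assoc (2 * Real.pi) C]
  refine mul_le_mul_of_nonneg_left ?_ (by positivity)
  refine le_trans (setIntegral_mono_on ?_ ?_ hMmeas fun x _ => ?_) (hmin (1 / r) hQ T hTmem)
  · refine Measure.integrableOn_of_bounded (M := 1) hMfin ?_ ?_
    · exact (((continuous_decay p d n r s).comp (continuous_const.mul continuous_id)).neg.rexp).aestronglyMeasurable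
    · refine Eventually.of_forall fun y => ?_
      rw [Real.norm_of_nonneg (Real.exp_nonneg _)]
      exact Real.exp_le_one_iff.2 (neg_nonpos.2
        (Finset.sum_nonneg fun h _ => decay_term_nonneg hd r _ s h))
  · refine Measure.integrableOn_of_bounded (M := 1) hMfin
      ((measurable_card_hits T _).const_mul _).neg.exp.aestronglyMeasurable ?_
    refine Eventually.of_forall fun y => ?_
    rw [Real.norm_of_nonneg (Real.exp_nonneg _)]
    exact Real.exp_le_one_iff.2 (neg_nonpos.2 (by positivity))
  · exact Real.exp_le_exp.2 (neg_le_neg (hpt x))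

end

/-! ### The local limit theorem. -/

theorem integral_eq_major_add_minor {f : ℝ → ℂ} (hf : Continuous f) (r : ℝ) :
    ∫ t in -Real.pi..Real.pi, f t = (∫ t in majorArc r, f t) + ∫ t in minorArc r, f t := by
  have hpi := Real.pi_pos
  rw [intervalIntegral.integral_of_le (by linarith), ← integral_Icc_eq_integral_Ioc]
  have hint : IntegrableOn f (Set.Icc (-Real.pi) Real.pi) :=
    hf.continuousOn.integrableOn_Icc
  have hunion : Set.Icc (-Real.pi) Real.pi = majorArc r ∪ minorArc r := by
    rw [majorArc, minorArc, ← Set.inter_union_distrib_left]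
    symm
    apply Set.inter_eq_left.2
    intro t _
    rw [Set.mem_union, Set.mem_ofPred_eq, Set.mem_ofPred_eq]
    exact le_or_gt _ _
  rw [hunion, setIntegral_union _ (measurableSet_minorArc r)]
  · exact hint.mono_set Set.inter_subset_left
  · exact hint.mono_set Set.inter_subset_left
  · rw [Set.disjoint_left]
    rintro t ⟨_, h1⟩ ⟨_, h2⟩
    rw [Set.mem_ofPred_eq] at h1 h2
    exact absurd h2 (not_lt.2 h1)

/-- The variance of the Hamming weight under the tilted law. -/
noncomputable def weightVar (p : Fin m → ℕ) (d n : ℕ) (r : ℝ) : ℝ :=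
  ∑ h ∈ ppLe p n, digitQ d r h * (1 - digitQ d r h)

/-- The test function giving the joint characteristic function of value and Hamming weight. -/
noncomputable def charTest (d : ℕ) (r s : ℝ) (h c : ℕ) : ℂ :=
  Complex.exp ((s * (nz c - digitQ d r h) : ℝ) * Complex.I)

theorem norm_prod_sub_prod_le {ι : Type*} (S : Finset ι) (f g : ι → ℂ)
    (hf : ∀ i ∈ S, ‖f i‖ ≤ 1) (hg : ∀ i ∈ S, ‖g i‖ ≤ 1) :
    ‖∏ i ∈ S, f i - ∏ i ∈ S, g i‖ ≤ ∑ i ∈ S, ‖f i - g i‖ := by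
  classical
  induction S using Finset.induction_on with
  | empty => simp
  | insert i S hi ih =>
    rw [Finset.prod_insert hi, Finset.prod_insert hi, Finset.sum_insert hi]
    have ih' := ih (fun j hj => hf j (Finset.mem_insert_of_mem hj))
      fun j hj => hg j (Finset.mem_insert_of_mem hj)
    have e : f i * ∏ j ∈ S, f j - g i * ∏ j ∈ S, g j
        = (f i - g i) * ∏ j ∈ S, f j + g i * (∏ j ∈ S, f j - ∏ j ∈ S, g j) := by ring
    rw [e]
    refine (norm_add_le _ _).trans ?_
    rw [norm_mul, norm_mul]
    have h1 : ‖∏ j ∈ S, f j‖ ≤ 1 := by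
      rw [norm_prod]
      exact Finset.prod_le_one (fun _ _ => norm_nonneg _)
        fun j hj => hf j (Finset.mem_insert_of_mem hj)
    have h2 := hg i (Finset.mem_insert_self _ _)
    have h3 : ‖f i - g i‖ * ‖∏ j ∈ S, f j‖ ≤ ‖f i - g i‖ := mul_le_of_le_one_right (norm_nonneg _) h1
    have h4 : ‖g i‖ * ‖∏ j ∈ S, f j - ∏ j ∈ S, g j‖ ≤ ‖∏ j ∈ S, f j - ∏ j ∈ S, g j‖ :=
      mul_le_of_le_one_left (norm_nonneg _) h2
    linarith

/-- The joint Gaussian also factors over `h`, and all factors have norm at most `1`; so the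
one-digit errors, third moments and squared variances, simply add. -/
theorem norm_fourierProd_sub_gaussian_le (p : Fin m → ℕ) {d : ℕ} (hd : 2 ≤ d) (n : ℕ) {r : ℝ}
    (hr : 0 ≤ r) (t s : ℝ) :
    ‖fourierProd p d r n (charTest d r s) t - (Real.exp (-(t ^ 2 * sumVar p d n r
        + 2 * t * s * ∑ h ∈ ppLe p n, h * digitCov d r h + s ^ 2 * weightVar p d n r) / 2) : ℂ)‖
      ≤ 32 * d ^ 4 * (|t| ^ 3 * ∑ h ∈ ppLe p n, (h : ℝ) ^ 3 * Real.exp (-(r * h)))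
        + 16 * |s| ^ 3 * (ppLe p n).card
        + 32 * d ^ 6 * (|t| ^ 4 * ∑ h ∈ ppLe p n, (h : ℝ) ^ 4 * Real.exp (-(r * h)))
        + 8 * |s| ^ 4 * (ppLe p n).card := by
  have e1 : fourierProd p d r n (charTest d r s) t = ∏ h ∈ ppLe p n, ∑ c ∈ Finset.range d,
      (digitW d r h c : ℂ) * Complex.exp (phase d r t s h c * Complex.I) := by
    rw [fourierProd]
    refine Finset.prod_congr rfl fun h _ => Finset.sum_congr rfl fun c _ => ?_
    rw [charTest, ← Complex.exp_add]
    congr 2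
    rw [phase]
    push_cast
    ring
  have e2 : (Real.exp (-(t ^ 2 * sumVar p d n r
        + 2 * t * s * ∑ h ∈ ppLe p n, h * digitCov d r h + s ^ 2 * weightVar p d n r) / 2) : ℂ)
      = ∏ h ∈ ppLe p n, (Real.exp (-(∑ c ∈ Finset.range d, digitW d r h c * phase d r t s h c ^ 2) / 2) : ℂ) := by
    rw [← Complex.ofReal_prod, ← Real.exp_sum]
    congr 2
    simp only [sum_digitW_mul_phase_sq hd]
    rw [← Finset.sum_div, Finset.sum_neg_distrib, Finset.sum_add_distrib, Finset.sum_add_distrib,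
      ← Finset.mul_sum, ← Finset.mul_sum, ← Finset.mul_sum]
    rfl
  rw [e1, e2]
  have hnn : ∀ h, 0 ≤ ∑ c ∈ Finset.range d, digitW d r h c * phase d r t s h c ^ 2 :=
    fun h => Finset.sum_nonneg fun c _ => mul_nonneg (digitW_nonneg hd c) (sq_nonneg _)
  refine (norm_prod_sub_prod_le _ _ _ (fun h _ => ?_) fun h _ => ?_).trans ?_
  · have := norm_sum_mul_exp_le_one (fun c => digitW_nonneg (r := r) (h := h) hd c) (sum_digitW hd)
      (fun _ => 1) (fun c => phase d r t s h c) (by simp)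
    simpa using this
  · rw [Complex.norm_real, Real.norm_of_nonneg (Real.exp_nonneg _)]
    exact Real.exp_le_one_iff.2 (by linarith [hnn h])
  · have hterm : ∀ h ∈ ppLe p n, ‖∑ c ∈ Finset.range d,
        (digitW d r h c : ℂ) * Complex.exp (phase d r t s h c * Complex.I)
        - (Real.exp (-(∑ c ∈ Finset.range d, digitW d r h c * phase d r t s h c ^ 2) / 2) : ℂ)‖
        ≤ 32 * d ^ 4 * (|t| ^ 3 * ((h : ℝ) ^ 3 * Real.exp (-(r * h)))) + 16 * |s| ^ 3
          + 32 * d ^ 6 * (|t| ^ 4 * ((h : ℝ) ^ 4 * Real.exp (-(r * h)))) + 8 * |s| ^ 4 := by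
      intro h _
      have h1 := norm_charFun_sub_gaussian_le (fun c => digitW_nonneg (r := r) (h := h) hd c)
        (sum_digitW hd) (fun c => phase d r t s h c) (sum_digitW_mul_phase hd t s)
      have h2 := sum_digitW_mul_phase_cube_le (h := h) hd hr t s
      have h3 := sum_digitW_mul_phase_sq_sq_le (h := h) hd hr t s
      linarith
    refine (Finset.sum_le_sum hterm).trans (le_of_eq ?_)
    simp only [Finset.sum_add_distrib, ← Finset.mul_sum, Finset.sum_const, nsmul_eq_mul]
    ring

section
variable {p : Fin m → ℕ} (hp1 : ∀ j, 1 < p j) (hpcop : ∀ i j, i ≠ j → Nat.Coprime (p i) (p j))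
  {d : ℕ} (hd : 2 ≤ d) (hm : 2 ≤ m) {r : ℕ → ℝ} (hr : ∀ᶠ n in atTop, IsSaddle p d n (r n))
include hp1 hpcop

omit hp1 hpcop in
theorem abs_digitQ_mul_sub_le (hd : 2 ≤ d) (x : ℝ) (h : ℕ) :
    |digitQ d x h * (1 - digitQ d x h) - (d - 1) / d ^ 2| ≤ |digitQ d x h - (d - 1) / d| := by
  have hd0 : (0 : ℝ) < d := by positivity
  have e : digitQ d x h * (1 - digitQ d x h) - (d - 1) / d ^ 2
      = (digitQ d x h - (d - 1) / d) * (1 / d - digitQ d x h) := by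
    field_simp
    ring
  rw [e, abs_mul]
  apply mul_le_of_le_one_right (abs_nonneg _)
  have h1 := digitQ_nonneg (r := x) (h := h) hd
  have h2 := digitQ_le_one (r := x) (h := h) hd
  have h3 : 0 ≤ 1 / (d : ℝ) := by positivity
  have h4 : 1 / (d : ℝ) ≤ 1 := by
    rw [div_le_one hd0]; exact_mod_cast (by omega : 1 ≤ d)
  rw [abs_le]; constructor <;> linarith

omit hp1 hpcop in
theorem abs_digitQ_sub_le_one (hd : 2 ≤ d) (x : ℝ) (h : ℕ) :
    |digitQ d x h - (d - 1) / d| ≤ 1 := by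
  have hd0 : (0 : ℝ) < d := by positivity
  have h1 := digitQ_nonneg (r := x) (h := h) hd
  have h2 := digitQ_le_one (r := x) (h := h) hd
  have e : ((d : ℝ) - 1) / d = 1 - 1 / d := by field_simp
  have h3 : 0 ≤ 1 / (d : ℝ) := by positivity
  have h4 : 1 / (d : ℝ) ≤ 1 := by
    rw [div_le_one hd0]; exact_mod_cast (by omega : 1 ≤ d)
  rw [e, abs_le]; constructor <;> linarith

include hd hm

theorem sum_digitQ_asymp :
    ∃ C > 0, ∀ᶠ n : ℕ in atTop, ∀ x, IsSaddle p d n x →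
      |∑ h ∈ ppLe p n, digitQ d x h - (d - 1) / d * (Real.log n ^ m / volConst p)|
        ≤ C * (Real.log n ^ (m - 1) * Real.log (Real.log n)) := by
  have hd0 : (0 : ℝ) < d := by positivity
  have ha : |((d : ℝ) - 1) / d| ≤ 1 := by
    rw [abs_div, abs_of_pos hd0, div_le_one hd0, abs_le]
    have : (2 : ℝ) ≤ d := by exact_mod_cast hd
    constructor <;> linarith
  obtain ⟨C, hC, h⟩ := sum_digit_asymp hp1 hpcop hd hm ((d - 1) / d) d ha hd0
  refine ⟨C, hC, ?_⟩
  filter_upwards [h] with n hn x hx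
  refine hn x hx _ (fun h => abs_digitQ_sub_le hd hx.1.le) fun h =>
    (abs_digitQ_sub_le_one hd x h).trans ?_
  exact_mod_cast (by omega : 1 ≤ d)

theorem weightVar_asymp :
    ∃ C > 0, ∀ᶠ n : ℕ in atTop, ∀ x, IsSaddle p d n x →
      |weightVar p d n x - (d - 1) / d ^ 2 * (Real.log n ^ m / volConst p)|
        ≤ C * (Real.log n ^ (m - 1) * Real.log (Real.log n)) := by
  have hd0 : (0 : ℝ) < d := by positivity
  have ha : |((d : ℝ) - 1) / d ^ 2| ≤ 1 := by
    have : (2 : ℝ) ≤ d := by exact_mod_cast hd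
    rw [abs_div, abs_of_pos (by positivity : (0 : ℝ) < d ^ 2), div_le_one (by positivity), abs_le]
    constructor <;> nlinarith
  obtain ⟨C, hC, h⟩ := sum_digit_asymp hp1 hpcop hd hm ((d - 1) / d ^ 2) d ha hd0
  refine ⟨C, hC, ?_⟩
  filter_upwards [h] with n hn x hx
  refine hn x hx _ (fun h => (abs_digitQ_mul_sub_le hd x h).trans
    (abs_digitQ_sub_le hd hx.1.le)) fun h =>
    (abs_digitQ_mul_sub_le hd x h).trans ((abs_digitQ_sub_le_one hd x h).trans ?_)
  exact_mod_cast (by omega : 1 ≤ d)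

omit hp1 hpcop hd hm in
theorem eventually_mul_loglog_le {ε : ℝ} (hε : 0 < ε) :
    ∀ᶠ n : ℕ in atTop, |Real.log (Real.log n)| ≤ ε * Real.log n := by
  have := (Real.isLittleO_log_id_atTop.comp_tendsto tendsto_log_natCast).bound hε
  filter_upwards [this, eventually_le_log 0] with n h1 h2
  simpa only [Function.comp_apply, id_eq, Real.norm_eq_abs, abs_of_nonneg h2] using h1

theorem weightVar_lower :
    ∃ c > 0, ∀ᶠ n : ℕ in atTop, ∀ x, IsSaddle p d n x →
      c * Real.log n ^ m ≤ weightVar p d n x := by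
  obtain ⟨C, hC, h⟩ := weightVar_asymp hp1 hpcop hd hm
  have hv := volConst_pos hp1
  have hd2 : (2 : ℝ) ≤ d := by exact_mod_cast hd
  have hK : 0 < ((d : ℝ) - 1) / d ^ 2 / volConst p := by
    have : 0 < (d : ℝ) - 1 := by linarith
    positivity
  set K := ((d : ℝ) - 1) / d ^ 2 / volConst p with hKdef
  refine ⟨K / 2, by positivity, ?_⟩
  filter_upwards [h, eventually_mul_loglog_le (show 0 < K / (2 * C) by positivity),
    eventually_le_log 0] with n h1 h2 h3 x hx
  have h4 := (abs_le.1 (h1 x hx)).1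
  have h5 : Real.log n ^ (m - 1) * Real.log (Real.log n)
      ≤ Real.log n ^ (m - 1) * (K / (2 * C) * Real.log n) := by
    gcongr
    exact (le_abs_self _).trans h2
  have h6 : Real.log n ^ (m - 1) * (K / (2 * C) * Real.log n) = K / (2 * C) * Real.log n ^ m := by
    rw [← Nat.sub_add_cancel (show 1 ≤ m by omega), pow_succ]
    simp only [add_tsub_cancel_right]
    ring
  have h7 : C * (Real.log n ^ (m - 1) * Real.log (Real.log n)) ≤ K / 2 * Real.log n ^ m := by
    calc _ ≤ C * (K / (2 * C) * Real.log n ^ m) := by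
          rw [← h6]; gcongr
      _ = _ := by field_simp
  have h8 : ((d : ℝ) - 1) / d ^ 2 * (Real.log n ^ m / volConst p) = K * Real.log n ^ m := by
    rw [hKdef]; ring
  rw [h8] at h4
  linarith

omit hd hm in
theorem card_ppLe_le :
    ∃ C > 0, ∀ᶠ n : ℕ in atTop, ((ppLe p n).card : ℝ) ≤ C * Real.log n ^ m := by
  obtain ⟨C, hC, h⟩ := card_ppLe_asymp hp1 hpcop
  have hv := volConst_pos hp1
  refine ⟨C + 1 / volConst p, by positivity, ?_⟩
  filter_upwards [eventually_le_log 1] with n hn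
  have h1 := (abs_le.1 (h n hn)).2
  have h2 : Real.log n ^ (m - 1) ≤ Real.log n ^ m := pow_le_pow_right₀ hn (by omega)
  have h3 : C * Real.log n ^ (m - 1) ≤ C * Real.log n ^ m := by gcongr
  calc ((ppLe p n).card : ℝ) ≤ C * Real.log n ^ m + Real.log n ^ m / volConst p := by linarith
    _ = _ := by ring

include hr

/-- After rescaling by the standard deviation of the value, the central arc therefore exhausts the
real line; `m ≥ 2` is essential here. -/
theorem tendsto_mul_sqrt_sumVar :
    Tendsto (fun n => r n * Real.sqrt (sumVar p d n (r n))) atTop atTop := by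
  obtain ⟨c, hc, _, _, h⟩ := sumVar_bounds hp1 hpcop hd hm
  have h1 : Tendsto (fun n : ℕ => Real.sqrt (c * Real.log n)) atTop atTop :=
    Real.tendsto_sqrt_atTop.comp (tendsto_log_natCast.const_mul_atTop hc)
  refine tendsto_atTop_mono' _ ?_ h1
  filter_upwards [h, hr, eventually_le_log 1] with n h2 h3 h4
  have h5 := (h2 _ h3).1
  have h6 : Real.log n ≤ Real.log n ^ (m - 1) := le_self_pow₀ h4 (by omega)
  have e : r n * Real.sqrt (sumVar p d n (r n)) = Real.sqrt (sumVar p d n (r n) * r n ^ 2) := by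
    rw [Real.sqrt_mul' _ (sq_nonneg _), Real.sqrt_sq h3.1.le, mul_comm]
  rw [e]
  exact Real.sqrt_le_sqrt (le_trans (by gcongr) h5)

omit hm in
-- Since `r ≤ n ^ (-1/2)`, any positive power of `r` beats all powers of `log n`.
theorem tendsto_log_pow_mul_saddle {δ : ℝ} (hδ : 0 < δ) (k : ℕ) :
    Tendsto (fun n : ℕ => Real.log n ^ k * Real.exp (-(δ * Real.log (1 / r n)))) atTop (𝓝 0) := by
  have h1 := (tendsto_rpow_mul_exp_neg_mul_atTop_nhds_zero (k : ℝ) (δ / 2) (by positivity)).comp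
    tendsto_log_natCast
  refine tendsto_of_tendsto_of_tendsto_of_le_of_le' tendsto_const_nhds h1 ?_ ?_
  · filter_upwards [eventually_le_log 0] with n hn
    positivity
  · filter_upwards [eventually_le_log 0, hr, saddle_log_lower hp1 hpcop hd] with n h2 h3 h4
    have h5 := h4 _ h3
    simp only [Function.comp_apply, Real.rpow_natCast]
    gcongr
    nlinarith

/-- The minor arcs contribute `O(r ^ (1 + δ))`. One factor `r` balances the square root of `sumVar`
up to powers of `log n`, and `r ^ δ` absorbs these. -/
theorem tendsto_minorArc_integral {s : ℕ → ℝ} (hs : Tendsto s atTop (𝓝 0)) (k : ℕ) :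
    Tendsto (fun n : ℕ => Real.log n ^ k * (Real.sqrt (sumVar p d n (r n)) *
      ∫ t in minorArc (r n), Real.exp (-decay p d n (r n) t (s n)))) atTop (𝓝 0) := by
  obtain ⟨δ, hδ, C, hC, s₀, hs₀, h⟩ := exists_minorArc_integral_le hp1 hpcop hd hm
  obtain ⟨_, _, C2, hC2, hV⟩ := sumVar_bounds hp1 hpcop hd hm
  have h1 := (tendsto_log_pow_mul_saddle hp1 hpcop hd hr hδ (k + m)).const_mul (C * (C2 + 1))
  rw [mul_zero] at h1
  have hs1 : ∀ᶠ n in atTop, |s n| ≤ s₀ := by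
    have := hs.abs
    rw [abs_zero] at this
    exact this.eventually_le_const hs₀
  refine tendsto_of_tendsto_of_tendsto_of_le_of_le' tendsto_const_nhds h1 ?_ ?_
  · filter_upwards [eventually_le_log 0] with n hn
    have : 0 ≤ ∫ t in minorArc (r n), Real.exp (-decay p d n (r n) t (s n)) :=
      integral_nonneg fun _ => Real.exp_nonneg _
    positivity
  · filter_upwards [eventually_le_log 1, hr, h, hV, hs1] with n h2 h3 h4 h5 h6
    have h4 := h4 _ h3 _ h6
    have h5 := (h5 _ h3).2
    have hr0 := h3.1
    have hL : 1 ≤ Real.log n ^ m := one_le_pow₀ h2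
    have hsq : Real.sqrt (sumVar p d n (r n)) * r n ≤ (C2 + 1) * Real.log n ^ m := by
      have e : Real.sqrt (sumVar p d n (r n)) * r n = Real.sqrt (sumVar p d n (r n) * r n ^ 2) := by
        rw [Real.sqrt_mul' _ (sq_nonneg _), Real.sqrt_sq hr0.le]
      rw [e]
      refine (Real.sqrt_le_sqrt h5).trans (Real.sqrt_le_iff.2 ⟨by positivity, ?_⟩)
      have h7 : Real.log n ^ (m - 1) ≤ Real.log n ^ m := pow_le_pow_right₀ h2 (by omega)
      calc C2 * Real.log n ^ (m - 1) ≤ (C2 + 1) * Real.log n ^ m := by gcongr; linarith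
        _ ≤ _ := le_self_pow₀ (by nlinarith) (by norm_num)
    have he : Real.exp (-((1 + δ) * Real.log (1 / r n)))
        = r n * Real.exp (-(δ * Real.log (1 / r n))) := by
      rw [show -((1 + δ) * Real.log (1 / r n)) = Real.log (r n) + -(δ * Real.log (1 / r n)) by
        rw [one_div, Real.log_inv]; ring, Real.exp_add, Real.exp_log hr0]
    rw [he] at h4
    have hE := Real.exp_nonneg (-(δ * Real.log (1 / r n)))
    calc _ ≤ Real.log n ^ k * (Real.sqrt (sumVar p d n (r n)) *
          (C * (r n * Real.exp (-(δ * Real.log (1 / r n)))))) := by gcongr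
      _ = C * Real.log n ^ k * (Real.sqrt (sumVar p d n (r n)) * r n) *
          Real.exp (-(δ * Real.log (1 / r n))) := by ring
      _ ≤ C * Real.log n ^ k * ((C2 + 1) * Real.log n ^ m) *
          Real.exp (-(δ * Real.log (1 / r n))) := by gcongr
      _ = _ := by rw [pow_add]; ring

/-- A Lyapunov condition: relative to the variance, the moment sum of order `k + 3` is smaller by
`(r √V) ^ (k + 1)`, with `V = sumVar p d n r`. -/
theorem tendsto_sum_pow_scaled (k : ℕ) (u : ℝ) :
    Tendsto (fun n : ℕ => |u / Real.sqrt (sumVar p d n (r n))| ^ (k + 3) *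
      ∑ h ∈ ppLe p n, (h : ℝ) ^ (k + 3) * Real.exp (-(r n * h))) atTop (𝓝 0) := by
  obtain ⟨C, hC, hup⟩ := sum_pow_mul_exp_le hp1 hpcop (k + 2)
  obtain ⟨c, hc, _, _, hV⟩ := sumVar_bounds hp1 hpcop hd hm
  have hR := tendsto_mul_sqrt_sumVar hp1 hpcop hd hm hr
  have h1 := ((tendsto_pow_atTop (n := k + 1) (by omega)).comp hR).inv_tendsto_atTop.const_mul
    (|u| ^ (k + 3) * (C / c))
  rw [mul_zero] at h1
  refine tendsto_of_tendsto_of_tendsto_of_le_of_le' tendsto_const_nhds h1 ?_ ?_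
  · exact Eventually.of_forall fun n => mul_nonneg (by positivity)
      (Finset.sum_nonneg fun h _ => by positivity)
  · filter_upwards [hr, hV, eventually_le_log 1, hR.eventually_gt_atTop 0] with n h2 h3 h4 h5
    have hr0 := h2.1
    have h3 := (h3 _ h2).1
    have h6 := hup n h4 _ hr0
    set V := sumVar p d n (r n)
    have hsV : 0 < Real.sqrt V := by
      by_contra hcon
      nlinarith [Real.sqrt_nonneg V]
    have hV0 : 0 < V := Real.sqrt_pos.1 hsV
    set w := Real.sqrt V with hw
    have hw2 : V = w ^ 2 := (Real.sq_sqrt hV0.le).symm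
    have h7 : (∑ h ∈ ppLe p n, (h : ℝ) ^ (k + 3) * Real.exp (-(r n * h))) * r n ^ (k + 3)
        ≤ C / c * (w ^ 2 * r n ^ 2) := by
      calc _ = ∑ h ∈ ppLe p n, (h * r n) ^ (k + 2 + 1) * Real.exp (-(r n * h)) := by
            rw [Finset.sum_mul]
            exact Finset.sum_congr rfl fun h _ => by ring
        _ ≤ C * Real.log n ^ (m - 1) := h6
        _ = C / c * (c * Real.log n ^ (m - 1)) := by field_simp
        _ ≤ C / c * (w ^ 2 * r n ^ 2) := by rw [← hw2]; gcongr
    set A3 := ∑ h ∈ ppLe p n, (h : ℝ) ^ (k + 3) * Real.exp (-(r n * h))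
    simp only [Pi.inv_apply, Function.comp_apply]
    rw [abs_div, abs_of_pos hsV, div_pow, ← div_eq_mul_inv, le_div_iff₀ (by positivity),
      div_mul_eq_mul_div, div_mul_eq_mul_div, div_le_iff₀ (by positivity)]
    have h8 : A3 * r n ^ (k + 1) ≤ C / c * w ^ 2 := by
      have : A3 * r n ^ (k + 1) * r n ^ 2 ≤ C / c * w ^ 2 * r n ^ 2 := by
        calc _ = A3 * r n ^ (k + 3) := by ring
          _ ≤ _ := h7
          _ = _ := by ring
      exact le_of_mul_le_mul_right this (by positivity)
    calc |u| ^ (k + 3) * A3 * (r n * w) ^ (k + 1)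
        = |u| ^ (k + 3) * w ^ (k + 1) * (A3 * r n ^ (k + 1)) := by rw [mul_pow]; ring
      _ ≤ |u| ^ (k + 3) * w ^ (k + 1) * (C / c * w ^ 2) := by gcongr
      _ = _ := by ring

/-- The local limit theorem for the tilted random sum, jointly with the Hamming weight. -/
theorem tendsto_integral_fourierProd {s : ℕ → ℝ} {a : ℝ}
    (hs : Tendsto (fun n => s n ^ 2 * weightVar p d n (r n)) atTop (𝓝 a)) :
    Tendsto (fun n => (Real.sqrt (sumVar p d n (r n)) : ℂ) *
      ∫ t in -Real.pi..Real.pi, fourierProd p d (r n) n (charTest d (r n) (s n)) t) atTop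
      (𝓝 ((Real.sqrt (2 * Real.pi) * Real.exp (-a / 2) : ℝ) : ℂ)) := by
  have hpi := Real.pi_pos
  obtain ⟨c1, hc1, hwv⟩ := weightVar_lower hp1 hpcop hd hm
  obtain ⟨C2, hC2, hcard⟩ := card_ppLe_le hp1 hpcop
  obtain ⟨cv, hcv, Cv, hCv, hV⟩ := sumVar_bounds hp1 hpcop hd hm
  obtain ⟨C3, hC3, hup⟩ := saddle_upper hp1 hpcop hd
  obtain ⟨cq, hcq, hquad⟩ := decay_quadratic hp1 hpcop hd hm
  have hR := tendsto_mul_sqrt_sumVar hp1 hpcop hd hm hr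
  set V : ℕ → ℝ := fun n => sumVar p d n (r n) with hVdef
  set K := |a| + 1 with hK
  have hK0 : 0 < K := by positivity
  have hsK : ∀ᶠ n in atTop, s n ^ 2 * weightVar p d n (r n) ≤ K :=
    hs.eventually_le_const (by rw [hK]; linarith [le_abs_self a])
  -- Convergence of `s² weightVar` forces `s = O((log n) ^ (-m / 2))`. Hence `s² card` stays bounded
  -- while `s² (log n) ^ (m - 1)` tends to `0`.
  have hsL : ∀ᶠ n : ℕ in atTop, s n ^ 2 * Real.log n ^ m ≤ K / c1 := by
    filter_upwards [hsK, hwv, hr] with n h1 h2 h3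
    have h2 := h2 _ h3
    rw [le_div_iff₀ hc1]
    calc s n ^ 2 * Real.log n ^ m * c1 = s n ^ 2 * (c1 * Real.log n ^ m) := by ring
      _ ≤ s n ^ 2 * weightVar p d n (r n) := by gcongr
      _ ≤ K := h1
  have hsC : ∀ᶠ n : ℕ in atTop, s n ^ 2 * (ppLe p n).card ≤ C2 * (K / c1) := by
    filter_upwards [hsL, hcard] with n h1 h2
    calc s n ^ 2 * (ppLe p n).card ≤ s n ^ 2 * (C2 * Real.log n ^ m) := by gcongr
      _ = C2 * (s n ^ 2 * Real.log n ^ m) := by ring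
      _ ≤ _ := by gcongr
  have hsLL : ∀ᶠ n : ℕ in atTop, s n ^ 2 * Real.log n ^ (m - 1) ≤ K / c1 / Real.log n := by
    filter_upwards [hsL, eventually_le_log 1] with n h1 h2
    rw [le_div_iff₀ (by linarith), mul_assoc, ← pow_succ, Nat.sub_add_cancel (by omega)]
    exact h1
  have hinvL : Tendsto (fun n : ℕ => K / c1 / Real.log n) atTop (𝓝 0) :=
    tendsto_const_nhds.div_atTop tendsto_log_natCast
  have hs2 : Tendsto (fun n => s n ^ 2) atTop (𝓝 0) := by
    refine tendsto_of_tendsto_of_tendsto_of_le_of_le' tendsto_const_nhds hinvL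
      (Eventually.of_forall fun n => sq_nonneg _) ?_
    filter_upwards [hsLL, eventually_le_log 1] with n h1 h2
    exact le_trans (le_mul_of_one_le_right (sq_nonneg _) (one_le_pow₀ h2)) h1
  have hs0 : Tendsto s atTop (𝓝 0) := by
    refine (tendsto_zero_iff_abs_tendsto_zero _).2 ?_
    have := hs2.sqrt
    rw [Real.sqrt_zero] at this
    refine this.congr fun n => ?_
    exact Real.sqrt_sq_eq_abs _
  have hrV : ∀ᶠ n in atTop, 0 < V n := by
    filter_upwards [hR.eventually_gt_atTop 0] with n hn
    by_contra hcon
    simp only [hVdef] at hcon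
    rw [Real.sqrt_eq_zero_of_nonpos (not_lt.1 hcon), mul_zero] at hn
    exact lt_irrefl _ hn
  -- the covariance term
  have hcov : ∀ u : ℝ, Tendsto (fun n => 2 * (u / Real.sqrt (V n)) * s n *
      ∑ h ∈ ppLe p n, h * digitCov d (r n) h) atTop (𝓝 0) := by
    intro u
    refine (tendsto_zero_iff_abs_tendsto_zero _).2 ?_
    have h1 : Tendsto (fun n : ℕ => 4 * |u| * (C3 / Real.sqrt cv) * Real.sqrt (K / c1 / Real.log n))
        atTop (𝓝 0) := by
      have := (hinvL.sqrt).const_mul (4 * |u| * (C3 / Real.sqrt cv))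
      rwa [Real.sqrt_zero, mul_zero] at this
    refine tendsto_of_tendsto_of_tendsto_of_le_of_le' tendsto_const_nhds h1
      (Eventually.of_forall fun n => abs_nonneg _) ?_
    filter_upwards [hr, hrV, hV, hsLL, eventually_le_log 1] with n h2 h3 h4 h5 h6
    have hr0 := h2.1
    have h4 := (h4 _ h2).1
    have h7 := hup n h6 _ h2
    set P := Real.log n ^ (m - 1)
    have hP : 0 < P := by positivity
    have hsP : 0 < Real.sqrt P := Real.sqrt_pos.2 hP
    have hsV : 0 < Real.sqrt (V n) := Real.sqrt_pos.2 h3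
    -- The saddle equation enters through `abs_digitCov_le`. Then `n / √V` is `O((log n) ^ ((m - 1)
    -- / 2))`, and the covariance term is `O((log n) ^ (-1 / 2))`.
    have hc : |∑ h ∈ ppLe p n, h * digitCov d (r n) h| ≤ 2 * n := by
      refine (Finset.abs_sum_le_sum_abs _ _).trans ?_
      rw [← h2.2, Finset.mul_sum]
      refine Finset.sum_le_sum fun h _ => ?_
      rw [abs_mul, Nat.abs_cast]
      calc (h : ℝ) * |digitCov d (r n) h| ≤ h * (2 * digitMean d (r n) h) := by
            gcongr; exact abs_digitCov_le hd
        _ = _ := by ring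
    have hw : Real.sqrt cv * Real.sqrt P ≤ Real.sqrt (V n) * r n := by
      have := Real.sqrt_le_sqrt h4
      rwa [Real.sqrt_mul hcv.le, Real.sqrt_mul' _ (sq_nonneg _), Real.sqrt_sq hr0.le] at this
    have hn : (n : ℝ) / Real.sqrt (V n) ≤ C3 / Real.sqrt cv * Real.sqrt P := by
      rw [div_le_iff₀ hsV]
      have hPP : P = Real.sqrt P * Real.sqrt P := (Real.mul_self_sqrt hP.le).symm
      have hcv0 : 0 < Real.sqrt cv := Real.sqrt_pos.2 hcv
      have : (n : ℝ) * r n ≤ C3 / Real.sqrt cv * Real.sqrt P * Real.sqrt (V n) * r n := by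
        calc (n : ℝ) * r n ≤ C3 * P := h7
          _ = C3 / Real.sqrt cv * Real.sqrt P * (Real.sqrt cv * Real.sqrt P) := by
            rw [hPP]; field_simp; simp
          _ ≤ C3 / Real.sqrt cv * Real.sqrt P * (Real.sqrt (V n) * r n) := by gcongr
          _ = _ := by ring
      exact le_of_mul_le_mul_right this hr0
    have hsS : |s n| * Real.sqrt P ≤ Real.sqrt (K / c1 / Real.log n) := by
      rw [← Real.sqrt_sq_eq_abs, ← Real.sqrt_mul (sq_nonneg _)]
      exact Real.sqrt_le_sqrt h5
    calc |2 * (u / Real.sqrt (V n)) * s n * ∑ h ∈ ppLe p n, h * digitCov d (r n) h|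
        = 2 * (|u| / Real.sqrt (V n)) * |s n| * |∑ h ∈ ppLe p n, h * digitCov d (r n) h| := by
          rw [abs_mul, abs_mul, abs_mul, abs_div, abs_of_pos hsV]; norm_num
      _ ≤ 2 * (|u| / Real.sqrt (V n)) * |s n| * (2 * n) := by gcongr
      _ = 4 * |u| * |s n| * (n / Real.sqrt (V n)) := by ring
      _ ≤ 4 * |u| * |s n| * (C3 / Real.sqrt cv * Real.sqrt P) := by gcongr
      _ = 4 * |u| * (C3 / Real.sqrt cv) * (|s n| * Real.sqrt P) := by ring
      _ ≤ _ := by gcongr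
  -- pointwise limit
  have hpoint : ∀ u : ℝ, Tendsto (fun n => fourierProd p d (r n) n (charTest d (r n) (s n))
      (u / Real.sqrt (V n))) atTop (𝓝 ((Real.exp (-(u ^ 2 + a) / 2) : ℝ) : ℂ)) := by
    intro u
    have hG : Tendsto (fun n => ((Real.exp (-((u / Real.sqrt (V n)) ^ 2 * sumVar p d n (r n)
        + 2 * (u / Real.sqrt (V n)) * s n * ∑ h ∈ ppLe p n, h * digitCov d (r n) h
        + s n ^ 2 * weightVar p d n (r n)) / 2) : ℝ) : ℂ)) atTop
        (𝓝 ((Real.exp (-(u ^ 2 + a) / 2) : ℝ) : ℂ)) := by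
      refine (Complex.continuous_ofReal.tendsto _).comp ((Real.continuous_exp.tendsto _).comp ?_)
      have h1 : Tendsto (fun n => (u / Real.sqrt (V n)) ^ 2 * sumVar p d n (r n)) atTop (𝓝 (u ^ 2)) := by
        refine tendsto_const_nhds.congr' ?_
        filter_upwards [hrV] with n hn
        rw [div_pow, Real.sq_sqrt hn.le]
        exact (div_mul_cancel₀ _ hn.ne').symm
      have h2 := ((h1.add (hcov u)).add hs).neg.div_const 2
      rwa [add_zero] at h2
    have hE : Tendsto (fun n => 32 * d ^ 4 * (|u / Real.sqrt (V n)| ^ (0 + 3) *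
          ∑ h ∈ ppLe p n, (h : ℝ) ^ (0 + 3) * Real.exp (-(r n * h)))
        + 16 * (|s n| * (C2 * (K / c1)))
        + 32 * d ^ 6 * (|u / Real.sqrt (V n)| ^ (1 + 3) *
          ∑ h ∈ ppLe p n, (h : ℝ) ^ (1 + 3) * Real.exp (-(r n * h)))
        + 8 * (s n ^ 2 * (C2 * (K / c1)))) atTop (𝓝 0) := by
      have h1 := (tendsto_sum_pow_scaled hp1 hpcop hd hm hr 0 u).const_mul (32 * (d : ℝ) ^ 4)
      have h2 := (hs0.abs.mul_const (C2 * (K / c1))).const_mul 16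
      have h3 := (tendsto_sum_pow_scaled hp1 hpcop hd hm hr 1 u).const_mul (32 * (d : ℝ) ^ 6)
      have h4 := (hs2.mul_const (C2 * (K / c1))).const_mul 8
      have h5 := ((h1.add h2).add h3).add h4
      simpa using h5
    rw [← sub_zero ((Real.exp (-(u ^ 2 + a) / 2) : ℝ) : ℂ)]
    rw [show (fun n => fourierProd p d (r n) n (charTest d (r n) (s n)) (u / Real.sqrt (V n)))
      = fun n => ((Real.exp (-((u / Real.sqrt (V n)) ^ 2 * sumVar p d n (r n)
        + 2 * (u / Real.sqrt (V n)) * s n * ∑ h ∈ ppLe p n, h * digitCov d (r n) h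
        + s n ^ 2 * weightVar p d n (r n)) / 2) : ℝ) : ℂ) -
        (((Real.exp (-((u / Real.sqrt (V n)) ^ 2 * sumVar p d n (r n)
        + 2 * (u / Real.sqrt (V n)) * s n * ∑ h ∈ ppLe p n, h * digitCov d (r n) h
        + s n ^ 2 * weightVar p d n (r n)) / 2) : ℝ) : ℂ) -
          fourierProd p d (r n) n (charTest d (r n) (s n)) (u / Real.sqrt (V n))) by
      funext n; ring]
    refine hG.sub (squeeze_zero_norm' ?_ hE)
    filter_upwards [hr, hsC] with n h1 h2
    rw [norm_sub_rev]
    refine (norm_fourierProd_sub_gaussian_le p hd n h1.1.le _ _).trans ?_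
    have h3 : |s n| ^ 3 * (ppLe p n).card ≤ |s n| * (C2 * (K / c1)) := by
      calc |s n| ^ 3 * (ppLe p n).card = |s n| * (s n ^ 2 * (ppLe p n).card) := by
            rw [← sq_abs]; ring
        _ ≤ _ := by gcongr
    have h4 : |s n| ^ 4 * (ppLe p n).card ≤ s n ^ 2 * (C2 * (K / c1)) := by
      calc |s n| ^ 4 * (ppLe p n).card = s n ^ 2 * (s n ^ 2 * (ppLe p n).card) := by
            rw [← sq_abs]; ring
        _ ≤ _ := by gcongr
    simp only [zero_add, Nat.reduceAdd]
    linarith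
  -- the major arc
  set G : ℕ → ℝ → ℂ := fun n u => (majorArc (r n)).indicator
    (fourierProd p d (r n) n (charTest d (r n) (s n))) (u * (Real.sqrt (V n))⁻¹) with hG
  have hmajor : Tendsto (fun n => ∫ u, G n u) atTop
      (𝓝 (∫ u : ℝ, ((Real.exp (-(u ^ 2 + a) / 2) : ℝ) : ℂ))) := by
    -- The Gaussian majorant is `decay_quadratic` in the rescaled variable; the constant in front
    -- bounds the loss `exp (s² card)`.
    refine tendsto_integral_filter_of_dominated_convergence
      (fun u => Real.exp (C2 * (K / c1)) * Real.exp (-cq * u ^ 2)) ?_ ?_ ?_ ?_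
    · refine Eventually.of_forall fun n => ?_
      refine Measurable.aestronglyMeasurable ?_
      exact ((continuous_fourierProd p d (r n) n _).measurable.indicator
        (measurableSet_majorArc _)).comp (measurable_mul_const _)
    · have hs1 : ∀ᶠ n in atTop, |s n| ≤ 1 := by
        have := hs0.abs
        rw [abs_zero] at this
        exact this.eventually_le_const one_pos
      filter_upwards [hr, hquad, hrV, hsC, hs1] with n h1 h2 h3 h4 h5
      refine Eventually.of_forall fun u => ?_
      simp only [hG]
      by_cases hu : u * (Real.sqrt (V n))⁻¹ ∈ majorArc (r n)
      · rw [Set.indicator_of_mem hu]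
        refine (norm_fourierProd_charFun_le hd n (r n) _ (s n)).trans ?_
        rw [← Real.exp_add]
        apply Real.exp_le_exp.2
        have h6 := h2 _ h1 (u * (Real.sqrt (V n))⁻¹) (s n) hu.2 h5
        have h7 : sumVar p d n (r n) * (u * (Real.sqrt (V n))⁻¹) ^ 2 = u ^ 2 := by
          rw [mul_pow, inv_pow, Real.sq_sqrt h3.le]
          have : V n ≠ 0 := h3.ne'
          simp only [hVdef] at this ⊢
          field_simp
        rw [h7] at h6
        linarith
      · rw [Set.indicator_of_notMem hu, norm_zero]
        positivity
    · exact (integrable_exp_neg_mul_sq hcq).const_mul _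
    · refine Eventually.of_forall fun u => ?_
      -- For fixed `u` the rescaled point eventually lies in the central arc, so the indicator
      -- disappears in the limit.
      refine (hpoint u).congr' ?_
      have h1 : ∀ᶠ n in atTop, |u| ≤ r n * Real.sqrt (V n) := hR.eventually_ge_atTop |u|
      filter_upwards [h1, hr, hrV, saddle_log_lower hp1 hpcop hd,
        eventually_le_log (2 * Real.log 2)] with n h1 h2 h3 h4 h5
      have hr0 := h2.1
      have hsV : 0 < Real.sqrt (V n) := Real.sqrt_pos.2 h3
      have h6 : r n ≤ 1 / 2 := by
        have h7 := (h4 _ h2)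
        have h8 : Real.log 2 ≤ Real.log (1 / r n) := by linarith
        rw [Real.log_le_log_iff (by norm_num) (by positivity), le_div_iff₀ hr0] at h8
        linarith
      have h9 : |u * (Real.sqrt (V n))⁻¹| ≤ r n := by
        rw [abs_mul, abs_inv, abs_of_pos hsV, ← div_eq_mul_inv, div_le_iff₀ hsV]
        exact h1
      have hpi3 := Real.pi_gt_three
      have hmem : u * (Real.sqrt (V n))⁻¹ ∈ majorArc (r n) := by
        refine ⟨abs_le.1 (by linarith), ?_⟩
        rw [Set.mem_ofPred_eq]
        nlinarith
      simp only [hG]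
      rw [Set.indicator_of_mem hmem, div_eq_mul_inv]
  have hlimit : ∫ u : ℝ, ((Real.exp (-(u ^ 2 + a) / 2) : ℝ) : ℂ)
      = ((Real.sqrt (2 * Real.pi) * Real.exp (-a / 2) : ℝ) : ℂ) := by
    rw [integral_complex_ofReal]
    congr 1
    have : ∀ u : ℝ, Real.exp (-(u ^ 2 + a) / 2) = Real.exp (-(1 / 2) * u ^ 2) * Real.exp (-a / 2) := by
      intro u
      rw [← Real.exp_add]
      congr 1
      ring
    simp only [this]
    rw [integral_mul_const, integral_gaussian]
    congr 2
    field_simp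
  rw [hlimit] at hmajor
  have hminor : Tendsto (fun n => (Real.sqrt (V n) : ℂ) *
      ∫ t in minorArc (r n), fourierProd p d (r n) n (charTest d (r n) (s n)) t) atTop (𝓝 0) := by
    have h1 := tendsto_minorArc_integral hp1 hpcop hd hm hr hs0 0
    refine squeeze_zero_norm (fun n => ?_) h1
    rw [pow_zero, one_mul, norm_mul, Complex.norm_real, Real.norm_of_nonneg (Real.sqrt_nonneg _)]
    refine mul_le_mul_of_nonneg_left ?_ (Real.sqrt_nonneg _)
    refine norm_integral_le_of_norm_le ?_ (Eventually.of_forall fun t =>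
      norm_fourierProd_charFun_le hd n (r n) t (s n))
    exact ((continuous_decay p d n (r n) (s n)).neg.rexp.continuousOn.integrableOn_Icc).mono_set
      Set.inter_subset_left
  have hsum := hmajor.add hminor
  rw [add_zero] at hsum
  refine hsum.congr' ?_
  filter_upwards [hrV] with n hn
  have hsV : 0 < Real.sqrt (V n) := Real.sqrt_pos.2 hn
  rw [integral_eq_major_add_minor (continuous_fourierProd p d (r n) n _) (r n), mul_add]
  congr 1
  have h1 := Measure.integral_comp_mul_right ((majorArc (r n)).indicator
    (fourierProd p d (r n) n (charTest d (r n) (s n)))) (Real.sqrt (V n))⁻¹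
  rw [inv_inv, abs_of_pos hsV, integral_indicator (measurableSet_majorArc _)] at h1
  simp only [hG]
  rw [h1, Complex.real_smul]

end

/-! ### Moments of digit functions under the uniform law. -/

theorem integrable_abs_pow_mul_exp {c : ℝ} (hc : 0 < c) (k : ℕ) :
    Integrable fun u : ℝ => |u| ^ k * Real.exp (-c * u ^ 2) := by
  have h := (integrable_rpow_mul_exp_neg_mul_sq hc (s := k)
    (by linarith [k.cast_nonneg (α := ℝ)])).norm
  refine h.congr (Eventually.of_forall fun u => ?_)
  simp

/-- On the central arc substitute `u = t √V`: each `h ∈ A` contributes `|u|` times `h digitMean /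
√V`, leaving an absolute Gaussian moment. On the minor arcs the gains are bounded by `1`. -/
theorem norm_integral_testFun_le {p : Fin m → ℕ} {d : ℕ} (hd : 2 ≤ d) {n : ℕ} {r c : ℝ}
    (hc : 0 < c) (hV : 0 < sumVar p d n r)
    (hquad : ∀ t, |t| ≤ 2 * Real.pi * r → c * (sumVar p d n r * t ^ 2) ≤ decay p d n r t 0)
    {A : Finset ℕ} (hA : A ⊆ ppLe p n) {Y : ℕ → ℕ → ℝ} (hY1 : ∀ h c, |Y h c| ≤ 1)
    (hY : ∀ h ∈ A, ∑ c ∈ Finset.range d, digitW d r h c * Y h c = 0) :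
    Real.sqrt (sumVar p d n r) *
        ‖∫ t in -Real.pi..Real.pi, fourierProd p d r n (testFun A Y) t‖
      ≤ Real.exp 2 ^ A.card * ((∫ u, |u| ^ A.card * Real.exp (-c * u ^ 2)) *
          (∏ h ∈ A, h * digitMean d r h / Real.sqrt (sumVar p d n r))
        + Real.sqrt (sumVar p d n r) * ∫ t in minorArc r, Real.exp (-decay p d n r t 0)) := by
  set w := Real.sqrt (sumVar p d n r) with hw
  have hw0 : 0 < w := Real.sqrt_pos.2 hV
  have hw2 : w ^ 2 = sumVar p d n r := Real.sq_sqrt hV.le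
  set k := A.card with hk
  have hB : ∀ h, 0 ≤ h * digitMean d r h :=
    fun h => mul_nonneg h.cast_nonneg (digitMean_nonneg hd)
  set g : ℝ → ℝ := fun u => |u| ^ k * Real.exp (-c * u ^ 2) with hg
  have hgi : Integrable g := integrable_abs_pow_mul_exp hc k
  have hgw : Integrable fun t => g (t * w) := hgi.comp_mul_right' hw0.ne'
  have hbound := norm_fourierProd_testFun_le hd n r (hA := hA) (hY1 := hY1) (hY := hY)
  have hmajor : ‖∫ t in majorArc r, fourierProd p d r n (testFun A Y) t‖
      ≤ Real.exp 2 ^ k * (∏ h ∈ A, h * digitMean d r h / w) * (w⁻¹ * ∫ u, g u) := by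
    have e : w⁻¹ * ∫ u, g u = ∫ t, g (t * w) := by
      rw [Measure.integral_comp_mul_right, abs_of_pos (inv_pos.2 hw0), smul_eq_mul]
    rw [e, ← integral_const_mul]
    refine (norm_integral_le_of_norm_le (hgw.const_mul _).integrableOn
      ((ae_restrict_iff' (measurableSet_majorArc r)).2 (Eventually.of_forall fun t ht => ?_))).trans
      (setIntegral_le_integral (hgw.const_mul _) (Eventually.of_forall fun t => ?_))
    · refine (hbound t).trans ?_
      have h1 : ∏ h ∈ A, Real.exp 2 * min 1 (|t| * (h * digitMean d r h))
          ≤ ∏ h ∈ A, Real.exp 2 * (h * digitMean d r h / w * |t * w|) := by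
        refine Finset.prod_le_prod (fun h _ => ?_) fun h _ => ?_
        · have := hB h
          positivity
        · gcongr
          refine (min_le_right _ _).trans (le_of_eq ?_)
          rw [abs_mul, abs_of_pos hw0]
          field_simp
      have h2 := hquad t ht.2
      calc _ ≤ (∏ h ∈ A, Real.exp 2 * (h * digitMean d r h / w * |t * w|)) *
            Real.exp (-c * (t * w) ^ 2) := by
            gcongr
            · exact Finset.prod_nonneg fun h _ => by have := hB h; positivity
            · rw [mul_pow, hw2]; linarith
        _ = _ := by
            rw [Finset.prod_mul_distrib, Finset.prod_mul_distrib, Finset.prod_const,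
              Finset.prod_const, ← hk, hg]
            ring
    · have : 0 ≤ ∏ h ∈ A, h * digitMean d r h / w :=
        Finset.prod_nonneg fun h _ => div_nonneg (hB h) hw0.le
      simp only [Pi.zero_apply, hg]
      positivity
  have hminor : ‖∫ t in minorArc r, fourierProd p d r n (testFun A Y) t‖
      ≤ Real.exp 2 ^ k * ∫ t in minorArc r, Real.exp (-decay p d n r t 0) := by
    rw [← integral_const_mul]
    have hi : IntegrableOn (fun t => Real.exp (-decay p d n r t 0)) (minorArc r) :=
      ((continuous_decay p d n r 0).neg.rexp.continuousOn.integrableOn_Icc).mono_set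
        Set.inter_subset_left
    refine norm_integral_le_of_norm_le (hi.const_mul _) (Eventually.of_forall fun t => ?_)
    refine (hbound t).trans ?_
    gcongr
    rw [hk, ← Finset.prod_const]
    refine Finset.prod_le_prod (fun h _ => ?_) fun h _ => ?_
    · have := hB h
      positivity
    · exact mul_le_of_le_one_right (Real.exp_nonneg _) (min_le_left _ _)
  rw [integral_eq_major_add_minor (continuous_fourierProd p d r n _)]
  calc _ ≤ w * (Real.exp 2 ^ k * (∏ h ∈ A, h * digitMean d r h / w) * (w⁻¹ * ∫ u, g u)
        + Real.exp 2 ^ k * ∫ t in minorArc r, Real.exp (-decay p d n r t 0)) := by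
        gcongr
        exact (norm_add_le _ _).trans (add_le_add hmajor hminor)
    _ = _ := by
        field_simp

/-- The size of the minor arcs relative to that of the central peak. -/
noncomputable def minorRatio (p : Fin m → ℕ) (d n : ℕ) (r : ℝ) : ℝ :=
  Real.sqrt (sumVar p d n r) * ∫ t in minorArc r, Real.exp (-decay p d n r t 0)

theorem minorRatio_nonneg (p : Fin m → ℕ) (d n : ℕ) (r : ℝ) : 0 ≤ minorRatio p d n r :=
  mul_nonneg (Real.sqrt_nonneg _) (integral_nonneg fun _ => Real.exp_nonneg _)

theorem repAvg_sum {ι : Type*} (p : Fin m → ℕ) (d n : ℕ) (S : Finset ι)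
    (F : ι → (ℕ →₀ ℕ) → ℂ) :
    repAvg p d n (fun a => ∑ i ∈ S, F i a) = ∑ i ∈ S, repAvg p d n (F i) := by
  simp only [repAvg]
  rw [Finset.sum_comm, Finset.sum_div]

theorem repAvg_sub (p : Fin m → ℕ) (d n : ℕ) (F G : (ℕ →₀ ℕ) → ℂ) :
    repAvg p d n (fun a => F a - G a) = repAvg p d n F - repAvg p d n G := by
  simp only [repAvg, Finset.sum_sub_distrib, sub_div]

theorem repAvg_const {p : Fin m → ℕ} {d n : ℕ} (hne : (repFin p d n).Nonempty) (c : ℂ) :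
    repAvg p d n (fun _ => c) = c := by
  have : ((repFin p d n).card : ℂ) ≠ 0 := by exact_mod_cast (Finset.card_pos.2 hne).ne'
  rw [repAvg, Finset.sum_const, nsmul_eq_mul, mul_div_cancel_left₀ _ this]

theorem repAvg_congr {p : Fin m → ℕ} {d n : ℕ} {F G : (ℕ →₀ ℕ) → ℂ}
    (h : ∀ a ∈ repFin p d n, F a = G a) : repAvg p d n F = repAvg p d n G := by
  rw [repAvg, repAvg, Finset.sum_congr rfl h]

section
variable {p : Fin m → ℕ} (hp1 : ∀ j, 1 < p j) (hpcop : ∀ i j, i ≠ j → Nat.Coprime (p i) (p j))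
  {d : ℕ} (hd : 2 ≤ d) (hm : 2 ≤ m) {r : ℕ → ℝ} (hr : ∀ᶠ n in atTop, IsSaddle p d n (r n))
include hp1 hpcop hd hm hr

theorem tendsto_integral_fourierProd_one :
    Tendsto (fun n => (Real.sqrt (sumVar p d n (r n)) : ℂ) *
      ∫ t in -Real.pi..Real.pi, fourierProd p d (r n) n (fun _ _ => 1) t) atTop
      (𝓝 ((Real.sqrt (2 * Real.pi) : ℝ) : ℂ)) := by
  have h := tendsto_integral_fourierProd hp1 hpcop hd hm hr (s := fun _ => 0) (a := 0) (by simp)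
  have e : ∀ n, charTest d (r n) 0 = fun _ _ => 1 := fun n => by
    funext h c
    simp [charTest]
  simpa [e] using h

theorem eventually_sumVar_pos : ∀ᶠ n in atTop, 0 < sumVar p d n (r n) := by
  filter_upwards [(tendsto_mul_sqrt_sumVar hp1 hpcop hd hm hr).eventually_gt_atTop 0] with n hn
  by_contra hcon
  rw [Real.sqrt_eq_zero_of_nonpos (not_lt.1 hcon), mul_zero] at hn
  exact lt_irrefl _ hn

/-- The limit is `√(2π) > 1`; this keeps the denominator of all quotients of Fourier integrals away
from zero. -/
theorem eventually_one_le_norm_integral :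
    ∀ᶠ n in atTop, 1 ≤ Real.sqrt (sumVar p d n (r n)) *
      ‖∫ t in -Real.pi..Real.pi, fourierProd p d (r n) n (fun _ _ => 1) t‖ := by
  have h := (tendsto_integral_fourierProd_one hp1 hpcop hd hm hr).norm
  have h1 : 1 < ‖((Real.sqrt (2 * Real.pi) : ℝ) : ℂ)‖ := by
    rw [Complex.norm_real, Real.norm_of_nonneg (Real.sqrt_nonneg _), Real.lt_sqrt zero_le_one]
    linarith [Real.pi_gt_three]
  filter_upwards [h.eventually_const_le h1] with n hn
  rwa [norm_mul, Complex.norm_real, Real.norm_of_nonneg (Real.sqrt_nonneg _)] at hn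

theorem eventually_repFin_nonempty : ∀ᶠ n in atTop, (repFin p d n).Nonempty := by
  filter_upwards [hr, eventually_one_le_norm_integral hp1 hpcop hd hm hr] with n h1 h2
  refine repFin_nonempty_of_integral_ne_zero h1 fun h => ?_
  rw [h, norm_zero, mul_zero] at h2
  linarith

/-- Products of centred functions of distinct digits are nearly uncorrelated under the uniform law
on representations. -/
theorem norm_repAvg_prod_le (k : ℕ) :
    ∃ M > 0, ∀ᶠ n in atTop, ∀ A ⊆ ppLe p n, A.card = k → ∀ Y : ℕ → ℕ → ℝ, (∀ h c, |Y h c| ≤ 1) →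
      (∀ h ∈ A, ∑ c ∈ Finset.range d, digitW d (r n) h c * Y h c = 0) →
      ‖repAvg p d n (fun a => ∏ h ∈ A, (Y h (a h) : ℂ))‖
        ≤ M * ((∏ h ∈ A, h * digitMean d (r n) h / Real.sqrt (sumVar p d n (r n)))
          + minorRatio p d n (r n)) := by
  obtain ⟨c, hc, hquad⟩ := decay_quadratic hp1 hpcop hd hm
  set I := ∫ u : ℝ, |u| ^ k * Real.exp (-c * u ^ 2) with hI
  have hI0 : 0 ≤ I := integral_nonneg fun u => by positivity
  refine ⟨Real.exp 2 ^ k * (I + 1), by positivity, ?_⟩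
  filter_upwards [hr, hquad, eventually_sumVar_pos hp1 hpcop hd hm hr,
    eventually_one_le_norm_integral hp1 hpcop hd hm hr,
    eventually_repFin_nonempty hp1 hpcop hd hm hr] with n h1 h2 h3 h4 h5 A hA hAk Y hY1 hY
  have hq : ∀ t, |t| ≤ 2 * Real.pi * r n →
      c * (sumVar p d n (r n) * t ^ 2) ≤ decay p d n (r n) t 0 := fun t ht => by
    have := h2 _ h1 t 0 ht (by simp)
    simpa using this
  have h6 := norm_integral_testFun_le hd hc h3 hq hA hY1 hY
  rw [hAk, ← hI] at h6
  have e : repAvg p d n (fun a => ∏ h ∈ A, (Y h (a h) : ℂ))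
      = repAvg p d n (fun a => ∏ h ∈ ppLe p n, testFun A Y h (a h)) := by
    congr 1
    funext a
    simp only [testFun]
    rw [Finset.prod_ite_mem, Finset.inter_eq_right.2 hA]
  rw [e, repAvg_prod hd h1 h5, norm_div]
  set D := ‖∫ t in -Real.pi..Real.pi, fourierProd p d (r n) n (fun _ _ => 1) t‖
  set w := Real.sqrt (sumVar p d n (r n)) with hw
  have hw0 : 0 < w := Real.sqrt_pos.2 h3
  have hD : 0 < D := by
    by_contra hcon
    nlinarith [not_lt.1 hcon]
  set B := ∏ h ∈ A, h * digitMean d (r n) h / w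
  have hB : 0 ≤ B := Finset.prod_nonneg fun h _ =>
    div_nonneg (mul_nonneg h.cast_nonneg (digitMean_nonneg hd)) hw0.le
  have hmr := minorRatio_nonneg p d n (r n)
  rw [← mul_div_mul_left _ _ hw0.ne']
  have hn0 : 0 ≤ w * ‖∫ t in -Real.pi..Real.pi, fourierProd p d (r n) n (testFun A Y) t‖ := by
    positivity
  -- Numerator and denominator have both been multiplied by `w`, after which the denominator is at
  -- least `1`.
  refine (div_le_self hn0 h4).trans (h6.trans ?_)
  rw [mul_assoc]
  refine mul_le_mul_of_nonneg_left ?_ (by positivity)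
  change I * B + minorRatio p d n (r n) ≤ _
  nlinarith

theorem tendsto_minorRatio (k : ℕ) :
    Tendsto (fun n : ℕ => Real.log n ^ k * minorRatio p d n (r n)) atTop (𝓝 0) :=
  tendsto_minorArc_integral hp1 hpcop hd hm hr tendsto_const_nhds k

theorem div_sqrt_sumVar_le :
    ∃ C > 0, ∀ᶠ n : ℕ in atTop, n / Real.sqrt (sumVar p d n (r n))
      ≤ C * Real.sqrt (Real.log n ^ (m - 1)) := by
  obtain ⟨c, hc, _, _, hV⟩ := sumVar_bounds hp1 hpcop hd hm
  obtain ⟨C, hC, hup⟩ := saddle_upper hp1 hpcop hd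
  have hsc := Real.sqrt_pos.2 hc
  refine ⟨C / Real.sqrt c, by positivity, ?_⟩
  filter_upwards [hr, hV, eventually_sumVar_pos hp1 hpcop hd hm hr, eventually_le_log 1]
    with n h1 h2 h3 h4
  have hr0 := h1.1
  have h2 := (h2 _ h1).1
  have h5 := hup n h4 _ h1
  set P := Real.log n ^ (m - 1)
  have hP : 0 < P := by positivity
  have hsV : 0 < Real.sqrt (sumVar p d n (r n)) := Real.sqrt_pos.2 h3
  have hw : Real.sqrt c * Real.sqrt P ≤ Real.sqrt (sumVar p d n (r n)) * r n := by
    have := Real.sqrt_le_sqrt h2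
    rwa [Real.sqrt_mul hc.le, Real.sqrt_mul' _ (sq_nonneg _), Real.sqrt_sq hr0.le] at this
  rw [div_le_iff₀ hsV]
  have hPP : P = Real.sqrt P * Real.sqrt P := (Real.mul_self_sqrt hP.le).symm
  have : (n : ℝ) * r n ≤ C / Real.sqrt c * Real.sqrt P * Real.sqrt (sumVar p d n (r n)) * r n := by
    calc (n : ℝ) * r n ≤ C * P := h5
      _ = C / Real.sqrt c * Real.sqrt P * (Real.sqrt c * Real.sqrt P) := by
        rw [hPP]; field_simp; simp
      _ ≤ C / Real.sqrt c * Real.sqrt P * (Real.sqrt (sumVar p d n (r n)) * r n) := by gcongr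
      _ = _ := by ring
  exact le_of_mul_le_mul_right this hr0

/-- The minor arc error survives summation over all tuples of `k` power products. -/
theorem card_pow_mul_minorRatio_le (k : ℕ) :
    ∀ᶠ n : ℕ in atTop, ((ppLe p n).card : ℝ) ^ k * minorRatio p d n (r n) ≤ 1 := by
  obtain ⟨C, hC, hcard⟩ := card_ppLe_le hp1 hpcop
  have h := (tendsto_minorRatio hp1 hpcop hd hm hr (m * k)).const_mul (C ^ k)
  rw [mul_zero] at h
  filter_upwards [hcard, h.eventually_le_const one_pos] with n h1 h2
  have := minorRatio_nonneg p d n (r n)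
  calc _ ≤ (C * Real.log n ^ m) ^ k * minorRatio p d n (r n) := by gcongr
    _ = C ^ k * (Real.log n ^ (m * k) * minorRatio p d n (r n)) := by rw [mul_pow, pow_mul]; ring
    _ ≤ 1 := h2

/-- Summing the one-digit bounds, the saddle equation turns the sum of `h digitMean` into `n`, and
`n / √V` is `O((log n) ^ ((m - 1) / 2))`. -/
theorem norm_repAvg_sum_le :
    ∃ C > 0, ∀ᶠ n : ℕ in atTop, ∀ Y : ℕ → ℕ → ℝ, (∀ h c, |Y h c| ≤ 1) →
      (∀ h ∈ ppLe p n, ∑ c ∈ Finset.range d, digitW d (r n) h c * Y h c = 0) →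
      ‖repAvg p d n (fun a => ∑ h ∈ ppLe p n, (Y h (a h) : ℂ))‖
        ≤ C * Real.sqrt (Real.log n ^ (m - 1)) := by
  obtain ⟨M, hM, h⟩ := norm_repAvg_prod_le hp1 hpcop hd hm hr 1
  obtain ⟨C, hC, hdiv⟩ := div_sqrt_sumVar_le hp1 hpcop hd hm hr
  refine ⟨M * (C + 1), by positivity, ?_⟩
  filter_upwards [h, hdiv, hr, card_pow_mul_minorRatio_le hp1 hpcop hd hm hr 1,
    eventually_le_log 1] with n h1 h2 h3 h4 h5 Y hY1 hY
  rw [repAvg_sum]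
  have h6 : ∀ i ∈ ppLe p n, ‖repAvg p d n (fun a => (Y i (a i) : ℂ))‖
      ≤ M * (i * digitMean d (r n) i / Real.sqrt (sumVar p d n (r n)) + minorRatio p d n (r n)) := by
    intro i hi
    have := h1 {i} (Finset.singleton_subset_iff.2 hi) (Finset.card_singleton i) Y hY1
      (fun j hj => hY j (by rw [Finset.mem_singleton.1 hj]; exact hi))
    simpa using this
  have h7 : 1 ≤ Real.sqrt (Real.log n ^ (m - 1)) := by
    rw [Real.one_le_sqrt]; exact one_le_pow₀ h5
  calc _ ≤ ∑ i ∈ ppLe p n, M * (i * digitMean d (r n) i / Real.sqrt (sumVar p d n (r n))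
        + minorRatio p d n (r n)) := (norm_sum_le _ _).trans (Finset.sum_le_sum h6)
    _ = M * (n / Real.sqrt (sumVar p d n (r n))
        + ((ppLe p n).card : ℝ) ^ 1 * minorRatio p d n (r n)) := by
        rw [← Finset.mul_sum, Finset.sum_add_distrib, ← Finset.sum_div, h3.2, Finset.sum_const,
          nsmul_eq_mul, pow_one]
    _ ≤ M * (C * Real.sqrt (Real.log n ^ (m - 1)) + 1 * Real.sqrt (Real.log n ^ (m - 1))) := by
        rw [one_mul]
        exact mul_le_mul_of_nonneg_left (add_le_add h2 (h4.trans h7)) hM.le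
    _ = _ := by ring

/-- Summing the two-digit bounds over pairs gives `(n / √V) ^ 2`, smaller than the variance of the
weight by a factor `log n`. -/
theorem norm_repAvg_offDiag_le :
    ∃ C > 0, ∀ᶠ n : ℕ in atTop, ∀ Y : ℕ → ℕ → ℝ, (∀ h c, |Y h c| ≤ 1) →
      (∀ h ∈ ppLe p n, ∑ c ∈ Finset.range d, digitW d (r n) h c * Y h c = 0) →
      ‖repAvg p d n (fun a => ∑ x ∈ (ppLe p n).offDiag, (Y x.1 (a x.1) : ℂ) * Y x.2 (a x.2))‖
        ≤ C * Real.log n ^ (m - 1) := by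
  obtain ⟨M, hM, h⟩ := norm_repAvg_prod_le hp1 hpcop hd hm hr 2
  obtain ⟨C, hC, hdiv⟩ := div_sqrt_sumVar_le hp1 hpcop hd hm hr
  refine ⟨M * (C ^ 2 + 1), by positivity, ?_⟩
  filter_upwards [h, hdiv, hr, card_pow_mul_minorRatio_le hp1 hpcop hd hm hr 2,
    eventually_le_log 1] with n h1 h2 h3 h4 h5 Y hY1 hY
  rw [repAvg_sum]
  set w := Real.sqrt (sumVar p d n (r n)) with hw
  set B : ℕ → ℝ := fun i => i * digitMean d (r n) i / w with hBdef
  have hB : ∀ i, 0 ≤ B i := fun i =>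
    div_nonneg (mul_nonneg i.cast_nonneg (digitMean_nonneg hd)) (Real.sqrt_nonneg _)
  have hmr := minorRatio_nonneg p d n (r n)
  have h6 : ∀ x ∈ (ppLe p n).offDiag, ‖repAvg p d n (fun a => (Y x.1 (a x.1) : ℂ) * Y x.2 (a x.2))‖
      ≤ M * (B x.1 * B x.2 + minorRatio p d n (r n)) := by
    intro x hx
    obtain ⟨hx1, hx2, hx3⟩ := Finset.mem_offDiag.1 hx
    have hsub : ({x.1, x.2} : Finset ℕ) ⊆ ppLe p n := by
      intro j hj
      rcases Finset.mem_insert.1 hj with h | h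
      · rwa [h]
      · rwa [Finset.mem_singleton.1 h]
    have := h1 {x.1, x.2} hsub (Finset.card_pair hx3) Y hY1 fun j hj => hY j (hsub hj)
    rw [Finset.prod_pair hx3] at this
    simpa only [Finset.prod_pair hx3] using this
  have h7 : 1 ≤ Real.log n ^ (m - 1) := one_le_pow₀ h5
  have h8 : ∑ i ∈ ppLe p n, B i = n / w := by rw [← Finset.sum_div, h3.2]
  have h9 : (n / w) ^ 2 ≤ C ^ 2 * Real.log n ^ (m - 1) := by
    have h0 : 0 ≤ n / w := div_nonneg n.cast_nonneg (Real.sqrt_nonneg _)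
    calc (n / w) ^ 2 ≤ (C * Real.sqrt (Real.log n ^ (m - 1))) ^ 2 := by gcongr
      _ = _ := by rw [mul_pow, Real.sq_sqrt (by linarith)]
  calc _ ≤ ∑ x ∈ (ppLe p n).offDiag, M * (B x.1 * B x.2 + minorRatio p d n (r n)) :=
        (norm_sum_le _ _).trans (Finset.sum_le_sum h6)
    _ ≤ ∑ x ∈ ppLe p n ×ˢ ppLe p n, M * (B x.1 * B x.2 + minorRatio p d n (r n)) := by
        refine Finset.sum_le_sum_of_subset_of_nonneg (fun x hx => ?_) fun x _ _ => ?_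
        · obtain ⟨hx1, hx2, _⟩ := Finset.mem_offDiag.1 hx
          exact Finset.mem_product.2 ⟨hx1, hx2⟩
        · have := mul_nonneg (hB x.1) (hB x.2)
          positivity
    _ = M * ((n / w) ^ 2 + ((ppLe p n).card : ℝ) ^ 2 * minorRatio p d n (r n)) := by
        rw [← Finset.mul_sum, Finset.sum_add_distrib, Finset.sum_const, Finset.card_product,
          ← h8, sq, Finset.sum_mul_sum, Finset.sum_product, nsmul_eq_mul, sq]
        push_cast
        rfl
    _ ≤ M * (C ^ 2 * Real.log n ^ (m - 1) + 1 * Real.log n ^ (m - 1)) := by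
        rw [one_mul]
        exact mul_le_mul_of_nonneg_left (add_le_add h9 (h4.trans h7)) hM.le
    _ = _ := by ring

/-- The second moment of the centred Hamming weight. -/
theorem norm_repAvg_sq_sub_weightVar_le :
    ∃ C > 0, ∀ᶠ n : ℕ in atTop,
      ‖repAvg p d n (fun a => (∑ h ∈ ppLe p n, ((nz (a h) - digitQ d (r n) h : ℝ) : ℂ)) ^ 2)
        - (weightVar p d n (r n) : ℂ)‖ ≤ C * Real.log n ^ (m - 1) := by
  obtain ⟨C1, hC1, h1⟩ := norm_repAvg_sum_le hp1 hpcop hd hm hr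
  obtain ⟨C2, hC2, h2⟩ := norm_repAvg_offDiag_le hp1 hpcop hd hm hr
  refine ⟨C1 + C2, by positivity, ?_⟩
  filter_upwards [h1, h2, eventually_repFin_nonempty hp1 hpcop hd hm hr, eventually_le_log 1]
    with n h1 h2 h3 h4
  have hy : ∀ h c, |nz c - digitQ d (r n) h| ≤ 1 := fun h c => abs_nz_sub_digitQ_le hd c
  have hz : ∀ h c : ℕ, |(nz c - digitQ d (r n) h) ^ 2
      - digitQ d (r n) h * (1 - digitQ d (r n) h)| ≤ 1 := fun h c => by
    have a1 := hy h c
    have a2 := digitQ_nonneg (r := r n) (h := h) hd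
    have a3 := digitQ_le_one (r := r n) (h := h) hd
    have a4 : (nz c - digitQ d (r n) h) ^ 2 ≤ 1 := by
      rw [← sq_abs]; exact pow_le_one₀ (abs_nonneg _) a1
    have a5 : 0 ≤ digitQ d (r n) h * (1 - digitQ d (r n) h) := mul_nonneg a2 (by linarith)
    have a6 : digitQ d (r n) h * (1 - digitQ d (r n) h) ≤ 1 := by nlinarith
    rw [abs_le]
    constructor <;> nlinarith [sq_nonneg (nz c - digitQ d (r n) h)]
  have hz0 : ∀ h ∈ ppLe p n, ∑ c ∈ Finset.range d, digitW d (r n) h c *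
      ((nz c - digitQ d (r n) h) ^ 2 - digitQ d (r n) h * (1 - digitQ d (r n) h)) = 0 := by
    intro h _
    simp only [mul_sub (digitW d (r n) h _), Finset.sum_sub_distrib, ← Finset.sum_mul,
      sum_digitW_mul_nz_sub_sq hd, sum_digitW hd]
    ring
  have b1 := h1 (fun h c => (nz c - digitQ d (r n) h) ^ 2
    - digitQ d (r n) h * (1 - digitQ d (r n) h)) hz hz0
  have b2 := h2 (fun h c => nz c - digitQ d (r n) h) hy fun h _ => sum_digitW_mul_nz_sub hd
  -- In the expanded square the diagonal terms, centred at `q (1 - q)`, fall under the one-digit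
  -- bound and the off-diagonal terms under the pair bound.
  have e : repAvg p d n (fun a => (∑ h ∈ ppLe p n, ((nz (a h) - digitQ d (r n) h : ℝ) : ℂ)) ^ 2)
        - (weightVar p d n (r n) : ℂ)
      = repAvg p d n (fun a => ∑ h ∈ ppLe p n, (((nz (a h) - digitQ d (r n) h) ^ 2
          - digitQ d (r n) h * (1 - digitQ d (r n) h) : ℝ) : ℂ))
        + repAvg p d n (fun a => ∑ x ∈ (ppLe p n).offDiag,
          ((nz (a x.1) - digitQ d (r n) x.1 : ℝ) : ℂ) * (nz (a x.2) - digitQ d (r n) x.2 : ℝ)) := by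
    rw [← repAvg_const h3 (weightVar p d n (r n) : ℂ), ← repAvg_sub, ← sub_eq_iff_eq_add,
      ← repAvg_sub]
    refine repAvg_congr fun a _ => ?_
    rw [sq, Finset.sum_mul_sum, ← Finset.sum_product', ← Finset.diag_union_offDiag,
      Finset.sum_union (Finset.disjoint_diag_offDiag _), Finset.sum_diag, weightVar]
    push_cast
    rw [Finset.sum_sub_distrib]
    simp only [← sq]
    ring
  rw [e]
  have h5 : Real.sqrt (Real.log n ^ (m - 1)) ≤ Real.log n ^ (m - 1) := by
    have := one_le_pow₀ (n := m - 1) h4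
    rw [Real.sqrt_le_left (by linarith)]
    nlinarith
  calc _ ≤ C1 * Real.sqrt (Real.log n ^ (m - 1)) + C2 * Real.log n ^ (m - 1) :=
        (norm_add_le _ _).trans (add_le_add b1 b2)
    _ ≤ C1 * Real.log n ^ (m - 1) + C2 * Real.log n ^ (m - 1) := by gcongr
    _ = _ := by ring

end

/-! ### The Hamming weight of a random representation. -/

instance : MeasurableSingletonClass (ℕ →₀ ℕ) := ⟨fun _ => trivial⟩

theorem hammingWeight_eq_sum {p : Fin m → ℕ} {d n : ℕ} {a : ℕ →₀ ℕ} (ha : a ∈ repFin p d n) :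
    hammingWeight a = ∑ h ∈ ppLe p n, nz (a h) := by
  have hs := (mem_repFin.1 ha).1
  rw [hammingWeight, Finset.card_eq_sum_ones, Nat.cast_sum]
  refine Finset.sum_congr_of_eq_on_inter (fun h h1 h2 => absurd (hs h1) h2) (fun h _ h2 => ?_)
    fun h h1 _ => ?_
  · simp [nz, Finsupp.notMem_support_iff.1 h2]
  · simp [nz, Finsupp.mem_support_iff.1 h1]

theorem integrableOn_count_finset {E : Type*} [NormedAddCommGroup E] (S : Finset (ℕ →₀ ℕ))
    (F : (ℕ →₀ ℕ) → E) : IntegrableOn F S Measure.count := by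
  have : IsFiniteMeasure (Measure.count.restrict (S : Set (ℕ →₀ ℕ))) := ⟨by
    rw [Measure.restrict_apply_univ, Measure.count_apply_finset]
    exact ENNReal.natCast_lt_top _⟩
  have h := IntegrableOn.finset (μ := Measure.count.restrict (S : Set (ℕ →₀ ℕ))) (s := S) (f := F)
  rw [IntegrableOn, Measure.restrict_restrict S.measurableSet, Set.inter_self] at h
  exact h

section
variable {p : Fin m → ℕ} (hp1 : ∀ j, 1 < p j) {d : ℕ} (hd : 2 ≤ d) {n : ℕ}
include hp1 hd

theorem integrable_randomRep {E : Type*} [NormedAddCommGroup E]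
    (hne : (repFin p d n).Nonempty) (F : (ℕ →₀ ℕ) → E) : Integrable F (randomRep p d n) := by
  rw [randomRep, coe_repFin hp1 hd, uniformOn, ProbabilityTheory.cond]
  refine Integrable.smul_measure (integrableOn_count_finset _ F) ?_
  rw [Measure.count_apply_finset, ENNReal.inv_ne_top]
  exact_mod_cast (Finset.card_pos.2 hne).ne'

theorem integral_randomRep (F : (ℕ →₀ ℕ) → ℂ) :
    ∫ a, F a ∂(randomRep p d n) = repAvg p d n F := by
  rw [randomRep, coe_repFin hp1 hd, uniformOn, ProbabilityTheory.cond, integral_smul_measure,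
    setIntegral_finset _ (integrableOn_count_finset _ F), Measure.count_apply_finset, repAvg]
  simp [Measure.real, div_eq_inv_mul]

theorem isProbabilityMeasure_randomRep (hne : (repFin p d n).Nonempty) :
    IsProbabilityMeasure (randomRep p d n) := by
  rw [randomRep, coe_repFin hp1 hd]
  exact isProbabilityMeasure_uniformOn (Finset.finite_toSet _) hne

theorem ofReal_meanWeight_sub (hne : (repFin p d n).Nonempty) (r : ℝ) :
    ((meanWeight p d n - ∑ h ∈ ppLe p n, digitQ d r h : ℝ) : ℂ)
      = repAvg p d n (fun a => ∑ h ∈ ppLe p n, ((nz (a h) - digitQ d r h : ℝ) : ℂ)) := by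
  rw [Complex.ofReal_sub, meanWeight, ← integral_complex_ofReal, integral_randomRep hp1 hd,
    ← repAvg_const hne ((∑ h ∈ ppLe p n, digitQ d r h : ℝ) : ℂ), ← repAvg_sub]
  refine repAvg_congr fun a ha => ?_
  rw [hammingWeight_eq_sum ha]
  push_cast
  rw [Finset.sum_sub_distrib]

/-- The second moment is taken about the tilted mean; the excess over the variance is the squared
bias. -/
theorem ofReal_varWeight_add (hne : (repFin p d n).Nonempty) (r : ℝ) :
    ((varWeight p d n + (meanWeight p d n - ∑ h ∈ ppLe p n, digitQ d r h) ^ 2 : ℝ) : ℂ)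
      = repAvg p d n (fun a => (∑ h ∈ ppLe p n, ((nz (a h) - digitQ d r h : ℝ) : ℂ)) ^ 2) := by
  have := isProbabilityMeasure_randomRep hp1 hd hne
  set A := ∑ h ∈ ppLe p n, digitQ d r h with hA
  have e : varWeight p d n + (meanWeight p d n - A) ^ 2
      = ∫ a, (hammingWeight a - A) ^ 2 ∂(randomRep p d n) := by
    rw [varWeight, variance_eq_integral measurable_from_top.aemeasurable]
    change ∫ a, (hammingWeight a - meanWeight p d n) ^ 2 ∂(randomRep p d n) + _ = _
    set μ := meanWeight p d n with hμ
    have e1 : ∀ a, (hammingWeight a - A) ^ 2 = (hammingWeight a - μ) ^ 2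
        + (2 * (μ - A) * (hammingWeight a - μ) + (μ - A) ^ 2) := fun a => by ring
    simp only [e1]
    have hi := fun F : (ℕ →₀ ℕ) → ℝ => integrable_randomRep hp1 hd hne F
    rw [integral_add (hi _) (hi _), integral_add (hi _) (hi _), integral_const_mul,
      integral_sub (hi _) (hi _)]
    have : ∫ a, hammingWeight a ∂(randomRep p d n) = μ := rfl
    simp [this]
  rw [e, ← integral_complex_ofReal, integral_randomRep hp1 hd]
  refine repAvg_congr fun a ha => ?_
  rw [hammingWeight_eq_sum ha, hA]
  push_cast
  rw [Finset.sum_sub_distrib]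

theorem charFun_map_randomRep (r μ σ s : ℝ) :
    charFun ((randomRep p d n).map fun a => (hammingWeight a - μ) / σ) s
      = Complex.exp ((s / σ * (∑ h ∈ ppLe p n, digitQ d r h - μ) : ℝ) * Complex.I) *
        repAvg p d n (fun a => ∏ h ∈ ppLe p n, charTest d r (s / σ) h (a h)) := by
  rw [charFun_apply_real, integral_map measurable_from_top.aemeasurable
    (Continuous.aestronglyMeasurable (by fun_prop)), integral_randomRep hp1 hd]
  simp only [repAvg]
  rw [← mul_div_assoc, Finset.mul_sum]
  congr 1
  refine Finset.sum_congr rfl fun a ha => ?_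
  simp only [charTest]
  rw [← Complex.exp_sum, ← Complex.exp_add, hammingWeight_eq_sum ha]
  congr 1
  rw [← Finset.sum_mul, ← add_mul]
  congr 1
  push_cast
  rw [← Finset.mul_sum, Finset.sum_sub_distrib]
  ring

end

/-! ### Asymptotics of mean and variance, and the Gaussian limit. -/

/-- Lévy's continuity theorem for a Gaussian limit, in terms of distribution functions. -/
theorem tendsto_measureReal_Iic_of_charFun {μ : ℕ → Measure ℝ}
    (hμ : ∀ᶠ n in atTop, IsProbabilityMeasure (μ n))
    (h : ∀ s : ℝ, Tendsto (fun n => charFun (μ n) s) atTop (𝓝 (Complex.exp (-(s : ℂ) ^ 2 / 2))))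
    (x : ℝ) :
    Tendsto (fun n => (μ n).real (Set.Iic x)) atTop (𝓝 ((gaussianReal 0 1).real (Set.Iic x))) := by
  classical
  let γ : ProbabilityMeasure ℝ := ⟨gaussianReal 0 1, inferInstance⟩
  let ν : ℕ → ProbabilityMeasure ℝ := fun n =>
    if hn : IsProbabilityMeasure (μ n) then ⟨μ n, hn⟩ else γ
  have hν : ∀ᶠ n in atTop, (ν n : Measure ℝ) = μ n := by
    filter_upwards [hμ] with n hn
    have : ν n = ⟨μ n, hn⟩ := dif_pos hn
    rw [this]
    rfl
  have hlim : Tendsto ν atTop (𝓝 γ) := by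
    rw [ProbabilityMeasure.tendsto_iff_tendsto_charFun]
    intro s
    have e : charFun (γ : Measure ℝ) s = Complex.exp (-(s : ℂ) ^ 2 / 2) := by
      change charFun (gaussianReal 0 1) s = _
      rw [charFun_gaussianReal]
      congr 1
      simp
      ring
    rw [e]
    refine (h s).congr' ?_
    filter_upwards [hν] with n hn
    rw [hn]
  have hnull : γ (frontier (Set.Iic x)) = 0 := by
    rw [frontier_Iic]
    have : (gaussianReal 0 1) {x} = 0 := by
      have := nullSingletonClass_gaussianReal (μ := 0) (v := 1) one_ne_zero
      exact measure_singleton x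
    rw [← ENNReal.coe_eq_zero, ProbabilityMeasure.ennreal_coeFn_eq_coeFn_toMeasure]
    exact this
  have := ProbabilityMeasure.tendsto_measure_of_null_frontier_of_tendsto hlim hnull
  have h2 := (NNReal.continuous_coe.tendsto _).comp this
  refine Tendsto.congr' ?_ h2
  filter_upwards [hν] with n hn
  rw [← hn]
  rfl

/-- The factor `log d` in `kappa` cancels, leaving the leading constant `1 / volConst p` of the
count of power products. -/
theorem kappa_mul_eq (p : Fin m → ℕ) {d : ℕ} (hd : 2 ≤ d) (c e : ℝ) (L : ℝ) :
    kappa p d * c / (e * Real.log d) * L = c / e * (L / volConst p) := by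
  have hl : Real.log d ≠ 0 := (Real.log_pos (by exact_mod_cast (by omega : 1 < d))).ne'
  rw [kappa, volConst, Finset.prod_div_distrib, Finset.prod_const_one]
  field_simp

section
variable {p : Fin m → ℕ} (hp1 : ∀ j, 1 < p j) (hpcop : ∀ i j, i ≠ j → Nat.Coprime (p i) (p j))
  {d : ℕ} (hd : 2 ≤ d) (hm : 2 ≤ m) {r : ℕ → ℝ} (hr : ∀ᶠ n in atTop, IsSaddle p d n (r n))
include hp1 hpcop hd hm hr

theorem abs_meanWeight_sub_le :
    ∃ C > 0, ∀ᶠ n : ℕ in atTop, |meanWeight p d n - ∑ h ∈ ppLe p n, digitQ d (r n) h|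
      ≤ C * Real.sqrt (Real.log n ^ (m - 1)) := by
  obtain ⟨C, hC, h⟩ := norm_repAvg_sum_le hp1 hpcop hd hm hr
  refine ⟨C, hC, ?_⟩
  filter_upwards [h, eventually_repFin_nonempty hp1 hpcop hd hm hr] with n h1 h2
  have := h1 (fun h c => nz c - digitQ d (r n) h) (fun h c => abs_nz_sub_digitQ_le hd c)
    fun h _ => sum_digitW_mul_nz_sub hd
  rwa [← ofReal_meanWeight_sub hp1 hd h2, Complex.norm_real, Real.norm_eq_abs] at this

theorem abs_varWeight_sub_le :
    ∃ C > 0, ∀ᶠ n : ℕ in atTop, |varWeight p d n - weightVar p d n (r n)|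
      ≤ C * Real.log n ^ (m - 1) := by
  obtain ⟨C1, hC1, h1⟩ := norm_repAvg_sq_sub_weightVar_le hp1 hpcop hd hm hr
  obtain ⟨C2, hC2, h2⟩ := abs_meanWeight_sub_le hp1 hpcop hd hm hr
  refine ⟨C1 + C2 ^ 2, by positivity, ?_⟩
  filter_upwards [h1, h2, eventually_repFin_nonempty hp1 hpcop hd hm hr, eventually_le_log 0]
    with n h1 h2 h3 h4
  rw [← ofReal_varWeight_add hp1 hd h3, ← Complex.ofReal_sub, Complex.norm_real,
    Real.norm_eq_abs] at h1
  set D := meanWeight p d n - ∑ h ∈ ppLe p n, digitQ d (r n) h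
  have h5 : D ^ 2 ≤ C2 ^ 2 * Real.log n ^ (m - 1) := by
    calc D ^ 2 = |D| ^ 2 := (sq_abs D).symm
      _ ≤ (C2 * Real.sqrt (Real.log n ^ (m - 1))) ^ 2 := by gcongr
      _ = _ := by rw [mul_pow, Real.sq_sqrt (by positivity)]
  have h6 := abs_le.1 h1
  rw [abs_le]
  constructor <;> nlinarith [sq_nonneg D]

omit hp1 hpcop hd hm hr in
theorem eventually_one_le_loglog : ∀ᶠ n : ℕ in atTop, 1 ≤ Real.log (Real.log n) :=
  (Real.tendsto_log_atTop.comp tendsto_log_natCast).eventually_ge_atTop 1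

theorem meanWeight_isBigO :
    (fun n : ℕ => meanWeight p d n - (d - 1) / d * (Real.log n ^ m / volConst p))
      =O[atTop] fun n : ℕ => Real.log n ^ (m - 1) * Real.log (Real.log n) := by
  obtain ⟨C1, hC1, h1⟩ := abs_meanWeight_sub_le hp1 hpcop hd hm hr
  obtain ⟨C2, hC2, h2⟩ := sum_digitQ_asymp hp1 hpcop hd hm
  refine IsBigO.of_bound (C1 + C2) ?_
  filter_upwards [h1, h2, hr, eventually_le_log 1, eventually_one_le_loglog] with n h1 h2 h3 h4 h5
  have h2 := h2 _ h3
  have h6 : 1 ≤ Real.log n ^ (m - 1) := one_le_pow₀ h4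
  have h7 : Real.sqrt (Real.log n ^ (m - 1)) ≤ Real.log n ^ (m - 1) * Real.log (Real.log n) := by
    rw [Real.sqrt_le_left (by positivity), mul_pow]
    nlinarith [mul_le_mul h6 h6 zero_le_one (by linarith), one_le_pow₀ (n := 2) h5]
  rw [Real.norm_eq_abs, Real.norm_of_nonneg (by positivity)]
  refine (abs_sub_le _ (∑ h ∈ ppLe p n, digitQ d (r n) h) _).trans ?_
  calc _ ≤ C1 * (Real.log n ^ (m - 1) * Real.log (Real.log n))
        + C2 * (Real.log n ^ (m - 1) * Real.log (Real.log n)) :=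
        add_le_add (h1.trans (by gcongr)) h2
    _ = _ := by ring

theorem varWeight_isBigO :
    (fun n : ℕ => varWeight p d n - (d - 1) / d ^ 2 * (Real.log n ^ m / volConst p))
      =O[atTop] fun n : ℕ => Real.log n ^ (m - 1) * Real.log (Real.log n) := by
  obtain ⟨C1, hC1, h1⟩ := abs_varWeight_sub_le hp1 hpcop hd hm hr
  obtain ⟨C2, hC2, h2⟩ := weightVar_asymp hp1 hpcop hd hm
  refine IsBigO.of_bound (C1 + C2) ?_
  filter_upwards [h1, h2, hr, eventually_le_log 1, eventually_one_le_loglog] with n h1 h2 h3 h4 h5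
  have h2 := h2 _ h3
  have h7 : Real.log n ^ (m - 1) ≤ Real.log n ^ (m - 1) * Real.log (Real.log n) :=
    le_mul_of_one_le_right (by positivity) h5
  rw [Real.norm_eq_abs, Real.norm_of_nonneg (by positivity)]
  refine (abs_sub_le _ (weightVar p d n (r n)) _).trans ?_
  calc _ ≤ C1 * (Real.log n ^ (m - 1) * Real.log (Real.log n))
        + C2 * (Real.log n ^ (m - 1) * Real.log (Real.log n)) :=
        add_le_add (h1.trans (by gcongr)) h2
    _ = _ := by ring

theorem tendsto_log_pow_div_weightVar (C : ℝ) :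
    Tendsto (fun n : ℕ => C * Real.log n ^ (m - 1) / weightVar p d n (r n)) atTop (𝓝 0) := by
  obtain ⟨c, hc, h⟩ := weightVar_lower hp1 hpcop hd hm
  have h1 : Tendsto (fun n : ℕ => |C| / c / Real.log n) atTop (𝓝 0) :=
    tendsto_const_nhds.div_atTop tendsto_log_natCast
  refine squeeze_zero_norm' ?_ h1
  filter_upwards [h, hr, eventually_le_log 1] with n h1 h2 h3
  have h1 := h1 _ h2
  have hL : 0 < Real.log n := by linarith
  have hw : 0 < weightVar p d n (r n) := lt_of_lt_of_le (by positivity) h1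
  rw [Real.norm_eq_abs, abs_div, abs_of_pos hw, abs_mul, abs_of_nonneg (by positivity : 0 ≤ Real.log n ^ (m - 1)),
    div_le_iff₀ hw]
  calc |C| * Real.log n ^ (m - 1) = |C| / c / Real.log n * (c * Real.log n ^ m) := by
        rw [← Nat.sub_add_cancel (show 1 ≤ m by omega), pow_succ]
        simp only [add_tsub_cancel_right]
        field_simp
    _ ≤ _ := by gcongr

theorem eventually_weightVar_pos : ∀ᶠ n in atTop, 0 < weightVar p d n (r n) := by
  obtain ⟨c, hc, h⟩ := weightVar_lower hp1 hpcop hd hm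
  filter_upwards [h, hr, eventually_le_log 1] with n h1 h2 h3
  exact lt_of_lt_of_le (by positivity) (h1 _ h2)

theorem tendsto_varWeight_div_weightVar :
    Tendsto (fun n : ℕ => varWeight p d n / weightVar p d n (r n)) atTop (𝓝 1) := by
  obtain ⟨C, hC, h⟩ := abs_varWeight_sub_le hp1 hpcop hd hm hr
  rw [tendsto_iff_norm_sub_tendsto_zero]
  refine squeeze_zero' (Eventually.of_forall fun _ => norm_nonneg _) ?_
    (tendsto_log_pow_div_weightVar hp1 hpcop hd hm hr C)
  filter_upwards [h, eventually_weightVar_pos hp1 hpcop hd hm hr] with n h1 h2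
  rw [Real.norm_eq_abs, div_sub_one h2.ne', abs_div, abs_of_pos h2]
  gcongr

theorem tendsto_sq_div_sqrt_varWeight_mul (s : ℝ) :
    Tendsto (fun n => (s / Real.sqrt (varWeight p d n)) ^ 2 * weightVar p d n (r n)) atTop
      (𝓝 (s ^ 2)) := by
  have h := ((tendsto_varWeight_div_weightVar hp1 hpcop hd hm hr).inv₀ one_ne_zero).const_mul
    (s ^ 2)
  rw [inv_one, mul_one] at h
  refine h.congr fun n => ?_
  have h0 : 0 ≤ varWeight p d n := variance_nonneg _ _
  rw [div_pow, Real.sq_sqrt h0, inv_div]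
  ring

/-- Divide the local limit theorem at `s / σ` by the one at `0`: the factors `√V` and `√(2π)`
cancel. Recentring from the tilted mean to the true mean costs a phase of order `(log n) ^ (-1 /
2)`. -/
theorem tendsto_charFun_normalized (s : ℝ) :
    Tendsto (fun n => charFun ((randomRep p d n).map fun a =>
      (hammingWeight a - meanWeight p d n) / Real.sqrt (varWeight p d n)) s) atTop
      (𝓝 (Complex.exp (-(s : ℂ) ^ 2 / 2))) := by
  have hsn := tendsto_sq_div_sqrt_varWeight_mul hp1 hpcop hd hm hr s
  have hnum := tendsto_integral_fourierProd hp1 hpcop hd hm hr hsn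
  have hden := tendsto_integral_fourierProd_one hp1 hpcop hd hm hr
  have hpi : (0 : ℝ) < Real.sqrt (2 * Real.pi) := Real.sqrt_pos.2 (by positivity)
  have hquot := hnum.div hden (by exact_mod_cast hpi.ne')
  -- the phase coming from the difference of the two means
  have hphase : Tendsto (fun n => s / Real.sqrt (varWeight p d n) *
      (∑ h ∈ ppLe p n, digitQ d (r n) h - meanWeight p d n)) atTop (𝓝 0) := by
    obtain ⟨C, hC, hmean⟩ := abs_meanWeight_sub_le hp1 hpcop hd hm hr
    have h1 := hsn.mul (tendsto_log_pow_div_weightVar hp1 hpcop hd hm hr (C ^ 2))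
    rw [mul_zero] at h1
    have h2 : Tendsto (fun n => (s / Real.sqrt (varWeight p d n) *
        (∑ h ∈ ppLe p n, digitQ d (r n) h - meanWeight p d n)) ^ 2) atTop (𝓝 0) := by
      refine squeeze_zero' (Eventually.of_forall fun _ => sq_nonneg _) ?_ h1
      filter_upwards [hmean, eventually_weightVar_pos hp1 hpcop hd hm hr, eventually_le_log 0]
        with n h3 h4 h5
      set D := ∑ h ∈ ppLe p n, digitQ d (r n) h - meanWeight p d n with hD
      have h6 : D ^ 2 ≤ C ^ 2 * Real.log n ^ (m - 1) := by
        calc D ^ 2 = |D| ^ 2 := (sq_abs D).symm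
          _ ≤ (C * Real.sqrt (Real.log n ^ (m - 1))) ^ 2 := by
            rw [hD, abs_sub_comm]; gcongr
          _ = _ := by rw [mul_pow, Real.sq_sqrt (by positivity)]
      calc (s / Real.sqrt (varWeight p d n) * D) ^ 2
          = (s / Real.sqrt (varWeight p d n)) ^ 2 * D ^ 2 := mul_pow _ _ _
        _ ≤ (s / Real.sqrt (varWeight p d n)) ^ 2 * (C ^ 2 * Real.log n ^ (m - 1)) := by gcongr
        _ = _ := by field_simp
    refine (tendsto_zero_iff_abs_tendsto_zero _).2 ?_
    have h3 := h2.sqrt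
    rw [Real.sqrt_zero] at h3
    exact h3.congr fun n => Real.sqrt_sq_eq_abs _
  have hexp : Tendsto (fun n => Complex.exp ((s / Real.sqrt (varWeight p d n) *
      (∑ h ∈ ppLe p n, digitQ d (r n) h - meanWeight p d n) : ℝ) * Complex.I)) atTop (𝓝 1) := by
    have h1 : Continuous fun x : ℝ => Complex.exp (x * Complex.I) := by fun_prop
    have h2 := (h1.tendsto 0).comp hphase
    rwa [Complex.ofReal_zero, zero_mul, Complex.exp_zero] at h2
  have hlim := hexp.mul hquot
  have e : (1 : ℂ) * (((Real.sqrt (2 * Real.pi) * Real.exp (-s ^ 2 / 2) : ℝ) : ℂ) /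
      ((Real.sqrt (2 * Real.pi) : ℝ) : ℂ)) = Complex.exp (-(s : ℂ) ^ 2 / 2) := by
    rw [one_mul, ← Complex.ofReal_div, mul_div_cancel_left₀ _ hpi.ne']
    push_cast
    rfl
  rw [e] at hlim
  refine hlim.congr' ?_
  filter_upwards [hr, eventually_repFin_nonempty hp1 hpcop hd hm hr,
    eventually_sumVar_pos hp1 hpcop hd hm hr] with n h1 h2 h3
  have h4 : ((Real.sqrt (sumVar p d n (r n)) : ℝ) : ℂ) ≠ 0 := by
    exact_mod_cast (Real.sqrt_pos.2 h3).ne'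
  rw [charFun_map_randomRep hp1 hd (r n), repAvg_prod hd h1 h2, Pi.div_apply, mul_div_mul_left _ _ h4]

end

end MultiBase

theorem theorem4 (d m : ℕ) (hd : 2 ≤ d) (hm : 2 ≤ m) (p : Fin m → ℕ)
    (hp1 : ∀ j, 1 < p j) (hpmono : StrictMono p)
    (hpcop : ∀ i j, i ≠ j → Nat.Coprime (p i) (p j)) :
    (∀ᶠ n : ℕ in atTop, (MultiBase.representations p d n).Nonempty) ∧
    (∀ x : ℝ, Tendsto
      (fun n : ℕ => (MultiBase.randomRep p d n).real
        {a | (MultiBase.hammingWeight a - MultiBase.meanWeight p d n) /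
          Real.sqrt (MultiBase.varWeight p d n) ≤ x})
      atTop (𝓝 ((gaussianReal 0 1).real (Set.Iic x)))) ∧
    ((fun n : ℕ => MultiBase.meanWeight p d n -
        MultiBase.kappa p d * ((d : ℝ) - 1) / ((d : ℝ) * Real.log d) * Real.log n ^ m)
      =O[atTop] (fun n : ℕ => Real.log n ^ (m - 1) * Real.log (Real.log n))) ∧
    ((fun n : ℕ => MultiBase.varWeight p d n -
        MultiBase.kappa p d * ((d : ℝ) - 1) / ((d : ℝ) ^ 2 * Real.log d) * Real.log n ^ m)
      =O[atTop] (fun n : ℕ => Real.log n ^ (m - 1) * Real.log (Real.log n))) := by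
  classical
  obtain ⟨r, hr⟩ : ∃ r : ℕ → ℝ, ∀ᶠ n in atTop, MultiBase.IsSaddle p d n (r n) := by
    refine ⟨fun n => if h : ∃ r, MultiBase.IsSaddle p d n r then h.choose else 0, ?_⟩
    filter_upwards [MultiBase.eventually_exists_saddle hp1 hpcop hd hm] with n hn
    rw [dif_pos hn]
    exact hn.choose_spec
  have hne := MultiBase.eventually_repFin_nonempty hp1 hpcop hd hm hr
  refine ⟨?_, fun x => ?_, ?_, ?_⟩
  · filter_upwards [hne] with n hn
    rwa [MultiBase.coe_repFin hp1 hd, Finset.coe_nonempty]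
  · have hprob : ∀ᶠ n in atTop, IsProbabilityMeasure ((MultiBase.randomRep p d n).map fun a =>
        (MultiBase.hammingWeight a - MultiBase.meanWeight p d n) /
          Real.sqrt (MultiBase.varWeight p d n)) := by
      filter_upwards [hne] with n hn
      have := MultiBase.isProbabilityMeasure_randomRep hp1 hd hn
      exact Measure.isProbabilityMeasure_map measurable_from_top.aemeasurable
    refine (MultiBase.tendsto_measureReal_Iic_of_charFun hprob
      (fun s => MultiBase.tendsto_charFun_normalized hp1 hpcop hd hm hr s) x).congr fun n => ?_
    rw [map_measureReal_apply measurable_from_top measurableSet_Iic]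
    rfl
  · simp only [MultiBase.kappa_mul_eq p hd]
    exact MultiBase.meanWeight_isBigO hp1 hpcop hd hm hr
  · simp only [MultiBase.kappa_mul_eq p hd]
    exact MultiBase.varWeight_isBigO hp1 hpcop hd hm hr
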